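/- **Setting.** Fix $n=N+2\ge 3$ second-price auctions. A valuation distribution $\nu$ is a probability law with CDF $F$, supported on $[v_L,v_H]$ with $0\le v_L<v_H\le\infty$, whose CDF is strictly increasing on the support and which has a density $f=F'$ continuous on the interior of the support. For each $K$, auction $j$ has $K_j$ bidders, where $K=\min_jK_j$ and $K_j/K\to1$ as $K\to\infty$; all valuations are independent with law $\nu$, and the price $P_j$ is the second-highest valuation in auction $j$; $\mathbf P=(P_1,\dots,P_n)$. We say that $F$ is in the domain of attraction with tail index $\xi\in\mathbb R$ if there are $a_K>0$, $b_K\in\mathbb R$ with $F(a_Kx+b_K)^K\to G_\xi(x)$ at all continuity points $x$ of $G_\xi$, where $G_\xi$ is the generalized extreme value CDF, $G_\xi(x)=\exp(-(1+\xi x)^{-1/\xi})$ where $1+\xi x>0$ ($\xi\neq0$; elsewhere $0$ if $\xi>0$ and $1$ if $\xi<0$) and $G_0(x)=\exp(-e^{-x})$. Let $P_{(1)}\le\dots\le P_{(n)}$ be the sorted prices and $\tilde P_j=(P_{(j+1)}-P_{(1)})/(P_{(n)}-P_{(1)})$, $j=1,\dots,N$ (all $0$ if $P_{(n)}=P_{(1)}$).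 Let $Z_1,\dots,Z_n$ be i.i.d. copies of $H_\xi(E_1+E_2)$, with $E_1,E_2$ independent standard exponential, $H_\xi(x)=(x^{-\xi}-1)/\xi$ for $\xi\ne0$, $H_0(x)=-\ln x$. The sorted, self-normalized $\tilde{\mathbf Z}$ has, on $0\le z_1\le\dots\le z_N\le1$, the density $$f_\xi(z)=(N+2)!\,\Gamma(2(N+2))\int_0^{b(\xi)}s^N\Big(1+\sum_{j=1}^N(1+z_j\xi s)^{-1/\xi}+(1+\xi s)^{-1/\xi}\Big)^{-2(N+2)}\Big((1+\xi s)\prod_{j=1}^N(1+z_j\xi s)\Big)^{-(1+2/\xi)}ds,$$ with $b(\xi)=-1/\xi$ for $\xi<0$ and $b(\xi)=\infty$ for $\xi>0$; for $\xi=0$, $$f_0(z)=(N+2)!\,\Gamma(2(N+2))\int_0^\infty s^N\Big(1+\sum_{j=1}^N e^{-z_js}+e^{-s}\Big)^{-2(N+2)}e^{-2s(1+\sum_jz_j)}\,ds.$$ Let $\xi_0\ne\xi_1$ be real and $\alpha\in(0,1)$, and consider $H_0:\xi=\xi_0$ against $H_1:\xi=\xi_1$. The likelihood-ratio test is $\varphi^*(\mathbf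 P)=1[f_{\xi_1}(\tilde{\mathbf P})/f_{\xi_0}(\tilde{\mathbf P})>q]$, with $q$ the $(1-\alpha)$-quantile of $f_{\xi_1}(\tilde{\mathbf Z}_0)/f_{\xi_0}(\tilde{\mathbf Z}_0)$, $\tilde{\mathbf Z}_0\sim f_{\xi_0}$. A price process with tail index $\xi$ is any sequence (in $K$) of joint laws of $\mathbf P\in\mathbb R^n$ for which some constants $a_K>0$, $b_K$ satisfy $((P_j-b_K)/a_K)_{j\le n}\to_d(Z_1,\dots,Z_n)$. An equivariant test is a sequence of measurable $\varphi_K:\mathbb R^n\to[0,1]$ with $\varphi_K$ unchanged when the prices are permuted, shifted, or multiplied by a positive constant. It is asymptotically valid if $\limsup_KE[\varphi_K(\mathbf P)]\le\alpha$ for every price process with tail index $\xi_0$. **Theorem.** 1. For every real $\xi$, the prices of the auctions above with $F$ in the domain of attraction with tail index $\xi$ form a price process with tail index $\xi$. If $\xi=\xi_0$, then $\lim_{K\to\infty}E[\varphi^*(\mathbf P)]=\alpha$. Moreover, $\varphi^*$ is an asymptotically valid equivariant test. 2. For every asymptotically valid equivariant test $(\varphi_K)$, and all auctions above with $F$ in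 the domain of attraction with tail index $\xi_1$, $\limsup_KE[\varphi_K(\mathbf P)]\le\limsup_KE[\varphi^*(\mathbf P)]$. 3. Let $F_0,F_1$ be valuation CDFs in the domains of attraction with tail indices $\xi_0,\xi_1$ and suppose that, with suitable normalizing constants, the densities of the normalized maxima also converge, that is, $\frac{d}{dx}F_i(a_Kx+b_K)^K\to G_{\xi_i}'(x)$ for almost every $x$ ($i=0,1$). Then for every equivariant test with $\limsup_KE_{F_0}[\varphi_K(\mathbf P)]\le\alpha$ in the auctions with valuation CDF $F_0$ (for some admissible numbers of bidders), the inequality of part 2 holds for the auctions with valuation CDF $F_1$ (for all admissible numbers of bidders). -/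

import Mathlib

open MeasureTheory ProbabilityTheory Filter Topology Set

noncomputable section

namespace Auction

/-! ### Extreme value distributions -/

/-- The generalized extreme value CDF `G_ξ`. -/
def gev (ξ x : ℝ) : ℝ :=
  if ξ = 0 then Real.exp (-Real.exp (-x))
  else if 0 < 1 + ξ * x then Real.exp (-(1 + ξ * x) ^ (-1 / ξ))
  else if ξ < 0 then 1 else 0

/-- `H_ξ(x) = (x ^ (-ξ) - 1) / ξ` for `ξ ≠ 0` and `-ln x` for `ξ = 0`. -/
def hFun (ξ x : ℝ) : ℝ :=
  if ξ = 0 then -Real.log x else (x ^ (-ξ) - 1) / ξ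

theorem measurable_hFun (ξ : ℝ) : Measurable (hFun ξ) := by
  unfold hFun
  by_cases h : ξ = 0
  · simp only [h, if_true]
    exact Real.measurable_log.neg
  · simp only [h, if_false]
    exact ((measurable_id.pow_const (-ξ)).sub_const 1).div_const ξ

/-- The law of `H_ξ(E₁ + E₂)` with `E₁, E₂` independent standard exponential variables. -/
def limitLaw (ξ : ℝ) : Measure ℝ :=
  ((expMeasure 1).prod (expMeasure 1)).map (fun e : ℝ × ℝ => hFun ξ (e.1 + e.2))

/-! ### Valuations, auctions and prices -/

/-- `ν` is a valuation distribution: it is supported on `[v_L, v_H]` with `0 ≤ v_L < v_H ≤ ∞`, its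
CDF is strictly increasing there, and it has a density (the derivative of the CDF) that is
continuous on the interior of the support. -/
structure IsValuationLaw (ν : Measure ℝ) : Prop where
  isProb : IsProbabilityMeasure ν
  absCont : ν ≪ (volume : Measure ℝ)
  exists_support : ∃ (vL : ℝ) (vH : EReal), 0 ≤ vL ∧ (vL : EReal) < vH ∧
    ν {v : ℝ | vL ≤ v ∧ (v : EReal) ≤ vH}ᶜ = 0 ∧
    StrictMonoOn (fun v => cdf ν v) {v : ℝ | vL ≤ v ∧ (v : EReal) ≤ vH} ∧
    DifferentiableOn ℝ (fun v => cdf ν v) {v : ℝ | vL < v ∧ (v : EReal) < vH} ∧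
    ContinuousOn (deriv (fun v => cdf ν v)) {v : ℝ | vL < v ∧ (v : EReal) < vH}

/-- `a, b` are normalizing constants for which `F_ν(a_K x + b_K) ^ K → G_ξ(x)` at every continuity
point `x` of `G_ξ`. -/
def IsNormalizing (ν : Measure ℝ) (ξ : ℝ) (a b : ℕ → ℝ) : Prop :=
  (∀ K, 0 < a K) ∧
    ∀ x, ContinuousAt (gev ξ) x →
      Tendsto (fun K : ℕ => (cdf ν (a K * x + b K)) ^ K) atTop (𝓝 (gev ξ x))

/-- `ν` is in the domain of attraction of `G_ξ`. -/
def InDomain (ν : Measure ℝ) (ξ : ℝ) : Prop :=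
  ∃ a b : ℕ → ℝ, IsNormalizing ν ξ a b

/-- `ν` is in the domain of attraction of `G_ξ`, and moreover the densities of the normalized maxima
converge almost everywhere to the density of `G_ξ`. -/
def InLocalDomain (ν : Measure ℝ) (ξ : ℝ) : Prop :=
  ∃ a b : ℕ → ℝ, IsNormalizing ν ξ a b ∧
    ∀ᵐ x : ℝ, Tendsto (fun K : ℕ => deriv (fun y : ℝ => (cdf ν (a K * y + b K)) ^ K) x)
      atTop (𝓝 (deriv (gev ξ) x))

/-- Numbers of bidders `k K j` in auction `j`, indexed by `K = min_j k K j`, with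
`k K j / K → 1`. -/
def IsBidderArray {n : ℕ} (k : ℕ → Fin n → ℕ) : Prop :=
  (∀ K, (∀ j, K ≤ k K j) ∧ ∃ j, k K j = K) ∧
    ∀ j, Tendsto (fun K : ℕ => (k K j : ℝ) / (K : ℝ)) atTop (𝓝 1)

/-- The `r`-th smallest entry of `x`, counted from `r = 0` (junk value `0` for `r ≥ m`). -/
def orderStat {m : ℕ} (x : Fin m → ℝ) (r : ℕ) : ℝ :=
  if h : r < m then x (Tuple.sort x ⟨r, h⟩) else 0

theorem measurable_orderStat {m : ℕ} (r : ℕ) :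
    Measurable (fun x : Fin m → ℝ => orderStat x r) := by
  by_cases h : r < m
  · refine measurable_of_Iic fun c => ?_
    have key : (fun x : Fin m → ℝ => orderStat x r) ⁻¹' Iic c =
        {x | r < (∑ i : Fin m, if x i ≤ c then 1 else 0 : ℕ)} := by
      ext x
      have h1 := Tuple.lt_card_le_iff_apply_le_of_monotone (f := x ∘ Tuple.sort x) (a := c)
        (j := ⟨r, h⟩) (Tuple.monotone_sort x)
      have h2 : Fintype.card {i : Fin m // (x ∘ Tuple.sort x) i ≤ c} =
          Fintype.card {i : Fin m // x i ≤ c} :=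
        Fintype.card_congr ((Tuple.sort x).subtypeEquiv fun _ => Iff.rfl)
      simp only [mem_preimage, mem_Iic, mem_ofPred_eq, orderStat, h, dif_pos]
      rw [Finset.sum_boole, ← Fintype.card_subtype]
      simp only [Nat.cast_id]
      rw [← h2, Fintype.card_subtype]
      exact h1.symm
    rw [key]
    refine measurableSet_lt measurable_const (Finset.measurable_sum _ fun i _ => ?_)
    exact Measurable.ite (measurableSet_le (measurable_pi_apply i) measurable_const)
      measurable_const measurable_const
  · simp only [orderStat, h, dif_neg, not_false_eq_true]
    exact measurable_const

/-- The joint law of all valuations: independent draws from `ν`, with `k j` bidders in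
auction `j`. -/
def valuationLaw {n : ℕ} (ν : Measure ℝ) (k : Fin n → ℕ) :
    Measure ((j : Fin n) → Fin (k j) → ℝ) :=
  Measure.pi fun j => Measure.pi fun _ : Fin (k j) => ν

/-- The transaction price of a second-price auction: the second-highest valuation. -/
def secondPrice {m : ℕ} (v : Fin m → ℝ) : ℝ := orderStat v (m - 2)

/-- The joint law of the transaction prices `P = (P_1, …, P_n)` of the `n` auctions. -/
def priceLaw {n : ℕ} (ν : Measure ℝ) (k : Fin n → ℕ) : Measure (Fin n → ℝ) :=
  (valuationLaw ν k).map fun v j => secondPrice (v j)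

theorem measurable_prices {n : ℕ} (k : Fin n → ℕ) :
    Measurable (fun (v : (j : Fin n) → Fin (k j) → ℝ) (j : Fin n) => secondPrice (v j)) :=
  measurable_pi_lambda _ fun j => (measurable_orderStat _).comp (measurable_pi_apply j)

/-- The sorted and self-normalized prices `(P_(j+1) - P_(1)) / (P_(n) - P_(1))`, `j = 1, …, N`,
where `n = N + 2`; they are `0` if all prices coincide. -/
def selfNorm {N : ℕ} (p : Fin (N + 2) → ℝ) (j : Fin N) : ℝ :=
  if orderStat p 0 < orderStat p (N + 1) then
    (orderStat p ((j : ℕ) + 1) - orderStat p 0) / (orderStat p (N + 1) - orderStat p 0)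
  else 0

/-! ### The limiting density and the likelihood-ratio test -/

/-- The joint density, on `0 ≤ z_1 ≤ … ≤ z_N ≤ 1`, of the sorted and self-normalized version of
`N + 2` independent draws from `limitLaw ξ`. -/
def limitDensity {N : ℕ} (ξ : ℝ) (z : Fin N → ℝ) : ℝ :=
  open scoped Classical in
  if (∀ j, 0 ≤ z j ∧ z j ≤ 1) ∧ Monotone z then
    (Nat.factorial (N + 2) : ℝ) * Real.Gamma (2 * (N + 2)) *
      (if ξ = 0 then
        ∫ s in Ioi (0 : ℝ), s ^ N * Real.exp
          (-2 * (N + 2) * Real.log (1 + (∑ j, Real.exp (-(z j) * s)) + Real.exp (-s))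
            - 2 * s * ((∑ j, z j) + 1))
      else
        ∫ s in (if ξ < 0 then Ioo 0 (-1 / ξ) else Ioi (0 : ℝ)), s ^ N * Real.exp
          (-2 * (N + 2) * Real.log
              (1 + (∑ j, (1 + z j * ξ * s) ^ (-1 / ξ)) + (1 + ξ * s) ^ (-1 / ξ))
            - (1 + 2 / ξ) * ((∑ j, Real.log (1 + z j * ξ * s)) + Real.log (1 + ξ * s))))
  else 0

/-- The likelihood ratio `f_{ξ₁} / f_{ξ₀}`. -/
def likelihoodRatio {N : ℕ} (ξ₀ ξ₁ : ℝ) (z : Fin N → ℝ) : ℝ :=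
  limitDensity ξ₁ z / limitDensity ξ₀ z

/-- The critical value: the `(1 - α)`-quantile of the likelihood ratio under the density
`f_{ξ₀}`. -/
def critValue (N : ℕ) (ξ₀ ξ₁ α : ℝ) : ℝ :=
  sInf {t : ℝ | 1 - α ≤
    ((volume : Measure (Fin N → ℝ)).withDensity
      fun z => ENNReal.ofReal (limitDensity ξ₀ z)).real {z | likelihoodRatio ξ₀ ξ₁ z ≤ t}}

/-- The likelihood-ratio test `1[f_{ξ₁}(P̃) / f_{ξ₀}(P̃) > q(ξ₀, ξ₁, α)]`. -/
def lrTest {N : ℕ} (ξ₀ ξ₁ α : ℝ) (p : Fin (N + 2) → ℝ) : ℝ :=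
  open scoped Classical in
  if critValue N ξ₀ ξ₁ α < likelihoodRatio ξ₀ ξ₁ (selfNorm p) then 1 else 0

/-! ### Tests and their asymptotic validity -/

/-- A sequence of (possibly randomized) equivariant tests: rejection probabilities that do not
change when the prices are permuted, shifted, or rescaled by a positive constant. -/
structure IsEquivariantTest {n : ℕ} (φ : ℕ → (Fin n → ℝ) → ℝ) : Prop where
  meas : ∀ K, Measurable (φ K)
  mem_Icc : ∀ K p, φ K p ∈ Icc (0 : ℝ) 1
  equivariant : ∀ K (σ : Equiv.Perm (Fin n)) (c d : ℝ) (p : Fin n → ℝ), 0 < c →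
    φ K (fun j => c * p (σ j) + d) = φ K p

/-- `P` is a data generating process with tail index `ξ`: a sequence of joint laws of the `n`
transaction prices such that, for some normalizing constants, `((P_j - b_K) / a_K)_j` converges in
distribution to `n` independent draws from `limitLaw ξ`. -/
def IsPriceModel {n : ℕ} (ξ : ℝ) (P : ℕ → Measure (Fin n → ℝ)) : Prop :=
  (∀ K, IsProbabilityMeasure (P K)) ∧
    ∃ a b : ℕ → ℝ, (∀ K, 0 < a K) ∧
      ∀ g : BoundedContinuousFunction (Fin n → ℝ) ℝ,
        Tendsto (fun K => ∫ p, g (fun j => (p j - b K) / a K) ∂(P K)) atTop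
          (𝓝 (∫ x, g x ∂(Measure.pi fun _ : Fin n => limitLaw ξ)))

/-- The tests have asymptotic rejection probability at most `α` under the price laws `P`. -/
def ValidUnder {n : ℕ} (α : ℝ) (φ : ℕ → (Fin n → ℝ) → ℝ) (P : ℕ → Measure (Fin n → ℝ)) : Prop :=
  limsup (fun K => ∫ p, φ K p ∂(P K)) atTop ≤ α

/-- Asymptotic validity for `H₀ : ξ = ξ₀` at level `α`: the asymptotic rejection probability is at
most `α` under every data generating process with tail index `ξ₀`. -/
def IsAsymptoticallyValid {n : ℕ} (ξ₀ α : ℝ) (φ : ℕ → (Fin n → ℝ) → ℝ) : Prop :=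
  ∀ P : ℕ → Measure (Fin n → ℝ), IsPriceModel ξ₀ P → ValidUnder α φ P

end Auction

end

noncomputable section

namespace Auction


/-! Apart from ties, `selfNorm` is a maximal invariant under permutations and positive affine maps.
An equivariant test therefore depends on the prices only through it
(`IsEquivariantTest.apply_eq_addEnds`), and the limit problem is to test one density on the open
simplex against another.

The densities. Write τ = exp(-`gevLog`), so that G = exp(-τ) on its support and H is the inverse of
τ. The identity H(u τ(y)) = H(u) + u^(-ξ) y (`hFun_mul_exp`) turns scaling of the gamma variables E₁
+ E₂ into an affine map of prices. If t is the gamma variable of the lowest price, the others are t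
τ(s z_j) and t τ(s), where z is the self-normalized vector and s is a multiple of the range.
`lintegral_pi_limitLaw` is this change of variables; integrating out t is a Gamma integral and
leaves f_ξ.

Exact size. For a quantile to give size exactly α, and for the rejection indicator to be almost
everywhere continuous in the limit, f_ξ₁/f_ξ₀ must have no atoms (`volume_limitDensity_eq_mul`). The
formula for f_ξ extends from ordered vectors to the whole open cube and is analytic in each
coordinate there, so f_ξ₁ - c f_ξ₀ vanishes on a null set or identically. The latter would make the
two laws equal, whereas the mean of the first self-normalized spacing is strictly decreasing in ξ
(`selfNormLaw_ne_of_lt`). Weak convergence of normalized prices (`isPriceModel_priceLaw`) and the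
continuous mapping theorem then give the limiting rejection probabilities.

Optimality. Let r = min(f_ξ₀/f_ξ₁, 1/q) (`capRatio`). Every test satisfies φ ≤ (1 - q r) + q r φ,
and (1 - q r) f_ξ₁ is the positive part of f_ξ₁ - q f_ξ₀, so it remains to see that the integral of
r φ is asymptotically at most α. Given prices of index ξ₁, `matchedLaw` keeps the law of their
self-normalization, weighted by r, and redraws order, location and scale from the conditional limit
law of index ξ₀; the missing mass is added from that limit law. If the self-normalization has its
limit law, the result is exactly the limit law of index ξ₀ (`matchedLaw_selfNormLaw`). Hence the
matched laws, normalized to mass one, are a price process of index ξ₀, to which asymptotic validity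
applies, and they dominate the integral of r φ (`ofReal_integral_capRatio_mul_le`).

Convergent densities. If the densities of normalized maxima converge, so do those of normalized
prices (`tendsto_normDensity`), and Scheffé's lemma gives convergence in total variation. Each φ K
may then be evaluated under the limit laws with vanishing error, and the same inequality is applied
there for every K. -/

/-! ### The reduced variate of the generalized extreme value law -/

/-- `-log (-log G_ξ(y))` on the support of `G_ξ`. -/
def gevLog (ξ y : ℝ) : ℝ := if ξ = 0 then y else Real.log (1 + ξ * y) / ξ

/-- The interior of the support of `G_ξ`. -/
def gevDom (ξ : ℝ) : Set ℝ := {y | 0 < 1 + ξ * y}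

/-- The positive part of the interior of the support of `G_ξ`. -/
def gapDom (ξ : ℝ) : Set ℝ := {y | 0 < y ∧ 0 < 1 + ξ * y}

theorem isOpen_gevDom (ξ : ℝ) : IsOpen (gevDom ξ) :=
  isOpen_lt continuous_const (by fun_prop)

theorem isOpen_gapDom (ξ : ℝ) : IsOpen (gapDom ξ) :=
  (isOpen_lt continuous_const continuous_id).inter (isOpen_gevDom ξ)

theorem gapDom_subset (ξ : ℝ) : gapDom ξ ⊆ gevDom ξ := fun _ h => h.2

theorem measurable_gevLog (ξ : ℝ) : Measurable (gevLog ξ) := by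
  unfold gevLog
  split_ifs <;> fun_prop

@[simp] theorem gevLog_zero (ξ : ℝ) : gevLog ξ 0 = 0 := by simp [gevLog]

theorem zero_mem_gevDom (ξ : ℝ) : (0 : ℝ) ∈ gevDom ξ := by simp [gevDom]

theorem mul_mem_gevDom {ξ s z : ℝ} (hs : s ∈ gapDom ξ) (h0 : 0 ≤ z) (h1 : z ≤ 1) :
    z * s ∈ gevDom ξ := by
  obtain ⟨hs, hs'⟩ := hs
  simp only [gevDom, mem_ofPred_eq]
  have e : 1 + ξ * (z * s) = (1 - z) + z * (1 + ξ * s) := by ring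
  rw [e]
  rcases h0.eq_or_lt with rfl | h0
  · simp
  · nlinarith [mul_pos h0 hs']

theorem mul_mem_gapDom {ξ s z : ℝ} (hs : s ∈ gapDom ξ) (h0 : 0 < z) (h1 : z ≤ 1) :
    z * s ∈ gapDom ξ := ⟨mul_pos h0 hs.1, mul_mem_gevDom hs h0.le h1⟩

/-- Expressing `1 + ξ * y` through `gevLog` lets most later formulas treat zero and nonzero tail
index alike. -/
theorem exp_mul_gevLog {ξ y : ℝ} (hy : y ∈ gevDom ξ) :
    Real.exp (ξ * gevLog ξ y) = 1 + ξ * y := by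
  unfold gevLog
  split_ifs with h
  · simp [h]
  · rw [mul_div_cancel₀ _ h, Real.exp_log hy]

theorem hasDerivAt_gevLog {ξ y : ℝ} (hy : y ∈ gevDom ξ) :
    HasDerivAt (gevLog ξ) (Real.exp (-(ξ * gevLog ξ y))) y := by
  rw [Real.exp_neg, exp_mul_gevLog hy]
  by_cases h : ξ = 0
  · have : gevLog ξ = id := by ext; simp [gevLog, h]
    rw [this, h]
    simpa using hasDerivAt_id y
  · have : gevLog ξ = fun y => Real.log (1 + ξ * y) / ξ := by ext; simp [gevLog, h]
    rw [this]
    have h1 : HasDerivAt (fun y : ℝ => 1 + ξ * y) ξ y := by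
      simpa using ((hasDerivAt_id y).const_mul ξ).const_add 1
    refine ((h1.log (ne_of_gt hy)).div_const ξ).congr_deriv ?_
    have hy' : 1 + ξ * y ≠ 0 := ne_of_gt hy
    field_simp

theorem continuousOn_gevLog (ξ : ℝ) : ContinuousOn (gevLog ξ) (gevDom ξ) :=
  fun _ hy => (hasDerivAt_gevLog hy).continuousAt.continuousWithinAt

theorem gevLog_injOn (ξ : ℝ) : InjOn (gevLog ξ) (gevDom ξ) := by
  intro x hx y hy h
  have h1 := exp_mul_gevLog hx
  rw [h, exp_mul_gevLog hy] at h1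
  by_cases h0 : ξ = 0
  · simpa [gevLog, h0] using h
  · have := mul_left_cancel₀ h0 (add_left_cancel h1)
    exact this.symm

theorem convex_gevDom (ξ : ℝ) : Convex ℝ (gevDom ξ) := by
  intro x hx y hy a b ha hb hab
  simp only [gevDom, mem_ofPred_eq, smul_eq_mul] at *
  have e : 1 + ξ * (a * x + b * y) = a * (1 + ξ * x) + b * (1 + ξ * y) := by
    linear_combination -hab
  rw [e]
  rcases ha.eq_or_lt with rfl | ha
  · have : b = 1 := by linarith
    subst this; simpa using hy
  · nlinarith [mul_pos ha hx, mul_nonneg hb hy.le]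

theorem strictMonoOn_gevLog (ξ : ℝ) : StrictMonoOn (gevLog ξ) (gevDom ξ) := by
  refine strictMonoOn_of_deriv_pos (convex_gevDom ξ) (continuousOn_gevLog ξ) fun x hx => ?_
  rw [(hasDerivAt_gevLog (interior_subset hx)).deriv]
  exact Real.exp_pos _

theorem gevLog_pos {ξ y : ℝ} (hy : y ∈ gapDom ξ) : 0 < gevLog ξ y := by
  simpa using strictMonoOn_gevLog ξ (zero_mem_gevDom ξ) hy.2 hy.1

/-- Max-stability in the form used throughout: a multiplicative factor on the exponential scale acts
on the price scale as a shift and a positive rescaling, which self-normalization removes. -/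
theorem hFun_mul_exp {ξ u y : ℝ} (hu : 0 < u) (hy : y ∈ gevDom ξ) :
    hFun ξ (u * Real.exp (-gevLog ξ y)) = hFun ξ u + u ^ (-ξ) * y := by
  unfold hFun
  by_cases h : ξ = 0
  · simp only [h, if_true]
    rw [Real.log_mul hu.ne' (Real.exp_pos _).ne', Real.log_exp]
    simp [gevLog]
    ring
  · simp only [h, if_false]
    rw [Real.mul_rpow hu.le (Real.exp_pos _).le, ← Real.exp_mul]
    have : -gevLog ξ y * -ξ = ξ * gevLog ξ y := by ring
    rw [this, exp_mul_gevLog hy]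
    field_simp
    ring

theorem hFun_exp_neg {ξ y : ℝ} (hy : y ∈ gevDom ξ) : hFun ξ (Real.exp (-gevLog ξ y)) = y := by
  have := hFun_mul_exp one_pos hy
  simpa [hFun] using this

theorem hFun_mem_gevDom {ξ x : ℝ} (hx : 0 < x) : hFun ξ x ∈ gevDom ξ := by
  unfold hFun gevDom
  by_cases h : ξ = 0
  · simp [h]
  · simp only [h, if_false, mem_ofPred_eq]
    rw [mul_div_cancel₀ _ h]
    have := Real.rpow_pos_of_pos hx (-ξ)
    linarith

theorem exp_neg_gevLog_hFun {ξ x : ℝ} (hx : 0 < x) :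
    Real.exp (-gevLog ξ (hFun ξ x)) = x := by
  unfold hFun gevLog
  by_cases h : ξ = 0
  · simp [h, Real.exp_log hx]
  · simp only [h, if_false]
    rw [mul_div_cancel₀ _ h, add_sub_cancel, Real.log_rpow hx]
    have : -(-ξ * Real.log x / ξ) = Real.log x := by field_simp
    rw [this, Real.exp_log hx]

theorem gev_eq {ξ y : ℝ} (hy : y ∈ gevDom ξ) :
    gev ξ y = Real.exp (-Real.exp (-gevLog ξ y)) := by
  unfold gev gevLog
  by_cases h : ξ = 0
  · simp [h]
  · simp only [h, if_false]
    have hy' : 0 < 1 + ξ * y := hy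
    rw [if_pos hy', Real.rpow_def_of_pos hy']
    congr 3
    ring

/-! ### Change of variables along the scaled reduced variate -/

theorem hasDerivAt_mul_exp_neg_gevLog {ξ w : ℝ} (t : ℝ) (hw : w ∈ gevDom ξ) :
    HasDerivAt (fun w => t * Real.exp (-gevLog ξ w))
      (-(t * Real.exp (-((1 + ξ) * gevLog ξ w)))) w := by
  refine (((hasDerivAt_gevLog hw).fun_neg.exp).const_mul t).congr_deriv ?_
  have : -((1 + ξ) * gevLog ξ w) = -gevLog ξ w + -(ξ * gevLog ξ w) := by ring
  rw [this, Real.exp_add]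
  ring

theorem injOn_mul_exp_neg_gevLog (ξ : ℝ) {t : ℝ} (ht : 0 < t) :
    InjOn (fun w => t * Real.exp (-gevLog ξ w)) (gevDom ξ) := by
  intro x hx y hy h
  have := mul_left_cancel₀ ht.ne' h
  exact gevLog_injOn ξ hx hy (neg_injective (Real.exp_injective this))

theorem image_mul_exp_neg_gevLog (ξ : ℝ) {t : ℝ} (ht : 0 < t) :
    (fun w => t * Real.exp (-gevLog ξ w)) '' gevDom ξ = Ioi 0 := by
  ext x
  constructor
  · rintro ⟨w, -, rfl⟩
    exact mul_pos ht (Real.exp_pos _)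
  · intro hx
    have hx : 0 < x / t := div_pos hx ht
    refine ⟨hFun ξ (x / t), hFun_mem_gevDom hx, ?_⟩
    simp only [exp_neg_gevLog_hFun hx]
    field_simp

/-- Positive `w` make the factor `exp (-gevLog ξ w)` less than one, so the positive half of the
support corresponds to the arguments below `t`, that is, to prices above the lowest one. -/
theorem image_mul_exp_neg_gevLog_gapDom (ξ : ℝ) {t : ℝ} (ht : 0 < t) :
    (fun w => t * Real.exp (-gevLog ξ w)) '' gapDom ξ = Ioo 0 t := by
  ext x
  constructor
  · rintro ⟨w, hw, rfl⟩
    refine ⟨mul_pos ht (Real.exp_pos _), ?_⟩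
    have : Real.exp (-gevLog ξ w) < 1 := by
      rw [Real.exp_lt_one_iff]; linarith [gevLog_pos hw]
    simpa using mul_lt_mul_of_pos_left this ht
  · intro hx
    have hx' : 0 < x / t := div_pos hx.1 ht
    refine ⟨hFun ξ (x / t), ⟨?_, hFun_mem_gevDom hx'⟩, ?_⟩
    · by_contra hneg
      have h1 := (strictMonoOn_gevLog ξ).monotoneOn (hFun_mem_gevDom hx') (zero_mem_gevDom ξ)
        (not_lt.1 hneg)
      rw [gevLog_zero] at h1
      have h2 : 1 ≤ Real.exp (-gevLog ξ (hFun ξ (x / t))) := Real.one_le_exp (by linarith)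
      rw [exp_neg_gevLog_hFun hx', le_div_iff₀ ht] at h2
      linarith [hx.2]
    · simp only [exp_neg_gevLog_hFun hx']
      field_simp

theorem lintegral_image_mul_exp_neg_gevLog {ξ t : ℝ} (ht : 0 < t) {s : Set ℝ}
    (hs : MeasurableSet s) (hs' : s ⊆ gevDom ξ) (g : ℝ → ENNReal) :
    ∫⁻ x in (fun w => t * Real.exp (-gevLog ξ w)) '' s, g x =
      ∫⁻ w in s, ENNReal.ofReal (t * Real.exp (-((1 + ξ) * gevLog ξ w))) *
        g (t * Real.exp (-gevLog ξ w)) := by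
  rw [lintegral_image_eq_lintegral_abs_deriv_mul hs
    (fun x hx => (hasDerivAt_mul_exp_neg_gevLog t (hs' hx)).hasDerivWithinAt)
    ((injOn_mul_exp_neg_gevLog ξ ht).mono hs')]
  refine lintegral_congr fun w => ?_
  rw [abs_neg, abs_of_pos (mul_pos ht (Real.exp_pos _))]

theorem lintegral_Ioi_eq_gevDom (ξ : ℝ) (g : ℝ → ENNReal) :
    ∫⁻ x in Ioi 0, g x =
      ∫⁻ w in gevDom ξ, ENNReal.ofReal (Real.exp (-((1 + ξ) * gevLog ξ w))) *
        g (Real.exp (-gevLog ξ w)) := by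
  have := lintegral_image_mul_exp_neg_gevLog one_pos (isOpen_gevDom ξ).measurableSet subset_rfl g
  rw [image_mul_exp_neg_gevLog ξ one_pos] at this
  simpa using this

theorem lintegral_Ioo_eq_gapDom (ξ : ℝ) {t : ℝ} (ht : 0 < t) (g : ℝ → ENNReal) :
    ∫⁻ x in Ioo 0 t, g x =
      ∫⁻ w in gapDom ξ, ENNReal.ofReal (t * Real.exp (-((1 + ξ) * gevLog ξ w))) *
        g (t * Real.exp (-gevLog ξ w)) := by
  rw [← lintegral_image_mul_exp_neg_gevLog ht (isOpen_gapDom ξ).measurableSet (gapDom_subset ξ),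
    image_mul_exp_neg_gevLog_gapDom ξ ht]

/-! ### The law of the sum of two exponential variables -/

/-- The law of the sum of two independent standard exponential variables. -/
def expSumLaw : Measure ℝ :=
  (volume.restrict (Ioi 0)).withDensity fun x => ENNReal.ofReal (x * Real.exp (-x))

theorem expMeasure_one_eq :
    expMeasure 1 = (volume.restrict (Ioi 0)).withDensity
      fun x => ENNReal.ofReal (Real.exp (-x)) := by
  have : expMeasure 1 = (volume.restrict (Ici 0)).withDensity
      fun x => ENNReal.ofReal (Real.exp (-x)) := by
    unfold expMeasure gammaMeasure
    rw [← withDensity_indicator measurableSet_Ici]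
    congr 1
    ext x
    have := exponentialPDF_eq 1 x
    unfold exponentialPDF exponentialPDFReal at this
    unfold gammaPDF
    rw [this]
    by_cases h : 0 ≤ x <;> simp [h]
  rw [this, Measure.restrict_congr_set Ioi_ae_eq_Ici]

/-- In the convolution at `u` the two exponentials multiply to `exp (-u)` whatever the first summand
is, and that summand ranges over an interval of length `u`; the sum thus has density `u * exp (-u)`.
-/
theorem limitLaw_eq_map (ξ : ℝ) : limitLaw ξ = expSumLaw.map (hFun ξ) := by
  have key : ((expMeasure 1).prod (expMeasure 1)).map (fun e : ℝ × ℝ => e.1 + e.2) =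
      expSumLaw := by
    have : IsProbabilityMeasure (expMeasure 1) := isProbabilityMeasure_expMeasure one_pos
    refine Measure.ext_of_lintegral _ fun g hg => ?_
    rw [lintegral_map hg (by fun_prop), lintegral_prod _ (by fun_prop)]
    rw [expMeasure_one_eq, lintegral_withDensity_eq_lintegral_mul _ (by fun_prop)
      (by rw [← expMeasure_one_eq]; fun_prop)]
    have h1 : ∀ x, ∫⁻ y, g (x + y) ∂((volume.restrict (Ioi 0)).withDensity
        fun x => ENNReal.ofReal (Real.exp (-x))) =
        ∫⁻ u in Ioi x, ENNReal.ofReal (Real.exp (-(u - x))) * g u := by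
      intro x
      rw [lintegral_withDensity_eq_lintegral_mul _ (by fun_prop) (by fun_prop),
        ← lintegral_indicator measurableSet_Ioi, ← lintegral_indicator measurableSet_Ioi,
        ← lintegral_add_right_eq_self ((Ioi x).indicator _) x]
      refine lintegral_congr fun y => ?_
      by_cases hy : 0 < y
      · simp [hy, add_comm x y]
      · simp [hy]
    simp only [h1, Pi.mul_apply]
    have h2 : ∀ x, ENNReal.ofReal (Real.exp (-x)) *
        ∫⁻ u in Ioi x, ENNReal.ofReal (Real.exp (-(u - x))) * g u =
        ∫⁻ u, (Ioi x).indicator (fun u => ENNReal.ofReal (Real.exp (-u)) * g u) u := by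
      intro x
      rw [lintegral_indicator measurableSet_Ioi, ← lintegral_const_mul _ (by fun_prop)]
      refine lintegral_congr fun u => ?_
      rw [← mul_assoc, ← ENNReal.ofReal_mul (Real.exp_pos _).le, ← Real.exp_add]
      congr 3
      ring
    simp only [h2]
    have hm : Measurable (Function.uncurry fun x u : ℝ =>
        (Ioi x).indicator (fun u => ENNReal.ofReal (Real.exp (-u)) * g u) u) := by
      have : (Function.uncurry fun x u : ℝ =>
        (Ioi x).indicator (fun u => ENNReal.ofReal (Real.exp (-u)) * g u) u) =
        {p : ℝ × ℝ | p.1 < p.2}.indicator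
          (fun p => ENNReal.ofReal (Real.exp (-p.2)) * g p.2) := by
        ext ⟨x, u⟩
        simp [Function.uncurry, indicator]
      rw [this]
      exact Measurable.indicator (by fun_prop) (measurableSet_lt measurable_fst measurable_snd)
    rw [lintegral_lintegral_swap hm.aemeasurable, expSumLaw,
      lintegral_withDensity_eq_lintegral_mul _ (by fun_prop) hg,
      ← lintegral_indicator measurableSet_Ioi]
    refine lintegral_congr fun u => ?_
    have h3 : ∀ x, (Ioi x).indicator (fun u => ENNReal.ofReal (Real.exp (-u)) * g u) u =
        (Iio u).indicator (fun _ => ENNReal.ofReal (Real.exp (-u)) * g u) x := by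
      intro x; simp [indicator]
    simp only [h3]
    rw [lintegral_indicator measurableSet_Iio, setLIntegral_const,
      Measure.restrict_apply measurableSet_Iio, Iio_inter_Ioi, Real.volume_Ioo]
    by_cases hu : 0 < u
    · simp [hu, ENNReal.ofReal_mul hu.le]
      ring
    · simp [hu, ENNReal.ofReal_of_nonpos (not_lt.1 hu)]
  rw [← key, Measure.map_map (measurable_hFun ξ) (by fun_prop)]
  rfl

instance isProbabilityMeasure_limitLaw (ξ : ℝ) : IsProbabilityMeasure (limitLaw ξ) := by
  have : IsProbabilityMeasure (expMeasure 1) := isProbabilityMeasure_expMeasure one_pos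
  exact Measure.isProbabilityMeasure_map ((measurable_hFun ξ).comp (by fun_prop)).aemeasurable

instance isProbabilityMeasure_expSumLaw : IsProbabilityMeasure expSumLaw := by
  -- A push-forward preserves total mass, so the mass can be read off from any one image law.
  have h := isProbabilityMeasure_limitLaw 0
  rw [limitLaw_eq_map] at h
  exact Measure.isProbabilityMeasure_of_map (hFun 0)

theorem limitLaw_eq_withDensity (ξ : ℝ) :
    limitLaw ξ = (volume.restrict (gevDom ξ)).withDensity fun y =>
      ENNReal.ofReal (Real.exp (-((2 + ξ) * gevLog ξ y)) *
        Real.exp (-Real.exp (-gevLog ξ y))) := by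
  have := measurable_gevLog ξ
  refine Measure.ext_of_lintegral _ fun g hg => ?_
  rw [limitLaw_eq_map, lintegral_map hg (measurable_hFun ξ), expSumLaw,
    lintegral_withDensity_eq_lintegral_mul (g := fun x => g (hFun ξ x)) _ (by fun_prop)
      (hg.comp (measurable_hFun ξ)),
    lintegral_withDensity_eq_lintegral_mul _ (by fun_prop) hg, lintegral_Ioi_eq_gevDom ξ]
  refine setLIntegral_congr_fun (isOpen_gevDom ξ).measurableSet fun y hy => ?_
  simp only [Pi.mul_apply, hFun_exp_neg hy]
  rw [← mul_assoc, ← ENNReal.ofReal_mul (Real.exp_pos _).le, ← mul_assoc, ← Real.exp_add]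
  congr 4
  ring_nf

/-- Since `hFun ξ` is decreasing, the event is that `E₁ + E₂` is at least `τ`, and the gamma tail
has antiderivative `-(1 + x) * exp (-x)`. The same expression is the limit of the CDF of a
second-highest draw. -/
theorem limitLaw_Iic {ξ y : ℝ} (hy : y ∈ gevDom ξ) :
    (limitLaw ξ).real (Iic y) =
      (1 + Real.exp (-gevLog ξ y)) * Real.exp (-Real.exp (-gevLog ξ y)) := by
  set τ := Real.exp (-gevLog ξ y) with hτ
  have hτ0 : 0 < τ := Real.exp_pos _
  have h1 : limitLaw ξ (Iic y) = expSumLaw (Ici τ) := by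
    rw [limitLaw_eq_map, Measure.map_apply (measurable_hFun ξ) measurableSet_Iic]
    refine measure_congr ?_
    have : ∀ᵐ x ∂expSumLaw, 0 < x := by
      refine withDensity_absolutelyContinuous _ _ ?_
      exact ae_restrict_mem measurableSet_Ioi
    filter_upwards [this] with x hx
    refine propext ?_
    change hFun ξ x ≤ y ↔ τ ≤ x
    rw [← (strictMonoOn_gevLog ξ).le_iff_le (hFun_mem_gevDom hx) hy]
    conv_rhs => rw [← exp_neg_gevLog_hFun (ξ := ξ) hx, hτ, Real.exp_le_exp]
    constructor <;> intro h <;> linarith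
  rw [measureReal_def, h1, expSumLaw, withDensity_apply _ measurableSet_Ici,
    Measure.restrict_restrict measurableSet_Ici]
  have h2 : Ici τ ∩ Ioi 0 = Ici τ := inter_eq_left.2 fun x hx => hτ0.trans_le hx
  rw [h2]
  have hd : ∀ x ∈ Ioi τ, HasDerivAt (fun x : ℝ => -((1 + x) * Real.exp (-x)))
      (x * Real.exp (-x)) x := by
    intro x _
    have h := (((hasDerivAt_id' x).const_add 1).mul ((hasDerivAt_id' x).fun_neg.exp)).fun_neg
    refine h.congr_deriv ?_
    ring
  have hc : ContinuousWithinAt (fun x : ℝ => -((1 + x) * Real.exp (-x))) (Ici τ) τ := by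
    apply Continuous.continuousWithinAt
    fun_prop
  have hl : Tendsto (fun x : ℝ => -((1 + x) * Real.exp (-x))) atTop (𝓝 0) := by
    have h0 := Real.tendsto_pow_mul_exp_neg_atTop_nhds_zero 0
    have h1 := Real.tendsto_pow_mul_exp_neg_atTop_nhds_zero 1
    have := (h0.add h1).neg
    simp only [add_zero, neg_zero] at this
    refine this.congr fun x => ?_
    simp; ring
  have hpos : ∀ x ∈ Ioi τ, 0 ≤ x * Real.exp (-x) := fun x hx =>
    mul_nonneg (hτ0.trans hx).le (Real.exp_pos _).le
  rw [setLIntegral_congr Ioi_ae_eq_Ici.symm, ← ofReal_integral_eq_lintegral_ofReal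
    (integrableOn_Ioi_deriv_of_nonneg hc hd hpos hl)
    ((ae_restrict_iff' measurableSet_Ioi).2 (Eventually.of_forall hpos)),
    integral_Ioi_of_hasDerivAt_of_nonneg hc hd hpos hl, ENNReal.toReal_ofReal]
  · ring
  · have : 0 ≤ (1 + τ) * Real.exp (-τ) := by positivity
    linarith


/-! ### Products of measures on the line -/

theorem measurable_snoc {n : ℕ} : Measurable fun p : ℝ × (Fin n → ℝ) =>
    (Fin.snoc p.2 p.1 : Fin (n + 1) → ℝ) := by
  refine measurable_pi_iff.2 fun i => ?_
  refine Fin.lastCases ?_ (fun i => ?_) i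
  · simpa using measurable_fst
  · simpa using! (measurable_pi_apply i).comp measurable_snd

theorem measurable_cons {n : ℕ} : Measurable fun p : ℝ × (Fin n → ℝ) =>
    (Fin.cons p.1 p.2 : Fin (n + 1) → ℝ) := by
  refine measurable_pi_iff.2 fun i => ?_
  refine Fin.cases ?_ (fun i => ?_) i
  · simpa using measurable_fst
  · simpa using! (measurable_pi_apply i).comp measurable_snd

theorem piFinSuccAbove_zero_symm {n : ℕ} (p : ℝ × (Fin n → ℝ)) :
    (MeasurableEquiv.piFinSuccAbove (fun _ : Fin (n + 1) => ℝ) 0).symm p =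
      Fin.cons p.1 p.2 :=
  Fin.insertNth_zero' p.1 p.2

theorem piFinSuccAbove_last_symm {n : ℕ} (p : ℝ × (Fin n → ℝ)) :
    (MeasurableEquiv.piFinSuccAbove (fun _ : Fin (n + 1) => ℝ) (Fin.last n)).symm p =
      Fin.snoc p.2 p.1 :=
  Fin.insertNth_last' p.1 p.2

theorem lintegral_fin_prod_eq_prod {n : ℕ} (m : Fin n → Measure ℝ) [∀ i, SigmaFinite (m i)]
    (f : Fin n → ℝ → ENNReal) (hf : ∀ i, Measurable (f i)) :
    ∫⁻ x, ∏ i, f i (x i) ∂(Measure.pi m) = ∏ i, ∫⁻ y, f i y ∂(m i) := by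
  induction n with
  | zero => simp
  | succ n ih =>
    rw [← ((measurePreserving_piFinSuccAbove m 0).symm).lintegral_comp
      (by fun_prop)]
    have h1 : ∀ p : ℝ × (Fin n → ℝ), ∏ i, f i
        ((MeasurableEquiv.piFinSuccAbove (fun _ : Fin (n + 1) => ℝ) 0).symm p i) =
        f 0 p.1 * ∏ i : Fin n, f i.succ (p.2 i) := by
      intro p
      rw [piFinSuccAbove_zero_symm, Fin.prod_univ_succ]
      simp
    have h2 : Measurable fun x : Fin n → ℝ => ∏ i : Fin n, f i.succ (x i) :=
      Finset.measurable_fun_prod _ fun i _ => (hf _).comp (measurable_pi_apply i)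
    refine (lintegral_congr h1).trans ?_
    refine (lintegral_prod_mul (μ := m 0) (ν := Measure.pi fun i : Fin n => m i.succ) (f := f 0)
      (g := fun x : Fin n → ℝ => ∏ i, f i.succ (x i))
      (hf 0).aemeasurable h2.aemeasurable).trans ?_
    rw [Fin.prod_univ_succ]
    congr 1
    exact ih (fun i => m i.succ) (fun i => f i.succ) fun i => hf _

theorem pi_withDensity {n : ℕ} (m : Fin n → Measure ℝ) [∀ i, SigmaFinite (m i)]
    (f : Fin n → ℝ → ENNReal) (hf : ∀ i, Measurable (f i))
    [∀ i, SigmaFinite ((m i).withDensity (f i))] :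
    Measure.pi (fun i => (m i).withDensity (f i)) =
      (Measure.pi m).withDensity fun x => ∏ i, f i (x i) := by
  refine (Measure.pi_eq fun s hs => ?_)
  rw [withDensity_apply _ (MeasurableSet.univ_pi hs), Measure.restrict_pi_pi,
    lintegral_fin_prod_eq_prod _ _ hf]
  exact Finset.prod_congr rfl fun i _ => (withDensity_apply _ (hs i)).symm

theorem measurableSet_strictAnti {n : ℕ} : MeasurableSet {x : Fin n → ℝ | StrictAnti x} := by
  simp only [StrictAnti, ofPred_forall]
  exact MeasurableSet.iInter fun i => MeasurableSet.iInter fun j => MeasurableSet.iInter fun _ =>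
    measurableSet_lt (measurable_pi_apply j) (measurable_pi_apply i)

theorem measurableSet_strictMono {n : ℕ} : MeasurableSet {x : Fin n → ℝ | StrictMono x} := by
  simp only [StrictMono, ofPred_forall]
  exact MeasurableSet.iInter fun i => MeasurableSet.iInter fun j => MeasurableSet.iInter fun _ =>
    measurableSet_lt (measurable_pi_apply i) (measurable_pi_apply j)

/-- Each diagonal `x i = x j` is a proper linear subspace, hence null. -/
theorem ae_injective_volume (n : ℕ) : ∀ᵐ x : Fin n → ℝ, Function.Injective x := by
  have h : ∀ i j : Fin n, i ≠ j → ∀ᵐ x : Fin n → ℝ, x i ≠ x j := by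
    intro i j hij
    let E : Submodule ℝ (Fin n → ℝ) := LinearMap.ker
      ((LinearMap.proj i : (Fin n → ℝ) →ₗ[ℝ] ℝ) - LinearMap.proj j)
    have hE : E ≠ ⊤ := by
      intro h
      have : Pi.single i (1 : ℝ) ∈ E := h ▸ Submodule.mem_top
      simp [E, hij.symm] at this
    have := Measure.addHaar_submodule volume E hE
    refine measure_mono_null (fun x hx => ?_) this
    have hx : x i = x j := by simpa using hx
    simp [E, hx]
  have h' : ∀ᵐ x : Fin n → ℝ, ∀ i j : Fin n, i ≠ j → x i ≠ x j := by
    simp only [ae_all_iff]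
    exact h
  filter_upwards [h'] with x hx i j hij
  by_contra hne
  exact hx i j hne hij

/-- Exactly one permutation puts an injective vector into decreasing order, so a single term
survives. -/
theorem sum_indicator_strictAnti {n : ℕ} {x : Fin n → ℝ} (hx : Function.Injective x)
    (c : ENNReal) :
    ∑ σ : Equiv.Perm (Fin n), {x : Fin n → ℝ | StrictAnti x}.indicator
      (fun _ => c) (x ∘ σ) = c := by
  set σ₀ := Tuple.sort (fun i => -x i)
  have h0 : StrictAnti (x ∘ σ₀) := by
    have h1 : Monotone ((fun i => -x i) ∘ σ₀) := Tuple.monotone_sort _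
    have h2 : StrictMono ((fun i => -x i) ∘ σ₀) :=
      h1.strictMono_of_injective ((neg_injective.comp hx).comp σ₀.injective)
    intro i j hij
    simpa using h2 hij
  rw [Finset.sum_eq_single σ₀]
  · simp [indicator, h0]
  · intro σ _ hne
    refine indicator_of_notMem (fun h => hne ?_) _
    have h : StrictAnti (x ∘ σ) := h
    have e : (fun i => -x i) ∘ σ = (fun i => -x i) ∘ σ₀ :=
      Tuple.unique_monotone (fun i j hij => neg_le_neg (h.antitone hij))
        (fun i j hij => neg_le_neg (h0.antitone hij))
    ext i
    have := congrFun e i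
    simp only [Function.comp] at this
    rw [hx (neg_injective this)]
  · simp

theorem measurePreserving_comp_perm {n : ℕ} (m : Measure ℝ) [SigmaFinite m]
    (σ : Equiv.Perm (Fin n)) :
    MeasurePreserving (fun x : Fin n → ℝ => x ∘ σ) (Measure.pi fun _ => m)
      (Measure.pi fun _ => m) := by
  have h := measurePreserving_piCongrLeft (fun _ : Fin n => m) σ.symm
  convert h using 1
  ext x i
  have := MeasurableEquiv.piCongrLeft_apply_apply (β := fun _ : Fin n => ℝ) σ.symm x (σ i)
  simpa using this.symm

/-- An integral over a power of a measure is the sum over all permutations of integrals over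
decreasing vectors. -/
theorem lintegral_pi_eq_sum_perm {n : ℕ} {m : Measure ℝ} [SigmaFinite m]
    (hinj : ∀ᵐ x ∂(Measure.pi fun _ : Fin n => m), Function.Injective x)
    {F : (Fin n → ℝ) → ENNReal} (hF : Measurable F) :
    ∫⁻ x, F x ∂(Measure.pi fun _ : Fin n => m) = ∑ σ : Equiv.Perm (Fin n),
      ∫⁻ x in {x | StrictAnti x}, F (x ∘ σ) ∂(Measure.pi fun _ : Fin n => m) := by
  have hσ : ∀ σ : Equiv.Perm (Fin n), Measurable fun x : Fin n → ℝ => x ∘ σ := fun σ =>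
    (measurePreserving_comp_perm m σ).measurable
  have h1 : ∀ σ : Equiv.Perm (Fin n),
      ∫⁻ x in {x | StrictAnti x}, F (x ∘ σ) ∂(Measure.pi fun _ : Fin n => m) =
      ∫⁻ x, {x : Fin n → ℝ | StrictAnti x}.indicator (fun _ => F x) (x ∘ σ.symm)
        ∂(Measure.pi fun _ : Fin n => m) := by
    intro σ
    rw [← lintegral_indicator measurableSet_strictAnti]
    rw [← (measurePreserving_comp_perm m σ).lintegral_comp
      (f := fun x => {x : Fin n → ℝ | StrictAnti x}.indicator (fun _ => F x) (x ∘ σ.symm))]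
    · refine lintegral_congr fun x => ?_
      have : (x ∘ σ) ∘ σ.symm = x := by ext i; simp
      rw [this]
      simp only [indicator]
    · have : (fun x : Fin n → ℝ => {x : Fin n → ℝ | StrictAnti x}.indicator (fun _ => F x)
          (x ∘ σ.symm)) = ((fun x : Fin n → ℝ => x ∘ σ.symm) ⁻¹' {x | StrictAnti x}).indicator
          F := by
        ext x; simp [indicator]
      rw [this]
      exact hF.indicator (hσ _ measurableSet_strictAnti)
  simp only [h1]
  rw [← lintegral_finsetSum']
  · refine lintegral_congr_ae ?_
    filter_upwards [hinj] with x hx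
    -- The change of variables left `σ.symm` in each term; reindexing by inversion brings back `σ`.
    rw [← Equiv.sum_comp (Equiv.inv (Equiv.Perm (Fin n)))]
    exact (sum_indicator_strictAnti hx _).symm
  · intro σ _
    have : (fun x : Fin n → ℝ => {x : Fin n → ℝ | StrictAnti x}.indicator (fun _ => F x)
        (x ∘ σ.symm)) = ((fun x : Fin n → ℝ => x ∘ σ.symm) ⁻¹' {x | StrictAnti x}).indicator
        F := by
      ext x; simp [indicator]
    rw [this]
    exact (hF.indicator (hσ _ measurableSet_strictAnti)).aemeasurable

theorem lintegral_pi_cons {n : ℕ} (m : Measure ℝ) [SigmaFinite m]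
    {F : (Fin (n + 1) → ℝ) → ENNReal} (hF : Measurable F) :
    ∫⁻ x, F x ∂(Measure.pi fun _ => m) =
      ∫⁻ t, ∫⁻ y : Fin n → ℝ, F (Fin.cons t y) ∂(Measure.pi fun _ => m) ∂m := by
  rw [← ((measurePreserving_piFinSuccAbove (fun _ : Fin (n + 1) => m) 0).symm).lintegral_comp hF]
  simp only [piFinSuccAbove_zero_symm]
  exact lintegral_prod (μ := m) (ν := Measure.pi fun _ : Fin n => m)
    (fun p : ℝ × (Fin n → ℝ) => F (Fin.cons p.1 p.2)) (hF.comp measurable_cons).aemeasurable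

theorem lintegral_pi_snoc {n : ℕ} (m : Measure ℝ) [SigmaFinite m]
    {F : (Fin (n + 1) → ℝ) → ENNReal} (hF : Measurable F) :
    ∫⁻ x, F x ∂(Measure.pi fun _ => m) =
      ∫⁻ t, ∫⁻ y : Fin n → ℝ, F (Fin.snoc y t) ∂(Measure.pi fun _ => m) ∂m := by
  rw [← ((measurePreserving_piFinSuccAbove (fun _ : Fin (n + 1) => m)
    (Fin.last n)).symm).lintegral_comp hF]
  simp only [piFinSuccAbove_last_symm]
  exact lintegral_prod (μ := m) (ν := Measure.pi fun _ : Fin n => m)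
    (fun p : ℝ × (Fin n → ℝ) => F (Fin.snoc p.2 p.1)) (hF.comp measurable_snoc).aemeasurable

theorem lintegral_comp_smul_pi {n : ℕ} {s : ℝ} (hs : 0 < s) {F : (Fin n → ℝ) → ENNReal}
    (hF : Measurable F) :
    ∫⁻ x, F x = ENNReal.ofReal (s ^ n) * ∫⁻ z : Fin n → ℝ, F (s • z) := by
  have h : ∫⁻ z : Fin n → ℝ, F (s • z) = ENNReal.ofReal ((s ^ n)⁻¹) * ∫⁻ x, F x := by
    rw [← lintegral_map (f := F) hF (measurable_const_smul s),
      Measure.map_addHaar_smul _ hs.ne', lintegral_smul_measure]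
    simp [abs_of_pos hs]
  rw [h, ← mul_assoc, ← ENNReal.ofReal_mul (by positivity), mul_inv_cancel₀ (by positivity)]
  simp


/-! ### Sorted samples in location, scale and self-normalized coordinates -/

/-- The open simplex of strictly increasing vectors in the open unit cube. -/
def simplex (N : ℕ) : Set (Fin N → ℝ) := {z | StrictMono z ∧ ∀ j, 0 < z j ∧ z j < 1}

/-- The sorted vector `(0, z, 1)`. -/
def addEnds {N : ℕ} (z : Fin N → ℝ) : Fin (N + 2) → ℝ := Fin.cons 0 (Fin.snoc z 1)

/-- The vector with smallest entry `H_ξ(t)` and range `t ^ (-ξ) s` whose self-normalization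
is `z`. -/
def recon {N : ℕ} (ξ : ℝ) (z : Fin N → ℝ) (p : ℝ × ℝ) (j : Fin (N + 2)) : ℝ :=
  hFun ξ p.2 + p.2 ^ (-ξ) * (p.1 * addEnds z j)

/-- `1 + ∑ τ(z_j s) + τ(s)` with `τ = exp (-gevLog ξ)`. -/
def expSum {N : ℕ} (ξ : ℝ) (z : Fin N → ℝ) (s : ℝ) : ℝ :=
  1 + (∑ j, Real.exp (-gevLog ξ (z j * s))) + Real.exp (-gevLog ξ s)

/-- The joint density of the coordinates `(z, (s, t))` of a sample, up to sorting. -/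
def reconWeight {N : ℕ} (ξ : ℝ) (z : Fin N → ℝ) (p : ℝ × ℝ) : ℝ :=
  p.2 ^ (2 * N + 3) * Real.exp (-(p.2 * expSum ξ z p.1)) *
    (p.1 ^ N * Real.exp (-((2 + ξ) * ((∑ j, gevLog ξ (z j * p.1)) + gevLog ξ p.1))))

/-- Lebesgue measure on the range of the scale and location coordinates. -/
def scaleLoc (ξ : ℝ) : Measure (ℝ × ℝ) :=
  (volume.restrict (gapDom ξ)).prod (volume.restrict (Ioi 0))

instance (ξ : ℝ) : SigmaFinite (scaleLoc ξ) := by unfold scaleLoc; infer_instance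

theorem measurableSet_simplex (N : ℕ) : MeasurableSet (simplex N) := by
  have : {z : Fin N → ℝ | ∀ j, 0 < z j ∧ z j < 1} = univ.pi fun _ => Ioo 0 1 := by
    ext z; simp
  have h2 : MeasurableSet {z : Fin N → ℝ | ∀ j, 0 < z j ∧ z j < 1} :=
    this ▸ MeasurableSet.univ_pi fun _ => measurableSet_Ioo
  exact measurableSet_strictMono.inter h2

theorem measurable_addEnds {N : ℕ} : Measurable (addEnds : (Fin N → ℝ) → _) :=
  (measurable_cons (n := N + 1)).comp (measurable_const.prodMk
    ((measurable_snoc (n := N)).comp (measurable_const.prodMk measurable_id)))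

theorem measurable_recon {N : ℕ} (ξ : ℝ) :
    Measurable fun q : (Fin N → ℝ) × (ℝ × ℝ) => recon ξ q.1 q.2 := by
  refine measurable_pi_iff.2 fun j => ?_
  have h1 : Measurable fun q : (Fin N → ℝ) × (ℝ × ℝ) => addEnds q.1 j :=
    (measurable_pi_apply j).comp (measurable_addEnds.comp measurable_fst)
  have h2 := measurable_hFun ξ
  unfold recon
  fun_prop

theorem measurable_reconWeight {N : ℕ} (ξ : ℝ) :
    Measurable fun q : (Fin N → ℝ) × (ℝ × ℝ) => reconWeight ξ q.1 q.2 := by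
  have := measurable_gevLog ξ
  unfold reconWeight expSum
  fun_prop

theorem strictAnti_cons {n : ℕ} {t : ℝ} {y : Fin n → ℝ} :
    StrictAnti (Fin.cons t y : Fin (n + 1) → ℝ) ↔ StrictAnti y ∧ ∀ j, y j < t := by
  constructor
  · intro h
    refine ⟨fun i j hij => ?_, fun j => ?_⟩
    · simpa using h (Fin.succ_lt_succ_iff.2 hij)
    · simpa using h (Fin.succ_pos j)
  · rintro ⟨h1, h2⟩ i j hij
    induction i using Fin.cases with
    | zero =>
      induction j using Fin.cases with
      | zero => exact absurd hij (lt_irrefl _)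
      | succ j => simpa using h2 j
    | succ i =>
      induction j using Fin.cases with
      | zero => exact absurd hij (Fin.not_lt_zero _)
      | succ j => simpa using h1 (Fin.succ_lt_succ_iff.1 hij)

theorem strictMono_snoc {n : ℕ} {t : ℝ} {y : Fin n → ℝ} :
    StrictMono (Fin.snoc y t : Fin (n + 1) → ℝ) ↔ StrictMono y ∧ ∀ j, y j < t := by
  constructor
  · intro h
    refine ⟨fun i j hij => ?_, fun j => ?_⟩
    · simpa using h (Fin.castSucc_lt_castSucc_iff.2 hij)
    · simpa using h (Fin.castSucc_lt_last j)
  · rintro ⟨h1, h2⟩ i j hij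
    induction j using Fin.lastCases with
    | last =>
      induction i using Fin.lastCases with
      | last => exact absurd hij (lt_irrefl _)
      | cast i => simpa using h2 i
    | cast j =>
      induction i using Fin.lastCases with
      | last => exact absurd hij (not_lt.2 (Fin.le_last _))
      | cast i => simpa using h1 (Fin.castSucc_lt_castSucc_iff.1 hij)

theorem strictMono_cons {n : ℕ} {t : ℝ} {y : Fin n → ℝ} :
    StrictMono (Fin.cons t y : Fin (n + 1) → ℝ) ↔ StrictMono y ∧ ∀ j, t < y j := by
  constructor
  · intro h
    refine ⟨fun i j hij => ?_, fun j => ?_⟩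
    · simpa using h (Fin.succ_lt_succ_iff.2 hij)
    · simpa using h (Fin.succ_pos j)
  · rintro ⟨h1, h2⟩ i j hij
    induction i using Fin.cases with
    | zero =>
      induction j using Fin.cases with
      | zero => exact absurd hij (lt_irrefl _)
      | succ j => simpa using h2 j
    | succ i =>
      induction j using Fin.cases with
      | zero => exact absurd hij (Fin.not_lt_zero _)
      | succ j => simpa using h1 (Fin.succ_lt_succ_iff.1 hij)

/-- The head of a decreasing vector is its maximum, so splitting it off confines the remaining
entries to the interval below it. -/
theorem lintegral_strictAnti_cons {n : ℕ} {Φ : (Fin (n + 1) → ℝ) → ENNReal}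
    (mΦ : Measurable Φ) :
    ∫⁻ x in {x | StrictAnti x}, Φ x
        ∂(Measure.pi fun _ : Fin (n + 1) => volume.restrict (Ioi (0 : ℝ))) =
      ∫⁻ t in Ioi (0 : ℝ), ∫⁻ y in {y | StrictAnti y}, Φ (Fin.cons t y)
        ∂(Measure.pi fun _ : Fin n => volume.restrict (Ioo (0 : ℝ) t)) := by
  rw [← lintegral_indicator measurableSet_strictAnti,
    lintegral_pi_cons _ (mΦ.indicator measurableSet_strictAnti)]
  refine lintegral_congr fun t => ?_
  rw [← Measure.restrict_pi_pi, ← Measure.restrict_pi_pi,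
    Measure.restrict_restrict measurableSet_strictAnti,
    ← lintegral_indicator (MeasurableSet.univ_pi fun _ => measurableSet_Ioi),
    ← lintegral_indicator (measurableSet_strictAnti.inter
      (MeasurableSet.univ_pi fun _ => measurableSet_Ioo))]
  refine lintegral_congr fun y => ?_
  have hiff : (∀ j, 0 < y j) ∧ StrictAnti (Fin.cons t y : Fin (n + 1) → ℝ) ↔
      StrictAnti y ∧ ∀ j, 0 < y j ∧ y j < t := by
    rw [strictAnti_cons, forall_and]
    tauto
  simp only [indicator, Set.mem_pi, mem_univ, mem_Ioi, true_imp_iff, mem_ofPred_eq, mem_inter_iff,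
    mem_Ioo, ← hiff]
  by_cases h1 : ∀ j, 0 < y j <;>
    by_cases h2 : StrictAnti (Fin.cons t y : Fin (n + 1) → ℝ) <;> simp [h1, h2]

theorem lintegral_pi_Ioo (ξ : ℝ) {n : ℕ} {t : ℝ} (ht : 0 < t) {Ψ : (Fin n → ℝ) → ENNReal}
    (mΨ : Measurable Ψ) :
    ∫⁻ y, Ψ y ∂(Measure.pi fun _ : Fin n => volume.restrict (Ioo (0 : ℝ) t)) =
      ∫⁻ w, (∏ j, ENNReal.ofReal (t * Real.exp (-((1 + ξ) * gevLog ξ (w j))))) *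
          Ψ (fun j => t * Real.exp (-gevLog ξ (w j)))
        ∂(Measure.pi fun _ : Fin n => volume.restrict (gapDom ξ)) := by
  have mlog := measurable_gevLog ξ
  set e : ℝ → ENNReal := fun w => ENNReal.ofReal (t * Real.exp (-((1 + ξ) * gevLog ξ w))) with he
  have me : Measurable e := by fun_prop
  have mf : Measurable fun w => t * Real.exp (-gevLog ξ w) := by fun_prop
  have h1 : volume.restrict (Ioo (0 : ℝ) t) =
      ((volume.restrict (gapDom ξ)).withDensity e).map fun w => t * Real.exp (-gevLog ξ w) := by
    refine Measure.ext_of_lintegral _ fun g hg => ?_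
    rw [lintegral_map hg mf, lintegral_withDensity_eq_lintegral_mul _ me
      (g := fun w => g (t * Real.exp (-gevLog ξ w))) (hg.comp mf), lintegral_Ioo_eq_gapDom ξ ht]
    rfl
  -- The image of this measure is Lebesgue measure on a bounded interval, and finiteness passes back
  -- along the map; it supplies the σ-finiteness needed for product measures.
  have hfin : IsFiniteMeasure ((volume.restrict (gapDom ξ)).withDensity e) := by
    have : IsFiniteMeasure (((volume.restrict (gapDom ξ)).withDensity e).map
        fun w => t * Real.exp (-gevLog ξ w)) := by
      rw [← h1]
      infer_instance
    exact Measure.isFiniteMeasure_of_map mf.aemeasurable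
  rw [h1, ← Measure.pi_map_pi fun _ => mf.aemeasurable, lintegral_map mΨ (by fun_prop),
    pi_withDensity _ _ fun _ => me, lintegral_withDensity_eq_lintegral_mul _ (by fun_prop)
      (g := fun w : Fin n → ℝ => Ψ fun j => t * Real.exp (-gevLog ξ (w j)))
      (mΨ.comp (by fun_prop))]
  rfl

/-- The last entry `s` of an increasing vector is its maximum; dividing the other entries by it
lands in the open simplex, with Jacobian `s ^ n`. The constraint of lying in `gapDom ξ` is then
automatic, because it is inherited by fractions of `s`. -/
theorem lintegral_strictMono_snoc (ξ : ℝ) {n : ℕ} {Ψ : (Fin (n + 1) → ℝ) → ENNReal}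
    (mΨ : Measurable Ψ) :
    ∫⁻ w in {w | StrictMono w}, Ψ w
        ∂(Measure.pi fun _ : Fin (n + 1) => volume.restrict (gapDom ξ)) =
      ∫⁻ s in gapDom ξ, ENNReal.ofReal (s ^ n) *
        ∫⁻ z in simplex n, Ψ (Fin.snoc (s • z) s) := by
  rw [← lintegral_indicator measurableSet_strictMono,
    lintegral_pi_snoc _ (mΨ.indicator measurableSet_strictMono)]
  refine setLIntegral_congr_fun (isOpen_gapDom ξ).measurableSet fun s hs => ?_
  have mgap := (isOpen_gapDom ξ).measurableSet
  have hm : Measurable fun y : Fin n → ℝ =>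
      {w : Fin (n + 1) → ℝ | StrictMono w}.indicator Ψ (Fin.snoc y s) :=
    (mΨ.indicator measurableSet_strictMono).comp
      (measurable_snoc.comp (measurable_const.prodMk measurable_id))
  rw [← Measure.restrict_pi_pi, ← lintegral_indicator (MeasurableSet.univ_pi fun _ => mgap),
    ← volume_pi, lintegral_comp_smul_pi hs.1 (hm.indicator (MeasurableSet.univ_pi fun _ => mgap)),
    ← lintegral_indicator (measurableSet_simplex n)]
  congr 1
  refine lintegral_congr fun z => ?_
  have hiff : (∀ j, s * z j ∈ gapDom ξ) ∧ StrictMono (Fin.snoc (s • z) s : Fin (n + 1) → ℝ) ↔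
      z ∈ simplex n := by
    rw [strictMono_snoc]
    constructor
    · rintro ⟨h1, h2, h3⟩
      refine ⟨fun i j hij => ?_, fun j => ⟨?_, ?_⟩⟩
      · have := h2 hij
        simpa [hs.1] using this
      · exact (mul_pos_iff_of_pos_left hs.1).1 (h1 j).1
      · have := h3 j
        simp only [Pi.smul_apply, smul_eq_mul] at this
        exact (mul_lt_iff_lt_one_right hs.1).1 this
    · rintro ⟨h1, h2⟩
      refine ⟨fun j => ?_, fun i j hij => ?_, fun j => ?_⟩
      · rw [mul_comm]
        exact mul_mem_gapDom hs (h2 j).1 (h2 j).2.le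
      · simpa [hs.1] using h1 hij
      · simpa using (mul_lt_iff_lt_one_right hs.1).2 (h2 j).2
  classical
  rw [indicator_apply, indicator_apply, indicator_apply]
  simp only [← hiff]
  simp only [Set.mem_pi, mem_univ, true_imp_iff, mem_ofPred_eq, Pi.smul_apply, smul_eq_mul]
  by_cases h1 : ∀ j, s * z j ∈ gapDom ξ <;>
    by_cases h2 : StrictMono (Fin.snoc (s • z) s : Fin (n + 1) → ℝ) <;> simp [h1, h2]

theorem lintegral_pi_limitLaw_eq_strictAnti (n : ℕ) (ξ : ℝ) {G : (Fin n → ℝ) → ENNReal}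
    (hG : Measurable G) :
    ∫⁻ x, G x ∂(Measure.pi fun _ => limitLaw ξ) =
      ∫⁻ x in {x | StrictAnti x}, (∑ σ : Equiv.Perm (Fin n), G ((fun j => hFun ξ (x j)) ∘ σ)) *
          ∏ j, ENNReal.ofReal (x j * Real.exp (-x j))
        ∂(Measure.pi fun _ : Fin n => volume.restrict (Ioi (0 : ℝ))) := by
  have hperm : ∀ σ : Equiv.Perm (Fin n), Measurable fun x : Fin n → ℝ => x ∘ σ :=
    fun σ => (measurePreserving_comp_perm volume σ).measurable
  have mh := measurable_hFun ξ
  set d : ℝ → ENNReal := fun x => ENNReal.ofReal (x * Real.exp (-x)) with hd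
  have md : Measurable d := by fun_prop
  have mD : Measurable fun x : Fin n → ℝ => ∏ j, d (x j) := by fun_prop
  have mH : Measurable fun (x : Fin n → ℝ) j => hFun ξ (x j) := by fun_prop
  have hsf : SigmaFinite ((volume.restrict (Ioi (0 : ℝ))).withDensity d) :=
    (inferInstance : SigmaFinite expSumLaw)
  have e1 : (Measure.pi fun _ : Fin n => limitLaw ξ) =
      (Measure.pi fun _ : Fin n => expSumLaw).map fun x j => hFun ξ (x j) := by
    simp only [limitLaw_eq_map]
    have := limitLaw_eq_map ξ
    have hs : ∀ i : Fin n, SigmaFinite (expSumLaw.map (hFun ξ)) := fun i => by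
      rw [← this]; infer_instance
    exact (Measure.pi_map_pi fun _ => mh.aemeasurable).symm
  have hinj : ∀ᵐ x ∂(Measure.pi fun _ : Fin n => volume.restrict (Ioi (0 : ℝ))),
      Function.Injective x := by
    rw [← Measure.restrict_pi_pi]
    exact ae_restrict_of_ae (ae_injective_volume _)
  have e2 : (Measure.pi fun _ : Fin n => expSumLaw) =
      (Measure.pi fun _ : Fin n => volume.restrict (Ioi (0 : ℝ))).withDensity
        fun x => ∏ j, d (x j) :=
    pi_withDensity (fun _ => volume.restrict (Ioi 0)) (fun _ => d) fun _ => md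
  have mF : Measurable ((fun x : Fin n → ℝ => ∏ j, d (x j)) * fun x => G fun j => hFun ξ (x j)) :=
    mD.mul (hG.comp mH)
  rw [e1, lintegral_map hG mH, e2, lintegral_withDensity_eq_lintegral_mul _ mD
      (g := fun x : Fin n → ℝ => G fun j => hFun ξ (x j)) (hG.comp mH),
    lintegral_pi_eq_sum_perm hinj mF, ← lintegral_finsetSum']
  · refine lintegral_congr fun x => ?_
    simp only [Pi.mul_apply, Finset.sum_mul]
    refine Finset.sum_congr rfl fun σ _ => ?_
    rw [mul_comm, Function.comp_def]
    -- The product density is symmetric, so only `G` sees the permutation.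
    rw [Equiv.prod_comp σ fun j => d (x j)]
    rfl
  · exact fun σ _ => (mF.comp (hperm σ)).aemeasurable

theorem hFun_eq_recon {N : ℕ} {ξ s t : ℝ} {z : Fin N → ℝ} (hz : z ∈ simplex N)
    (hs : s ∈ gapDom ξ) (ht : 0 < t) (j : Fin (N + 2)) :
    hFun ξ ((Fin.cons t (fun j => t * Real.exp (-gevLog ξ
      ((Fin.snoc (s • z) s : Fin (N + 1) → ℝ) j))) : Fin (N + 2) → ℝ) j) = recon ξ z (s, t) j := by
  unfold recon addEnds
  induction j using Fin.cases with
  | zero => simp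
  | succ j =>
    simp only [Fin.cons_succ]
    induction j using Fin.lastCases with
    | last => simpa using hFun_mul_exp ht hs.2
    | cast j =>
      have := hFun_mul_exp ht (mul_mem_gevDom hs (hz.2 j).1.le (hz.2 j).2.le)
      simpa [mul_comm s] using this

/-- Bookkeeping of three sources: the Jacobian `s ^ N`, the `N + 1` substitution factors and the `N
+ 2` gamma densities. The last two give the power `2 * N + 3` of `t`, and their exponents `1 + ξ`
and `1` add up to the `2 + ξ` of each gap. -/
theorem prod_eq_reconWeight {N : ℕ} {ξ s t : ℝ} {z : Fin N → ℝ} (hs : 0 < s) (ht : 0 < t) :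
    ENNReal.ofReal (s ^ N) * (∏ j, ENNReal.ofReal (t * Real.exp (-((1 + ξ) * gevLog ξ
        ((Fin.snoc (s • z) s : Fin (N + 1) → ℝ) j))))) *
      ∏ j, (fun x => ENNReal.ofReal (x * Real.exp (-x)))
        ((Fin.cons t (fun j => t * Real.exp (-gevLog ξ
          ((Fin.snoc (s • z) s : Fin (N + 1) → ℝ) j))) : Fin (N + 2) → ℝ) j) =
      ENNReal.ofReal (reconWeight ξ z (s, t)) := by
  rw [Fin.prod_univ_castSucc, Fin.prod_univ_succ (n := N + 1), Fin.prod_univ_castSucc (n := N)]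
  simp only [Fin.cons_zero, Fin.cons_succ, Fin.snoc_castSucc, Fin.snoc_last, Pi.smul_apply,
    smul_eq_mul]
  rw [← ENNReal.ofReal_prod_of_nonneg (by intros; positivity),
    ← ENNReal.ofReal_prod_of_nonneg (by intros; positivity),
    ← ENNReal.ofReal_mul (by positivity), ← ENNReal.ofReal_mul (by positivity),
    ← ENNReal.ofReal_mul (by positivity), ← ENNReal.ofReal_mul (by positivity),
    ← ENNReal.ofReal_mul (by positivity)]
  congr 1
  simp only [Finset.prod_mul_distrib, Finset.prod_const, Finset.card_univ, Fintype.card_fin,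
    ← Real.exp_sum, reconWeight, expSum]
  have e : ∀ a b c d e f g h : ℝ, s ^ N * (t ^ N * a * (t * b)) * (t * c * (t ^ N * d * e *
      (t * f * g))) = t ^ (2 * N + 3) * (s ^ N * (a * b * c * d * e * f * g)) := by
    intros; ring
  rw [e _ _ _ _ _ _ _ 0]
  simp only [← Real.exp_add]
  have e2 : ∀ A B : ℝ, t ^ (2 * N + 3) * Real.exp A * (s ^ N * Real.exp B) =
      t ^ (2 * N + 3) * (s ^ N * Real.exp (A + B)) := by
    intro A B; rw [Real.exp_add]; ring
  rw [e2]
  congr 3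
  simp only [Finset.sum_neg_distrib, ← Finset.mul_sum, mul_comm s]
  ring

/-- Disintegration of the limit law over its self-normalization. With `G` a function of `selfNorm`
it yields the density; with general `G` it yields the conditional laws used to build `matchedLaw`.
-/
theorem lintegral_pi_limitLaw (N : ℕ) (ξ : ℝ) {G : (Fin (N + 2) → ℝ) → ENNReal}
    (hG : Measurable G) :
    ∫⁻ x, G x ∂(Measure.pi fun _ => limitLaw ξ) =
      ∫⁻ z in simplex N, ∫⁻ p, (∑ σ : Equiv.Perm (Fin (N + 2)), G (recon ξ z p ∘ σ)) *
        ENNReal.ofReal (reconWeight ξ z p) ∂(scaleLoc ξ) := by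
  have hperm : ∀ σ : Equiv.Perm (Fin (N + 2)), Measurable fun x : Fin (N + 2) → ℝ => x ∘ σ :=
    fun σ => (measurePreserving_comp_perm volume σ).measurable
  have mlog := measurable_gevLog ξ
  have mh := measurable_hFun ξ
  set S : (Fin (N + 2) → ℝ) → ENNReal := fun x => ∑ σ : Equiv.Perm (Fin (N + 2)), G (x ∘ σ)
    with hS
  have mS : Measurable S := Finset.measurable_fun_sum _ fun σ _ => hG.comp (hperm σ)
  set Φ : (Fin (N + 2) → ℝ) → ENNReal := fun x =>
    S (fun j => hFun ξ (x j)) * ∏ j, (fun x => ENNReal.ofReal (x * Real.exp (-x))) (x j) with hΦ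
  have mΦ : Measurable Φ :=
    (mS.comp (by fun_prop)).mul (by fun_prop)
  set Q : ((Fin N → ℝ) × (ℝ × ℝ)) → ENNReal := fun q =>
    S (recon ξ q.1 q.2) * ENNReal.ofReal (reconWeight ξ q.1 q.2) with hQ
  have mQ : Measurable Q :=
    (mS.comp (measurable_recon ξ)).mul (measurable_reconWeight ξ).ennreal_ofReal
  have mgap := (isOpen_gapDom ξ).measurableSet
  have key : ∀ t ∈ Ioi (0 : ℝ), ∫⁻ y in {y | StrictAnti y}, Φ (Fin.cons t y)
        ∂(Measure.pi fun _ : Fin (N + 1) => volume.restrict (Ioo (0 : ℝ) t)) =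
      ∫⁻ s in gapDom ξ, ∫⁻ z in simplex N, Q (z, (s, t)) := by
    intro t ht
    have mΦt : Measurable fun y : Fin (N + 1) → ℝ => Φ (Fin.cons t y) :=
      mΦ.comp (measurable_cons.comp (measurable_const.prodMk measurable_id))
    set Ψ : (Fin (N + 1) → ℝ) → ENNReal := fun w =>
      (∏ j, ENNReal.ofReal (t * Real.exp (-((1 + ξ) * gevLog ξ (w j))))) *
        Φ (Fin.cons t fun j => t * Real.exp (-gevLog ξ (w j))) with hΨ
    have mΨ : Measurable Ψ := by
      refine Measurable.mul (by fun_prop) ?_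
      exact mΦt.comp (g := fun y : Fin (N + 1) → ℝ => Φ (Fin.cons t y)) (by fun_prop)
    rw [← lintegral_indicator measurableSet_strictAnti,
      lintegral_pi_Ioo ξ ht (mΦt.indicator measurableSet_strictAnti)]
    have h1 : ∫⁻ w, (∏ j, ENNReal.ofReal (t * Real.exp (-((1 + ξ) * gevLog ξ (w j))))) *
          {y | StrictAnti y}.indicator (fun y : Fin (N + 1) → ℝ => Φ (Fin.cons t y))
            (fun j => t * Real.exp (-gevLog ξ (w j)))
        ∂(Measure.pi fun _ : Fin (N + 1) => volume.restrict (gapDom ξ)) =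
        ∫⁻ w in {w | StrictMono w}, Ψ w
          ∂(Measure.pi fun _ : Fin (N + 1) => volume.restrict (gapDom ξ)) := by
      rw [← lintegral_indicator measurableSet_strictMono]
      have hae : ∀ᵐ w ∂(Measure.pi fun _ : Fin (N + 1) => volume.restrict (gapDom ξ)),
          ∀ j, w j ∈ gapDom ξ := by
        rw [← Measure.restrict_pi_pi]
        filter_upwards [ae_restrict_mem (MeasurableSet.univ_pi fun _ => mgap)] with w hw j
        exact hw j (mem_univ _)
      refine lintegral_congr_ae ?_
      filter_upwards [hae] with w hw
      have hiff : StrictAnti (fun j => t * Real.exp (-gevLog ξ (w j))) ↔ StrictMono w := by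
        have h : ∀ i j, t * Real.exp (-gevLog ξ (w j)) < t * Real.exp (-gevLog ξ (w i)) ↔
            w i < w j := by
          intro i j
          rw [mul_lt_mul_iff_right₀ ht, Real.exp_lt_exp, neg_lt_neg_iff,
            (strictMonoOn_gevLog ξ).lt_iff_lt (hw i).2 (hw j).2]
        exact ⟨fun H i j hij => (h i j).1 (H hij), fun H i j hij => (h i j).2 (H hij)⟩
      simp only [indicator, mem_ofPred_eq, hiff, hΨ]
      split_ifs <;> simp
    rw [h1, lintegral_strictMono_snoc ξ mΨ]
    refine setLIntegral_congr_fun mgap fun s hs => ?_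
    have mΨs : Measurable fun z : Fin N → ℝ => Ψ (Fin.snoc (s • z) s) :=
      mΨ.comp (measurable_snoc.comp (measurable_const.prodMk (measurable_const_smul s)))
    rw [← lintegral_const_mul _ mΨs]
    refine setLIntegral_congr_fun (measurableSet_simplex N) fun z hz => ?_
    simp only [hΨ, hΦ, hQ]
    rw [← prod_eq_reconWeight hs.1 ht, funext fun j => hFun_eq_recon hz hs ht j]
    ring
  rw [lintegral_pi_limitLaw_eq_strictAnti _ _ hG]
  refine (lintegral_strictAnti_cons mΦ).trans ?_
  rw [setLIntegral_congr_fun measurableSet_Ioi key]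
  have h2 : ∀ z, ∫⁻ p, Q (z, p) ∂(scaleLoc ξ) =
      ∫⁻ t in Ioi (0 : ℝ), ∫⁻ s in gapDom ξ, Q (z, (s, t)) := by
    intro z
    exact lintegral_prod_symm _ (mQ.comp (measurable_const.prodMk measurable_id)).aemeasurable
  change _ = ∫⁻ z in simplex N, ∫⁻ p, Q (z, p) ∂(scaleLoc ξ)
  simp only [h2]
  have mQ2 : Measurable fun q : (Fin N → ℝ) × ℝ => ∫⁻ s in gapDom ξ, Q (q.1, (s, q.2)) := by
    refine Measurable.lintegral_prod_right' (f := fun (q : ((Fin N → ℝ) × ℝ) × ℝ) =>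
      Q (q.1.1, (q.2, q.1.2))) ?_
    exact mQ.comp (by fun_prop)
  conv_rhs => rw [lintegral_lintegral_swap mQ2.aemeasurable]
  refine lintegral_congr fun t => ?_
  exact lintegral_lintegral_swap
    (f := fun s z => Q (z, (s, t))) (mQ.comp (by fun_prop)).aemeasurable


/-! ### Holomorphic parameter integrals -/

/-- By Cauchy's estimate on circles of radius `r / 4` about points of the half ball, a bound on the
integrand also bounds its derivative. Domination of `F` alone therefore permits differentiation
under the integral. -/
theorem analyticAt_integral_of_dominated {α : Type*} [MeasurableSpace α] {μ : Measure α}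
    {F : ℂ → α → ℂ} {x₀ : ℂ} {r : ℝ} (hr : 0 < r) {bound : α → ℝ}
    (hmeas : ∀ ζ ∈ Metric.ball x₀ r, AEStronglyMeasurable (F ζ) μ)
    (hdiff : ∀ᵐ s ∂μ, DifferentiableOn ℂ (fun ζ => F ζ s) (Metric.ball x₀ r))
    (hint : Integrable bound μ)
    (hb : ∀ᵐ s ∂μ, ∀ ζ ∈ Metric.ball x₀ r, ‖F ζ s‖ ≤ bound s) :
    AnalyticAt ℂ (fun ζ => ∫ s, F ζ s ∂μ) x₀ := by
  have hr2 : 0 < r / 2 := half_pos hr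
  have hr4 : 0 < r / 4 := by positivity
  have hsub : ∀ ζ ∈ Metric.ball x₀ (r / 2), Metric.closedBall ζ (r / 4) ⊆ Metric.ball x₀ r := by
    intro ζ hζ w hw
    rw [Metric.mem_ball] at *
    rw [Metric.mem_closedBall] at hw
    linarith [dist_triangle w ζ x₀]
  have hd : DifferentiableOn ℂ (fun ζ => ∫ s, F ζ s ∂μ) (Metric.ball x₀ (r / 2)) := by
    intro ζ hζ
    have hζr : ζ ∈ Metric.ball x₀ r := hsub ζ hζ (Metric.mem_closedBall_self hr4.le)
    have hnhds : Metric.ball x₀ (r / 2) ∈ 𝓝 ζ := Metric.isOpen_ball.mem_nhds hζ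
    have hderiv : ∀ᵐ s ∂μ, ∀ w ∈ Metric.ball x₀ (r / 2),
        HasDerivAt (fun w => F w s) (deriv (fun w => F w s) w) w := by
      filter_upwards [hdiff] with s hs w hw
      exact (hs.differentiableAt (Metric.isOpen_ball.mem_nhds
        (hsub w hw (Metric.mem_closedBall_self hr4.le)))).hasDerivAt
    have hm' : AEStronglyMeasurable (fun s => deriv (fun w => F w s) ζ) μ := by
      have hev : ∀ᶠ n : ℕ in atTop, ζ + ((1 : ℂ) / ((n : ℂ) + 1)) ∈ Metric.ball x₀ r := by
        have : Tendsto (fun n : ℕ => ζ + ((1 : ℂ) / ((n : ℂ) + 1))) atTop (𝓝 (ζ + 0)) :=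
          tendsto_const_nhds.add tendsto_one_div_add_atTop_nhds_zero_nat
        rw [add_zero] at this
        exact this (Metric.isOpen_ball.mem_nhds hζr)
      obtain ⟨n₀, hn₀⟩ := eventually_atTop.1 hev
      -- The derivative is measurable in `s` as a limit of difference quotients; shifting the index
      -- by `n₀` keeps all evaluation points in the ball where `F` is measurable.
      refine aestronglyMeasurable_of_tendsto_ae atTop
        (f := fun (n : ℕ) s => (((n + n₀ : ℕ) : ℂ) + 1) *
          (F (ζ + ((1 : ℂ) / (((n + n₀ : ℕ) : ℂ) + 1))) s - F ζ s)) ?_ ?_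
      · intro n
        exact ((hmeas _ (hn₀ _ (Nat.le_add_left _ _))).sub (hmeas _ hζr)).const_mul _
      · filter_upwards [hderiv] with s hs
        have h1 := (hs ζ hζ).tendsto_slope
        have h2 : Tendsto (fun n : ℕ => ζ + ((1 : ℂ) / ((n : ℂ) + 1))) atTop (𝓝[≠] ζ) := by
          refine tendsto_nhdsWithin_iff.2 ⟨?_, Eventually.of_forall fun n => ?_⟩
          · have : Tendsto (fun n : ℕ => ζ + ((1 : ℂ) / ((n : ℂ) + 1))) atTop (𝓝 (ζ + 0)) :=
              tendsto_const_nhds.add tendsto_one_div_add_atTop_nhds_zero_nat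
            simpa using this
          · have : ((n : ℂ) + 1) ≠ 0 := Nat.cast_add_one_ne_zero n
            simp [this]
        have h3 := (h1.comp h2).comp (tendsto_add_atTop_nat n₀)
        refine h3.congr fun n => ?_
        simp [slope_def_field, div_eq_mul_inv, mul_comm]
    refine (hasDerivAt_integral_of_dominated_loc_of_deriv_le (bound := fun s => bound s / (r / 4))
      hnhds ?_ ?_ hm' ?_ (hint.div_const _) hderiv).2.differentiableAt.differentiableWithinAt
    · filter_upwards [hnhds] with w hw
      exact hmeas w (hsub w hw (Metric.mem_closedBall_self hr4.le))
    · exact hint.mono' (hmeas ζ hζr) (by filter_upwards [hb] with s hs using hs ζ hζr)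
    · filter_upwards [hb, hdiff] with s hs hds w hw
      refine Complex.norm_deriv_le_of_forall_mem_sphere_norm_le hr4 ?_ fun u hu =>
        hs u (hsub w hw (Metric.sphere_subset_closedBall hu))
      exact (hds.mono (hsub w hw)).diffContOnCl_ball subset_rfl
  exact hd.analyticAt (Metric.isOpen_ball.mem_nhds (Metric.mem_ball_self hr2))

/-! ### Complex extension of the reduced variate -/

/-- The complex extension of `gevLog`. -/
def gevLogC (ξ : ℝ) (z : ℂ) : ℂ := if ξ = 0 then z else Complex.log (1 + ξ * z) / ξ

theorem gevLogC_ofReal {ξ y : ℝ} (hy : y ∈ gevDom ξ) : gevLogC ξ y = gevLog ξ y := by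
  unfold gevLogC gevLog
  by_cases h : ξ = 0
  · simp [h]
  · simp only [h, if_false]
    have hy' : 0 ≤ 1 + ξ * y := le_of_lt hy
    push_cast [Complex.ofReal_log hy']
    rfl

theorem differentiableAt_gevLogC {ξ : ℝ} {z : ℂ} (hz : 1 + ξ * z ∈ Complex.slitPlane) :
    DifferentiableAt ℂ (gevLogC ξ) z := by
  unfold gevLogC
  by_cases h : ξ = 0
  · simp only [h, if_true]
    exact differentiableAt_id
  · simp only [h, if_false]
    exact (DifferentiableAt.clog (f := fun z : ℂ => 1 + (ξ : ℂ) * z) (by fun_prop) hz).div_const _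

theorem measurable_gevLogC (ξ : ℝ) : Measurable (gevLogC ξ) := by
  unfold gevLogC
  split_ifs
  · exact measurable_id
  · exact (Complex.measurable_log.comp (by fun_prop)).div_const _

/-- The sign is that of `cos (arg w / ξ)`. The sector condition bounds `|sin (arg w)|` by `|ξ|`, and
Jordan's inequality turns this into `|arg w| ≤ π / 2 * |ξ|`. -/
theorem re_exp_neg_log_div_nonneg {ξ : ℝ} (hξ : ξ ≠ 0) {w : ℂ} (hre : 0 < w.re)
    (him : |w.im| ≤ |ξ| * w.re) : 0 ≤ (Complex.exp (-(Complex.log w / ξ))).re := by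
  have harg : |w.arg| ≤ Real.pi / 2 := (Complex.abs_arg_lt_pi_div_two_iff.2 (Or.inl hre)).le
  have h1 : |w.arg| ≤ Real.pi / 2 * |ξ| := by
    have h2 := Real.mul_abs_le_abs_sin harg
    rw [Complex.sin_arg, abs_div, abs_norm] at h2
    have hn : w.re ≤ ‖w‖ := (le_abs_self _).trans (Complex.abs_re_le_norm w)
    have hn0 : 0 < ‖w‖ := hre.trans_le hn
    have h3 : |w.im| / ‖w‖ ≤ |ξ| := by
      rw [div_le_iff₀ hn0]
      exact him.trans (mul_le_mul_of_nonneg_left hn (abs_nonneg _))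
    have h4 := h2.trans h3
    have hpi := Real.pi_pos
    rw [div_mul_eq_mul_div, div_le_iff₀ hpi] at h4
    linarith
  have hre2 : (-(Complex.log w / ξ)).im = -(w.arg / ξ) := by
    rw [Complex.neg_im, Complex.div_ofReal_im, Complex.log_im]
  rw [Complex.exp_re, hre2, Real.cos_neg]
  refine mul_nonneg (Real.exp_pos _).le (Real.cos_nonneg_of_neg_pi_div_two_le_of_le ?_ ?_)
  · have : |w.arg / ξ| ≤ Real.pi / 2 := by
      rw [abs_div, div_le_iff₀ (abs_pos.2 hξ)]; exact h1
    exact (abs_le.1 this).1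
  · have : |w.arg / ξ| ≤ Real.pi / 2 := by
      rw [abs_div, div_le_iff₀ (abs_pos.2 hξ)]; exact h1
    exact (abs_le.1 this).2

theorem norm_exp_neg_mul_log_div {ξ : ℝ} (c : ℝ) (w : ℂ) :
    ‖Complex.exp (-((c : ℂ) * (Complex.log w / ξ)))‖ = Real.exp (-(c / ξ * Real.log ‖w‖)) := by
  rw [Complex.norm_exp]
  congr 1
  rw [Complex.neg_re, Complex.re_ofReal_mul, Complex.div_ofReal_re, Complex.log_re]
  ring

/-- The real part is a decaying exponential times a cosine. Either the phase is at most `π / 2` and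
the cosine is nonnegative, or the small imaginary part of `ζ` forces `s` to be so large that the
exponential is at most `1 / 2`. -/
theorem exists_gevLogC_bound_zero {x₀ : ℝ} (h0 : 0 < x₀) :
    ∃ r > 0, ∃ C : ℝ, ∀ ζ ∈ Metric.ball (x₀ : ℂ) r, ∀ s ∈ gapDom 0,
      1 + ((0 : ℝ) : ℂ) * (ζ * s) ∈ Complex.slitPlane ∧
      -(1 / 2) ≤ (Complex.exp (-gevLogC 0 (ζ * s))).re ∧
      ‖(s : ℂ) * Complex.exp (-((2 + 0 : ℝ) * gevLogC 0 (ζ * s)))‖ ≤ C := by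
  refine ⟨x₀ / 4, by positivity, 1 / x₀, fun ζ hζ s hs => ?_⟩
  rw [Metric.mem_ball, Complex.dist_eq] at hζ
  have hx : |ζ.re - x₀| < x₀ / 4 := by
    simpa using (Complex.abs_re_le_norm (ζ - x₀)).trans_lt hζ
  have hy : |ζ.im| < x₀ / 4 := by
    simpa using (Complex.abs_im_le_norm (ζ - x₀)).trans_lt hζ
  have hx' : x₀ / 2 ≤ ζ.re := by linarith [(abs_lt.1 hx).1]
  have hs0 : 0 < s := hs.1
  have hxs : 0 < ζ.re * s := mul_pos (by linarith) hs0
  refine ⟨by simp [Complex.one_mem_slitPlane], ?_, ?_⟩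
  · simp only [gevLogC, if_true]
    rw [Complex.exp_re]
    have e1 : (-(ζ * (s : ℂ))).re = -(ζ.re * s) := by simp
    have e2 : (-(ζ * (s : ℂ))).im = -(ζ.im * s) := by simp
    rw [e1, e2, Real.cos_neg]
    by_cases h : |ζ.im * s| ≤ Real.pi / 2
    · have := mul_nonneg (Real.exp_pos (-(ζ.re * s))).le
        (Real.cos_nonneg_of_neg_pi_div_two_le_of_le (abs_le.1 h).1 (abs_le.1 h).2)
      linarith
    · rw [not_le, abs_mul, abs_of_pos hs0] at h
      have h1 : |ζ.im| * s ≤ x₀ / 4 * s := mul_le_mul_of_nonneg_right hy.le hs0.le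
      have h2 : 1 ≤ ζ.re * s := by
        have := mul_le_mul_of_nonneg_right hx' hs0.le
        linarith [Real.pi_gt_three]
      have h3 : Real.exp (-(ζ.re * s)) ≤ 1 / 2 := by
        rw [Real.exp_neg, ← one_div]
        refine one_div_le_one_div_of_le two_pos ?_
        linarith [Real.add_one_le_exp (ζ.re * s)]
      have h4 := Real.neg_one_le_cos (ζ.im * s)
      nlinarith [Real.exp_pos (-(ζ.re * s))]
  · simp only [gevLogC, if_true]
    rw [norm_mul, Complex.norm_exp, Complex.norm_real, Real.norm_of_nonneg hs0.le]
    have e1 : (-(((2 + 0 : ℝ) : ℂ) * (ζ * (s : ℂ)))).re = -(2 * (ζ.re * s)) := by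
      simp
    rw [e1, Real.exp_neg, ← div_eq_mul_inv, div_le_div_iff₀ (Real.exp_pos _) h0]
    have := Real.add_one_le_exp (2 * (ζ.re * s))
    have h5 := mul_le_mul_of_nonneg_right hx' hs0.le
    nlinarith

/-- The radius keeps `1 + ξ ζ s` in the sector of `re_exp_neg_log_div_nonneg` for all `s` at once.
For the last bound, the modulus of this number grows linearly in `s` and enters with power at most
`-1`, because `(2 + ξ) / ξ ≥ 1`. -/
theorem exists_gevLogC_bound_of_pos {ξ x₀ : ℝ} (hξ : 0 < ξ) (h0 : 0 < x₀) :
    ∃ r > 0, ∃ C : ℝ, ∀ ζ ∈ Metric.ball (x₀ : ℂ) r, ∀ s ∈ gapDom ξ,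
      1 + (ξ : ℂ) * (ζ * s) ∈ Complex.slitPlane ∧
      -(1 / 2) ≤ (Complex.exp (-gevLogC ξ (ζ * s))).re ∧
      ‖(s : ℂ) * Complex.exp (-((2 + ξ : ℝ) * gevLogC ξ (ζ * s)))‖ ≤ C := by
  refine ⟨min (x₀ / 2) (ξ * x₀ / 2), by positivity, 2 / (ξ * x₀), fun ζ hζ s hs => ?_⟩
  rw [Metric.mem_ball, Complex.dist_eq] at hζ
  have hx : |ζ.re - x₀| < x₀ / 2 := by
    simpa using (Complex.abs_re_le_norm (ζ - x₀)).trans_lt (hζ.trans_le (min_le_left _ _))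
  have hy : |ζ.im| < ξ * x₀ / 2 := by
    simpa using (Complex.abs_im_le_norm (ζ - x₀)).trans_lt (hζ.trans_le (min_le_right _ _))
  have hx' : x₀ / 2 < ζ.re := by linarith [(abs_lt.1 hx).1]
  have hs0 : 0 < s := hs.1
  have hxs : 0 < ζ.re * s := mul_pos (by linarith) hs0
  set w : ℂ := 1 + (ξ : ℂ) * (ζ * s) with hw
  have hre : w.re = 1 + ξ * (ζ.re * s) := by simp [hw]
  have him : w.im = ξ * (ζ.im * s) := by simp [hw]
  have hre0 : 1 < w.re := by rw [hre]; linarith [mul_pos hξ hxs]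
  have hn : w.re ≤ ‖w‖ := (le_abs_self _).trans (Complex.abs_re_le_norm w)
  refine ⟨Complex.mem_slitPlane_iff.2 (Or.inl (by linarith)), ?_, ?_⟩
  · simp only [gevLogC, hξ.ne', if_false, ← hw]
    have := re_exp_neg_log_div_nonneg (ξ := ξ) hξ.ne' (w := w) (by linarith) (by
      rw [him, hre, abs_mul, abs_mul, abs_of_pos hs0, abs_of_pos hξ]
      have h1 : |ζ.im| * s ≤ ξ * x₀ / 2 * s := mul_le_mul_of_nonneg_right hy.le hs0.le
      have h2 : ξ * x₀ / 2 * s ≤ ξ * (ζ.re * s) := by nlinarith [mul_pos hξ hs0]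
      refine mul_le_mul_of_nonneg_left ?_ hξ.le
      linarith)
    linarith
  · simp only [gevLogC, hξ.ne', if_false, ← hw]
    rw [norm_mul, norm_exp_neg_mul_log_div, Complex.norm_real, Real.norm_of_nonneg hs0.le]
    have hlog : 0 ≤ Real.log ‖w‖ := Real.log_nonneg (by linarith)
    have e1 : -((2 + ξ) / ξ * Real.log ‖w‖) ≤ -Real.log ‖w‖ := by
      have : (2 + ξ) / ξ = 2 / ξ + 1 := by field_simp
      rw [this]
      have : 0 ≤ 2 / ξ * Real.log ‖w‖ := by positivity
      linarith
    have e2 := Real.exp_le_exp.2 e1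
    rw [Real.exp_neg (Real.log _), Real.exp_log (by linarith)] at e2
    have e3 : ξ * x₀ / 2 * s ≤ ‖w‖ := by
      have : ξ * x₀ / 2 * s ≤ ξ * (ζ.re * s) := by nlinarith [mul_pos hξ hs0]
      linarith
    calc s * _ ≤ s * ‖w‖⁻¹ := mul_le_mul_of_nonneg_left e2 hs0.le
      _ ≤ 2 / (ξ * x₀) := by
        rw [← div_eq_mul_inv, div_le_div_iff₀ (by linarith) (by positivity)]
        linarith

/-- Here `s` is bounded by `-1 / ξ`, and `x₀ < 1` keeps the real part of `1 + ξ ζ s` above `(1 - x₀)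
/ 2`, away from the branch point. Its modulus thus lies between two positive constants, so every
real power of it is bounded, whatever the sign of the exponent. -/
theorem exists_gevLogC_bound_of_neg {ξ x₀ : ℝ} (hξ : ξ < 0) (h1 : x₀ < 1) (h0 : 0 < x₀) :
    ∃ r > 0, ∃ C : ℝ, ∀ ζ ∈ Metric.ball (x₀ : ℂ) r, ∀ s ∈ gapDom ξ,
      1 + (ξ : ℂ) * (ζ * s) ∈ Complex.slitPlane ∧
      -(1 / 2) ≤ (Complex.exp (-gevLogC ξ (ζ * s))).re ∧
      ‖(s : ℂ) * Complex.exp (-((2 + ξ : ℝ) * gevLogC ξ (ζ * s)))‖ ≤ C := by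
  have h1' : 0 < 1 - x₀ := by linarith
  have hξ' : 0 < -ξ := by linarith
  refine ⟨min (min x₀ ((1 - x₀) / 2)) (-ξ * ((1 - x₀) / 2)), by positivity,
    (1 / -ξ) * Real.exp (|(2 + ξ) / ξ| * (Real.log 3 + |Real.log ((1 - x₀) / 2)|)),
    fun ζ hζ s hs => ?_⟩
  rw [Metric.mem_ball, Complex.dist_eq] at hζ
  have hx0 : |ζ.re - x₀| < x₀ := by
    simpa using (Complex.abs_re_le_norm (ζ - x₀)).trans_lt
      (hζ.trans_le ((min_le_left _ _).trans (min_le_left _ _)))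
  have hx : |ζ.re - x₀| < (1 - x₀) / 2 := by
    simpa using (Complex.abs_re_le_norm (ζ - x₀)).trans_lt
      (hζ.trans_le ((min_le_left _ _).trans (min_le_right _ _)))
  have hy : |ζ.im| < -ξ * ((1 - x₀) / 2) := by
    simpa using (Complex.abs_im_le_norm (ζ - x₀)).trans_lt (hζ.trans_le (min_le_right _ _))
  have hnorm : ‖ζ‖ ≤ 2 := by
    have : ‖ζ‖ ≤ ‖ζ - x₀‖ + ‖(x₀ : ℂ)‖ := by
      simpa using norm_add_le (ζ - x₀) (x₀ : ℂ)
    rw [Complex.norm_real, Real.norm_of_nonneg h0.le] at this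
    have h2 := hζ.trans_le ((min_le_left _ _).trans (min_le_left _ _))
    linarith
  have hx' : ζ.re < 1 - (1 - x₀) / 2 := by linarith [(abs_lt.1 hx).2]
  have hx'' : 0 < ζ.re := by linarith [(abs_lt.1 hx0).1]
  have hs0 : 0 < s := hs.1
  have hs1 : -ξ * s < 1 := by linarith [hs.2]
  set w : ℂ := 1 + (ξ : ℂ) * (ζ * s) with hw
  have hre : w.re = 1 + ξ * (ζ.re * s) := by simp [hw]
  have him : w.im = ξ * (ζ.im * s) := by simp [hw]
  have hre0 : (1 - x₀) / 2 < w.re := by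
    rw [hre]
    nlinarith [mul_lt_mul_of_pos_left hs1 hx'']
  have hre1 : 0 < w.re := by linarith
  have hn : w.re ≤ ‖w‖ := (le_abs_self _).trans (Complex.abs_re_le_norm w)
  refine ⟨Complex.mem_slitPlane_iff.2 (Or.inl (by linarith)), ?_, ?_⟩
  · simp only [gevLogC, hξ.ne, if_false, ← hw]
    have := re_exp_neg_log_div_nonneg (ξ := ξ) hξ.ne (w := w) (by linarith) (by
      rw [him, abs_mul, abs_mul, abs_of_pos hs0, abs_of_neg hξ]
      calc -ξ * (|ζ.im| * s) = (-ξ * s) * |ζ.im| := by ring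
        _ ≤ 1 * |ζ.im| := mul_le_mul_of_nonneg_right hs1.le (abs_nonneg _)
        _ ≤ -ξ * ((1 - x₀) / 2) := by linarith
        _ ≤ -ξ * w.re := mul_le_mul_of_nonneg_left hre0.le hξ'.le)
    linarith
  · simp only [gevLogC, hξ.ne, if_false, ← hw]
    rw [norm_mul, norm_exp_neg_mul_log_div, Complex.norm_real, Real.norm_of_nonneg hs0.le]
    have hw3 : ‖w‖ ≤ 3 := by
      have : ‖(ξ : ℂ) * (ζ * s)‖ ≤ 2 := by
        rw [norm_mul, norm_mul, Complex.norm_real, Complex.norm_real, Real.norm_of_nonneg hs0.le,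
          Real.norm_of_nonpos hξ.le]
        calc -ξ * (‖ζ‖ * s) = (-ξ * s) * ‖ζ‖ := by ring
          _ ≤ 1 * ‖ζ‖ := mul_le_mul_of_nonneg_right hs1.le (norm_nonneg _)
          _ ≤ 2 := by linarith
      calc ‖w‖ ≤ ‖(1 : ℂ)‖ + ‖(ξ : ℂ) * (ζ * s)‖ := norm_add_le _ _
        _ ≤ 3 := by rw [norm_one]; linarith
    have hlog : |Real.log ‖w‖| ≤ Real.log 3 + |Real.log ((1 - x₀) / 2)| := by
      have l1 : Real.log ‖w‖ ≤ Real.log 3 := Real.log_le_log (by linarith) hw3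
      have l2 : Real.log ((1 - x₀) / 2) ≤ Real.log ‖w‖ :=
        Real.log_le_log (by linarith) (by linarith)
      have l3 : 0 ≤ Real.log 3 := Real.log_nonneg (by norm_num)
      rw [abs_le]
      constructor
      · linarith [neg_abs_le (Real.log ((1 - x₀) / 2))]
      · linarith [abs_nonneg (Real.log ((1 - x₀) / 2))]
    refine mul_le_mul ?_ (Real.exp_le_exp.2 ?_) (Real.exp_pos _).le (by positivity)
    · rw [le_div_iff₀ hξ']; linarith
    · refine (neg_le_abs _).trans ?_
      rw [abs_mul]
      exact mul_le_mul_of_nonneg_left hlog (abs_nonneg _)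

/-- Three facts, uniform in `s`, for complexifying one coordinate: the logarithm is holomorphic, the
corresponding summand of `expSum` cannot cancel the leading `1`, and the factor of that coordinate
in the integrand is bounded. -/
theorem exists_gevLogC_bound (ξ : ℝ) {x₀ : ℝ} (h0 : 0 < x₀) (h1 : x₀ < 1) :
    ∃ r > 0, ∃ C : ℝ, ∀ ζ ∈ Metric.ball (x₀ : ℂ) r, ∀ s ∈ gapDom ξ,
      1 + (ξ : ℂ) * (ζ * s) ∈ Complex.slitPlane ∧
      -(1 / 2) ≤ (Complex.exp (-gevLogC ξ (ζ * s))).re ∧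
      ‖(s : ℂ) * Complex.exp (-((2 + ξ : ℝ) * gevLogC ξ (ζ * s)))‖ ≤ C := by
  rcases lt_trichotomy ξ 0 with h | rfl | h
  · exact exists_gevLogC_bound_of_neg h h1 h0
  · exact exists_gevLogC_bound_zero h0
  · exact exists_gevLogC_bound_of_pos h h0


/-! ### The limiting density -/

/-- The open unit cube. -/
def cube (N : ℕ) : Set (Fin N → ℝ) := {z | ∀ j, 0 < z j ∧ z j < 1}

theorem isOpen_cube (N : ℕ) : IsOpen (cube N) := by
  have : cube N = univ.pi fun _ => Ioo 0 1 := by ext z; simp [cube]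
  rw [this]
  exact isOpen_set_pi finite_univ fun _ _ => isOpen_Ioo

theorem isOpen_simplex (N : ℕ) : IsOpen (simplex N) := by
  have : IsOpen {z : Fin N → ℝ | StrictMono z} := by
    simp only [StrictMono, ofPred_forall]
    refine isOpen_iInter_of_finite fun i => isOpen_iInter_of_finite fun j =>
      isOpen_iInter_of_finite fun _ => isOpen_lt (continuous_apply i) (continuous_apply j)
  exact this.inter (isOpen_cube N)

/-- The integrand of the limiting density, in terms of the reduced variate. -/
def coreIntegrand {N : ℕ} (ξ : ℝ) (z : Fin N → ℝ) (s : ℝ) : ℝ :=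
  s ^ N * Real.exp (-2 * (N + 2) * Real.log (expSum ξ z s) -
    (2 + ξ) * ((∑ j, gevLog ξ (z j * s)) + gevLog ξ s))

/-- The limiting density up to a constant, extended to the whole cube. -/
def coreDensity {N : ℕ} (ξ : ℝ) (z : Fin N → ℝ) : ℝ := ∫ s in gapDom ξ, coreIntegrand ξ z s

/-- The constant `(N + 2)! Γ(2 (N + 2))` of the limiting density. -/
def densityConst (N : ℕ) : ℝ := (Nat.factorial (N + 2) : ℝ) * Real.Gamma (2 * (N + 2))

theorem densityConst_pos (N : ℕ) : 0 < densityConst N :=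
  mul_pos (by positivity) (Real.Gamma_pos_of_pos (by positivity))

theorem gapDom_eq (ξ : ℝ) :
    gapDom ξ = if ξ < 0 then Ioo 0 (-1 / ξ) else Ioi (0 : ℝ) := by
  ext s
  split_ifs with h
  · simp only [gapDom, mem_ofPred_eq, mem_Ioo, and_congr_right_iff]
    intro _
    rw [lt_div_iff_of_neg h]
    constructor <;> intro h <;> linarith
  · simp only [gapDom, mem_ofPred_eq, mem_Ioi, and_iff_left_iff_imp]
    intro hs
    have := mul_nonneg (not_lt.1 h) hs.le
    linarith

/-- Powers of `1 + ξ y` become exponentials of `gevLog`, and `(1 + 2 / ξ) * ξ = 2 + ξ`. Unlike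
`limitDensity`, the function `coreDensity` is not cut off at unordered vectors, which is what the
analytic argument on the cube needs. -/
theorem limitDensity_eq {N : ℕ} (ξ : ℝ) {z : Fin N → ℝ} (h1 : ∀ j, 0 ≤ z j ∧ z j ≤ 1)
    (h2 : Monotone z) : limitDensity ξ z = densityConst N * coreDensity ξ z := by
  unfold limitDensity coreDensity densityConst
  rw [if_pos ⟨h1, h2⟩]
  congr 1
  by_cases h : ξ = 0
  · have : gapDom ξ = Ioi 0 := by rw [gapDom_eq]; simp [h]
    rw [this, if_pos h]
    refine setIntegral_congr_fun measurableSet_Ioi fun s _ => ?_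
    simp only [coreIntegrand, expSum, gevLog, h, if_true, neg_mul, ← Finset.sum_mul]
    congr 3
    ring
  · rw [if_neg h, ← gapDom_eq]
    refine setIntegral_congr_fun (isOpen_gapDom ξ).measurableSet fun s hs => ?_
    have key : ∀ y ∈ gevDom ξ, (1 + ξ * y) ^ (-1 / ξ) = Real.exp (-gevLog ξ y) := by
      intro y hy
      have hy' : 0 < 1 + ξ * y := hy
      rw [Real.rpow_def_of_pos hy', gevLog, if_neg h]
      congr 1; ring
    have hl : ∀ y, Real.log (1 + ξ * y) = ξ * gevLog ξ y := by
      intro y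
      rw [gevLog, if_neg h]; field_simp
    have e : ∀ j, z j * ξ * s = ξ * (z j * s) := fun j => by ring
    simp only [coreIntegrand, expSum, e, hl]
    rw [key s hs.2, Finset.sum_congr rfl fun j _ =>
      key (z j * s) (mul_mem_gevDom hs (h1 j).1 (h1 j).2), ← Finset.mul_sum]
    have e2 : ∀ A : ℝ, (1 + 2 / ξ) * (ξ * A) = (2 + ξ) * A := by
      intro A; field_simp; ring
    rw [← mul_add, e2]

theorem limitDensity_of_mem_simplex {N : ℕ} (ξ : ℝ) {z : Fin N → ℝ} (hz : z ∈ simplex N) :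
    limitDensity ξ z = densityConst N * coreDensity ξ z :=
  limitDensity_eq ξ (fun j => ⟨(hz.2 j).1.le, (hz.2 j).2.le⟩) hz.1.monotone

theorem one_le_expSum {N : ℕ} (ξ : ℝ) (z : Fin N → ℝ) (s : ℝ) : 1 ≤ expSum ξ z s := by
  unfold expSum
  have : 0 ≤ ∑ j, Real.exp (-gevLog ξ (z j * s)) :=
    Finset.sum_nonneg fun _ _ => (Real.exp_pos _).le
  linarith [Real.exp_pos (-gevLog ξ s)]

/-- `exp (-(2 + ξ) gevLog ξ s)`. -/
def gapWeight (ξ s : ℝ) : ℝ := Real.exp (-((2 + ξ) * gevLog ξ s))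

theorem gapWeight_pos (ξ s : ℝ) : 0 < gapWeight ξ s := Real.exp_pos _

theorem measurable_gapWeight (ξ : ℝ) : Measurable (gapWeight ξ) := by
  have := measurable_gevLog ξ
  unfold gapWeight
  fun_prop

/-- Under `x = exp (-gevLog ξ s)` the weight becomes `x dx` on the unit interval. -/
theorem integrableOn_gapWeight (ξ : ℝ) : IntegrableOn (gapWeight ξ) (gapDom ξ) := by
  refine ⟨(measurable_gapWeight ξ).aestronglyMeasurable, ?_⟩
  rw [hasFiniteIntegral_iff_ofReal (Eventually.of_forall fun s => (gapWeight_pos ξ s).le)]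
  have h := lintegral_Ioo_eq_gapDom ξ one_pos fun x => ENNReal.ofReal x
  have h2 : ∫⁻ s in gapDom ξ, ENNReal.ofReal (gapWeight ξ s) =
      ∫⁻ x in Ioo (0 : ℝ) 1, ENNReal.ofReal x := by
    rw [h]
    refine lintegral_congr fun s => ?_
    rw [← ENNReal.ofReal_mul (by positivity), one_mul, one_mul, ← Real.exp_add]
    unfold gapWeight
    congr 2
    ring
  rw [h2]
  calc ∫⁻ x in Ioo (0 : ℝ) 1, ENNReal.ofReal x ≤ ∫⁻ x in Ioo (0 : ℝ) 1, 1 := by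
        refine setLIntegral_mono measurable_const fun x hx => ?_
        simpa using hx.2.le
    _ < ⊤ := by simp

/-- Distributing `s ^ N` over the `N` coordinates leaves one integrable weight free of `z` and, for
each coordinate, a factor bounded in `s` locally uniformly in `z j`. All dominations rest on this
form or on its analogue for `reconWeight`. -/
theorem coreIntegrand_eq {N : ℕ} (ξ : ℝ) (z : Fin N → ℝ) (s : ℝ) :
    coreIntegrand ξ z s = gapWeight ξ s *
      (∏ j, (s * Real.exp (-((2 + ξ) * gevLog ξ (z j * s))))) *
      (expSum ξ z s ^ (2 * (N + 2)))⁻¹ := by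
  have hS : 0 < expSum ξ z s := one_pos.trans_le (one_le_expSum ξ z s)
  have h1 : (expSum ξ z s ^ (2 * (N + 2)))⁻¹ =
      Real.exp (-2 * (N + 2) * Real.log (expSum ξ z s)) := by
    conv_lhs => rw [← Real.exp_log hS, ← Real.exp_nat_mul, ← Real.exp_neg]
    congr 1
    push_cast
    ring
  rw [h1, Finset.prod_mul_distrib, ← Real.exp_sum, gapWeight, coreIntegrand]
  simp only [Finset.prod_const, Finset.card_univ, Fintype.card_fin]
  have e : -2 * ((N : ℝ) + 2) * Real.log (expSum ξ z s) -
      (2 + ξ) * ((∑ j, gevLog ξ (z j * s)) + gevLog ξ s) =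
      -2 * ((N : ℝ) + 2) * Real.log (expSum ξ z s) + (-((2 + ξ) * gevLog ξ s) +
        -((2 + ξ) * ∑ j, gevLog ξ (z j * s))) := by ring
  rw [e, Real.exp_add, Real.exp_add, Finset.sum_neg_distrib, ← Finset.mul_sum]
  ring

theorem measurable_coreIntegrand {N : ℕ} (ξ : ℝ) :
    Measurable fun q : (Fin N → ℝ) × ℝ => coreIntegrand ξ q.1 q.2 := by
  have := measurable_gevLog ξ
  unfold coreIntegrand expSum
  fun_prop

theorem measurable_coreDensity {N : ℕ} (ξ : ℝ) :
    Measurable (coreDensity ξ : (Fin N → ℝ) → ℝ) :=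
  (StronglyMeasurable.integral_prod_right' (f := fun q : (Fin N → ℝ) × ℝ =>
    coreIntegrand ξ q.1 q.2) (measurable_coreIntegrand ξ).stronglyMeasurable).measurable

theorem measurable_limitDensity {N : ℕ} (ξ : ℝ) :
    Measurable (limitDensity ξ : (Fin N → ℝ) → ℝ) := by
  set S : Set (Fin N → ℝ) := {z | (∀ j, 0 ≤ z j ∧ z j ≤ 1) ∧ Monotone z}
  have hS : MeasurableSet S := by
    refine (IsClosed.inter ?_ ?_).measurableSet
    · change IsClosed {z : Fin N → ℝ | ∀ j, 0 ≤ z j ∧ z j ≤ 1}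
      rw [ofPred_forall]
      exact isClosed_iInter fun j => (isClosed_le continuous_const (continuous_apply j)).inter
        (isClosed_le (continuous_apply j) continuous_const)
    · change IsClosed {z : Fin N → ℝ | ∀ i j, i ≤ j → z i ≤ z j}
      simp only [ofPred_forall]
      exact isClosed_iInter fun i => isClosed_iInter fun j => isClosed_iInter fun _ =>
        isClosed_le (continuous_apply i) (continuous_apply j)
  have : (limitDensity ξ : (Fin N → ℝ) → ℝ) =
      S.indicator (fun z => densityConst N * coreDensity ξ z) := by
    ext z
    by_cases hz : z ∈ S
    · rw [indicator_of_mem hz, limitDensity_eq ξ hz.1 hz.2]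
    · rw [indicator_of_notMem hz, limitDensity]
      exact if_neg hz
  rw [this]
  exact ((measurable_coreDensity ξ).const_mul _).indicator hS

/-! ### Local domination -/

theorem exists_gevLog_bound (ξ : ℝ) {x₀ : ℝ} (h0 : 0 < x₀) (h1 : x₀ < 1) :
    ∃ C : ℝ, ∀ᶠ x in 𝓝 x₀, ∀ s ∈ gapDom ξ,
      s * Real.exp (-((2 + ξ) * gevLog ξ (x * s))) ≤ C := by
  obtain ⟨r, hr, C, hC⟩ := exists_gevLogC_bound ξ h0 h1
  refine ⟨C, ?_⟩
  filter_upwards [Metric.ball_mem_nhds x₀ hr, Ioo_mem_nhds h0 h1] with x hx hx01 s hs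
  have hx' : (x : ℂ) ∈ Metric.ball (x₀ : ℂ) r := by
    simpa [Complex.dist_eq, ← Complex.ofReal_sub, Real.dist_eq] using hx
  have h := (hC x hx' s hs).2.2
  rw [← Complex.ofReal_mul, gevLogC_ofReal (mul_mem_gevDom hs hx01.1.le hx01.2.le),
    ← Complex.ofReal_mul, ← Complex.ofReal_neg, ← Complex.ofReal_exp, ← Complex.ofReal_mul,
    Complex.norm_real] at h
  exact (le_abs_self _).trans h

theorem exists_prod_gevLog_bound {N : ℕ} (ξ : ℝ) {z₀ : Fin N → ℝ} (hz₀ : z₀ ∈ cube N) :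
    ∃ C : ℝ, 0 ≤ C ∧ ∀ᶠ z in 𝓝 z₀, ∀ s ∈ gapDom ξ,
      ∏ j, (s * Real.exp (-((2 + ξ) * gevLog ξ (z j * s)))) ≤ C := by
  choose C hC using fun j => exists_gevLog_bound ξ (hz₀ j).1 (hz₀ j).2
  refine ⟨∏ j, |C j|, Finset.prod_nonneg fun _ _ => abs_nonneg _, ?_⟩
  have : ∀ᶠ z in 𝓝 z₀, ∀ j, ∀ s ∈ gapDom ξ,
      s * Real.exp (-((2 + ξ) * gevLog ξ (z j * s))) ≤ C j := by
    rw [eventually_all]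
    exact fun j => (continuous_apply j).continuousAt.eventually (hC j)
  filter_upwards [this] with z hz s hs
  exact Finset.prod_le_prod (fun j _ => mul_nonneg hs.1.le (Real.exp_pos _).le)
    fun j _ => (hz j s hs).trans (le_abs_self _)

theorem reconWeight_eq {N : ℕ} (ξ : ℝ) (z : Fin N → ℝ) (p : ℝ × ℝ) :
    reconWeight ξ z p = gapWeight ξ p.1 *
      (∏ j, (p.1 * Real.exp (-((2 + ξ) * gevLog ξ (z j * p.1))))) *
      (p.2 ^ (2 * N + 3) * Real.exp (-(p.2 * expSum ξ z p.1))) := by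
  rw [Finset.prod_mul_distrib, ← Real.exp_sum, gapWeight, reconWeight]
  simp only [Finset.prod_const, Finset.card_univ, Fintype.card_fin]
  rw [mul_add, neg_add, Real.exp_add, Finset.sum_neg_distrib, ← Finset.mul_sum]
  ring

theorem reconWeight_pos {N : ℕ} (ξ : ℝ) (z : Fin N → ℝ) {p : ℝ × ℝ} (h1 : 0 < p.1)
    (h2 : 0 < p.2) : 0 < reconWeight ξ z p := by
  unfold reconWeight
  positivity

theorem ae_scaleLoc (ξ : ℝ) : ∀ᵐ p ∂(scaleLoc ξ), p.1 ∈ gapDom ξ ∧ 0 < p.2 := by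
  unfold scaleLoc
  rw [Measure.prod_restrict]
  exact ae_restrict_mem ((isOpen_gapDom ξ).measurableSet.prod measurableSet_Ioi)

/-- An integrable function dominating `reconWeight`. -/
def reconBound (N : ℕ) (ξ C : ℝ) (p : ℝ × ℝ) : ℝ :=
  C * gapWeight ξ p.1 * (p.2 ^ (2 * N + 3) * Real.exp (-p.2))

theorem integrable_pow_mul_exp_neg (n : ℕ) {S : ℝ} (hS : 0 < S) :
    IntegrableOn (fun t : ℝ => t ^ n * Real.exp (-(t * S))) (Ioi 0) := by
  have h := integrableOn_rpow_mul_exp_neg_mul_rpow (p := 1) (s := n) (b := S)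
    (by have : (0 : ℝ) ≤ n := n.cast_nonneg
        linarith) one_pos hS
  refine h.congr_fun (fun t ht => ?_) measurableSet_Ioi
  simp [mul_comm]

theorem integral_pow_mul_exp_neg (n : ℕ) {S : ℝ} (hS : 0 < S) :
    ∫ t in Ioi (0 : ℝ), t ^ n * Real.exp (-(t * S)) =
      Real.Gamma (n + 1) * (S ^ (n + 1))⁻¹ := by
  have h := Real.integral_rpow_mul_exp_neg_mul_Ioi (a := n + 1) (r := S) (by positivity) hS
  have e : ((n : ℝ) + 1) = ((n + 1 : ℕ) : ℝ) := by push_cast; rfl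
  rw [mul_comm, one_div] at h
  have e' : S⁻¹ ^ ((n : ℝ) + 1) = S⁻¹ ^ ((n + 1 : ℕ) : ℝ) := by rw [e]
  rw [e', Real.rpow_natCast, inv_pow] at h
  rw [← h]
  refine setIntegral_congr_fun measurableSet_Ioi fun t ht => ?_
  simp [mul_comm]

theorem integrable_reconBound (N : ℕ) (ξ C : ℝ) :
    Integrable (reconBound N ξ C) (scaleLoc ξ) := by
  have h1 := (integrableOn_gapWeight ξ).const_mul C
  have h2 := integrable_pow_mul_exp_neg (2 * N + 3) one_pos
  simp only [mul_one] at h2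
  exact Integrable.mul_prod h1 h2

theorem exists_reconWeight_bound {N : ℕ} (ξ : ℝ) {z₀ : Fin N → ℝ} (hz₀ : z₀ ∈ cube N) :
    ∃ C : ℝ, ∀ᶠ z in 𝓝 z₀, ∀ p : ℝ × ℝ, p.1 ∈ gapDom ξ ∧ 0 < p.2 →
      reconWeight ξ z p ≤ reconBound N ξ C p := by
  obtain ⟨C, hC0, hC⟩ := exists_prod_gevLog_bound ξ hz₀
  refine ⟨C, ?_⟩
  filter_upwards [hC] with z hz p hp
  rw [reconWeight_eq, reconBound, mul_comm C]
  have := gapWeight_pos ξ p.1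
  refine mul_le_mul (mul_le_mul_of_nonneg_left (hz _ hp.1) this.le) ?_
    (by have := hp.2; positivity) (by positivity)
  refine mul_le_mul_of_nonneg_left (Real.exp_le_exp.2 ?_) (pow_nonneg hp.2.le _)
  nlinarith [one_le_expSum ξ z p.1, hp.2]

theorem integrable_reconWeight {N : ℕ} (ξ : ℝ) {z : Fin N → ℝ} (hz : z ∈ cube N) :
    Integrable (reconWeight ξ z) (scaleLoc ξ) := by
  obtain ⟨C, hC⟩ := exists_reconWeight_bound ξ hz
  refine (integrable_reconBound N ξ C).mono'
    ((measurable_reconWeight ξ).comp (measurable_const.prodMk measurable_id)).aestronglyMeasurable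
    ?_
  filter_upwards [ae_scaleLoc ξ] with p hp
  rw [Real.norm_of_nonneg (reconWeight_pos ξ z hp.1.1 hp.2).le]
  exact hC.self_of_nhds p hp

theorem continuousAt_expSum {N : ℕ} {ξ s : ℝ} (hs : s ∈ gapDom ξ) {z₀ : Fin N → ℝ}
    (hz₀ : z₀ ∈ cube N) : ContinuousAt (fun z : Fin N → ℝ => expSum ξ z s) z₀ := by
  have h : ∀ j, ContinuousAt (fun z : Fin N → ℝ => gevLog ξ (z j * s)) z₀ := fun j =>
    ContinuousAt.comp (f := fun z : Fin N → ℝ => z j * s) (g := gevLog ξ)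
      (hasDerivAt_gevLog (mul_mem_gevDom hs (hz₀ j).1.le (hz₀ j).2.le)).continuousAt 
      ((continuous_apply j).mul continuous_const).continuousAt
  unfold expSum
  fun_prop

theorem continuousAt_reconWeight {N : ℕ} {ξ : ℝ} {p : ℝ × ℝ} (hs : p.1 ∈ gapDom ξ)
    {z₀ : Fin N → ℝ} (hz₀ : z₀ ∈ cube N) :
    ContinuousAt (fun z : Fin N → ℝ => reconWeight ξ z p) z₀ := by
  have h : ∀ j, ContinuousAt (fun z : Fin N → ℝ => gevLog ξ (z j * p.1)) z₀ := fun j =>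
    ContinuousAt.comp (f := fun z : Fin N → ℝ => z j * p.1) (g := gevLog ξ)
      (hasDerivAt_gevLog (mul_mem_gevDom hs (hz₀ j).1.le (hz₀ j).2.le)).continuousAt 
      ((continuous_apply j).mul continuous_const).continuousAt
  have := continuousAt_expSum hs hz₀
  unfold reconWeight
  fun_prop

/-- Integrals of bounded functions against `reconWeight` depend continuously on the
self-normalized sample. -/
theorem continuousAt_integral_reconWeight {N : ℕ} (ξ : ℝ) {z₀ : Fin N → ℝ} (hz₀ : z₀ ∈ cube N)
    {g : (Fin N → ℝ) → ℝ × ℝ → ℝ} {B : ℝ} (hB : ∀ z p, |g z p| ≤ B)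
    (hm : ∀ z, Measurable (g z)) (hc : ∀ p, ContinuousAt (fun z => g z p) z₀) :
    ContinuousAt (fun z => ∫ p, g z p * reconWeight ξ z p ∂(scaleLoc ξ)) z₀ := by
  obtain ⟨C, hC⟩ := exists_reconWeight_bound ξ hz₀
  refine continuousAt_of_dominated (bound := fun p => B * reconBound N ξ C p) ?_ ?_
    ((integrable_reconBound N ξ C).const_mul B) ?_
  · exact Eventually.of_forall fun z => ((hm z).mul ((measurable_reconWeight ξ).comp
      (measurable_const.prodMk measurable_id))).aestronglyMeasurable
  · filter_upwards [hC] with z hz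
    filter_upwards [ae_scaleLoc ξ] with p hp
    rw [norm_mul, Real.norm_of_nonneg (reconWeight_pos ξ z hp.1.1 hp.2).le]
    exact mul_le_mul (hB z p) (hz p hp) (reconWeight_pos ξ z hp.1.1 hp.2).le
      ((abs_nonneg _).trans (hB z p))
  · filter_upwards [ae_scaleLoc ξ] with p hp
    exact (hc p).mul (continuousAt_reconWeight hp.1 hz₀)

/-- The location coordinate integrates to `Γ(2 N + 4)` times the power `-(2 N + 4)` of `expSum`, the
source of both the constant and the exponent in the limiting density. -/
theorem integral_reconWeight {N : ℕ} (ξ : ℝ) {z : Fin N → ℝ} (hz : z ∈ cube N) :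
    ∫ p, reconWeight ξ z p ∂(scaleLoc ξ) =
      Real.Gamma (2 * (N + 2)) * coreDensity ξ z := by
  unfold scaleLoc
  rw [integral_prod _ (integrable_reconWeight ξ hz), coreDensity, ← integral_const_mul]
  refine integral_congr_ae (Eventually.of_forall fun s => ?_)
  simp only [reconWeight_eq, coreIntegrand_eq]
  rw [integral_const_mul, integral_pow_mul_exp_neg _ (one_pos.trans_le (one_le_expSum ξ z s))]
  have e1 : ((2 * N + 3 : ℕ) : ℝ) + 1 = 2 * (N + 2) := by push_cast; ring
  have e2 : 2 * N + 3 + 1 = 2 * (N + 2) := by ring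
  rw [e1, e2]
  ring

theorem volume_gapDom_pos (ξ : ℝ) : 0 < volume (gapDom ξ) := by
  -- The witness is positive and small enough that its product with `ξ` exceeds `-1` for either
  -- sign.
  refine (isOpen_gapDom ξ).measure_pos _ ⟨1 / (1 + |ξ|), by positivity, ?_⟩
  have h : ξ * (1 / (1 + |ξ|)) = ξ / (1 + |ξ|) := by ring
  have h2 : -1 < ξ / (1 + |ξ|) := by
    rw [lt_div_iff₀ (by positivity)]
    linarith [neg_abs_le ξ]
  linarith

theorem coreDensity_pos {N : ℕ} (ξ : ℝ) {z : Fin N → ℝ} (hz : z ∈ cube N) :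
    0 < coreDensity ξ z := by
  have hG : 0 < Real.Gamma (2 * ((N : ℝ) + 2)) := Real.Gamma_pos_of_pos (by positivity)
  have h : 0 < ∫ p, reconWeight ξ z p ∂(scaleLoc ξ) := by
    have hnn : 0 ≤ᵐ[scaleLoc ξ] reconWeight ξ z := by
      filter_upwards [ae_scaleLoc ξ] with p hp using (reconWeight_pos ξ z hp.1.1 hp.2).le
    rw [integral_pos_iff_support_of_nonneg_ae hnn (integrable_reconWeight ξ hz)]
    have h1 : scaleLoc ξ (Function.support (reconWeight ξ z)) = scaleLoc ξ univ := by
      refine measure_congr ?_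
      filter_upwards [ae_scaleLoc ξ] with p hp
      exact propext (iff_of_true (reconWeight_pos ξ z hp.1.1 hp.2).ne' trivial)
    rw [h1, scaleLoc, ← univ_prod_univ, Measure.prod_prod]
    simp [(volume_gapDom_pos ξ).ne']
  rw [integral_reconWeight ξ hz] at h
  exact (mul_pos_iff_of_pos_left hG).1 h

theorem continuousAt_coreDensity {N : ℕ} (ξ : ℝ) {z₀ : Fin N → ℝ} (hz₀ : z₀ ∈ cube N) :
    ContinuousAt (coreDensity ξ) z₀ := by
  have hG : 0 < Real.Gamma (2 * ((N : ℝ) + 2)) := Real.Gamma_pos_of_pos (by positivity)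
  have h := continuousAt_integral_reconWeight ξ hz₀ (g := fun _ _ => 1) (B := 1) (by simp)
    (fun _ => measurable_const) fun _ => continuousAt_const
  refine (h.div_const (Real.Gamma (2 * ((N : ℝ) + 2)))).congr ?_
  filter_upwards [(isOpen_cube N).mem_nhds hz₀] with z hz
  simp only [one_mul, integral_reconWeight ξ hz]
  field_simp

/-! ### Analyticity in each coordinate -/

/-- The integrand of the limiting density with one complex coordinate. -/
def coreIntegrandC {N : ℕ} (ξ : ℝ) (z : Fin N → ℝ) (i : Fin N) (ζ : ℂ) (s : ℝ) : ℂ :=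
  ((gapWeight ξ s * ∏ j ∈ Finset.univ.erase i,
      (s * Real.exp (-((2 + ξ) * gevLog ξ (z j * s)))) : ℝ) : ℂ) *
    ((s : ℂ) * Complex.exp (-((2 + ξ : ℝ) * gevLogC ξ (ζ * s)))) *
    ((((1 + ∑ j ∈ Finset.univ.erase i, Real.exp (-gevLog ξ (z j * s)) +
      Real.exp (-gevLog ξ s) : ℝ) : ℂ) + Complex.exp (-gevLogC ξ (ζ * s))) ^ (2 * (N + 2)))⁻¹

theorem coreIntegrandC_ofReal {N : ℕ} {ξ : ℝ} (z : Fin N → ℝ) (i : Fin N) {x s : ℝ}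
    (hx0 : 0 < x) (hx1 : x < 1) (hs : s ∈ gapDom ξ) :
    coreIntegrandC ξ z i x s = (coreIntegrand ξ (Function.update z i x) s : ℝ) := by
  rw [coreIntegrand_eq, coreIntegrandC, ← Complex.ofReal_mul,
    gevLogC_ofReal (mul_mem_gevDom hs hx0.le hx1.le)]
  have e1 : ∏ j, (s * Real.exp (-((2 + ξ) * gevLog ξ (Function.update z i x j * s)))) =
      (∏ j ∈ Finset.univ.erase i, (s * Real.exp (-((2 + ξ) * gevLog ξ (z j * s))))) *
        (s * Real.exp (-((2 + ξ) * gevLog ξ (x * s)))) := by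
    rw [← Finset.prod_erase_mul _ _ (Finset.mem_univ i), Function.update_self]
    congr 1
    refine Finset.prod_congr rfl fun j hj => ?_
    rw [Function.update_of_ne (Finset.ne_of_mem_erase hj)]
  have e2 : expSum ξ (Function.update z i x) s =
      1 + ∑ j ∈ Finset.univ.erase i, Real.exp (-gevLog ξ (z j * s)) + Real.exp (-gevLog ξ s) +
        Real.exp (-gevLog ξ (x * s)) := by
    unfold expSum
    rw [← Finset.sum_erase_add _ _ (Finset.mem_univ i), Function.update_self]
    have : ∑ j ∈ Finset.univ.erase i, Real.exp (-gevLog ξ (Function.update z i x j * s)) =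
        ∑ j ∈ Finset.univ.erase i, Real.exp (-gevLog ξ (z j * s)) :=
      Finset.sum_congr rfl fun j hj => by
        rw [Function.update_of_ne (Finset.ne_of_mem_erase hj)]
    rw [this]
    ring
  rw [e1, e2]
  push_cast
  ring

/-- One coordinate is made complex and the others are frozen. The resulting parameter integral is
holomorphic by `analyticAt_integral_of_dominated`, and its real part on the real axis is the
function in question. -/
theorem analyticAt_coreDensity_update {N : ℕ} (ξ : ℝ) {z : Fin N → ℝ} (hz : z ∈ cube N)
    (i : Fin N) {x₀ : ℝ} (h0 : 0 < x₀) (h1 : x₀ < 1) :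
    AnalyticAt ℝ (fun x : ℝ => coreDensity ξ (Function.update z i x)) x₀ := by
  obtain ⟨r, hr, C, hC⟩ := exists_gevLogC_bound ξ h0 h1
  have hmem : Function.update z i x₀ ∈ cube N := by
    intro j
    by_cases h : j = i
    · subst h; simpa using ⟨h0, h1⟩
    · rw [Function.update_of_ne h]; exact hz j
  have hgap := (isOpen_gapDom ξ).measurableSet
  have mlog := measurable_gevLog ξ
  have mlogC := measurable_gevLogC ξ
  have mw := measurable_gapWeight ξ
  -- bound on the factors not involving the complex coordinate
  choose D hD using fun j => exists_gevLog_bound ξ (hz j).1 (hz j).2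
  have hD' : ∀ j, ∀ s ∈ gapDom ξ, s * Real.exp (-((2 + ξ) * gevLog ξ (z j * s))) ≤ D j :=
    fun j => (hD j).self_of_nhds
  have hC0 : ∀ s ∈ gapDom ξ, 0 ≤ C := fun s hs =>
    (norm_nonneg _).trans (hC x₀ (Metric.mem_ball_self hr) s hs).2.2
  have han : AnalyticAt ℂ (fun ζ => ∫ s in gapDom ξ, coreIntegrandC ξ z i ζ s) (x₀ : ℂ) := by
    -- The constant `1` and the real exponentials outweigh the one complex term, whose real part is
    -- at least `-1 / 2`; the inverse power is then at most `2 ^ (2 * (N + 2))`.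
    have hA : ∀ ζ ∈ Metric.ball (x₀ : ℂ) r, ∀ s ∈ gapDom ξ,
        1 / 2 ≤ ‖(((1 + ∑ j ∈ Finset.univ.erase i, Real.exp (-gevLog ξ (z j * s)) +
          Real.exp (-gevLog ξ s) : ℝ) : ℂ) + Complex.exp (-gevLogC ξ (ζ * s)))‖ := by
      intro ζ hζ s hs
      refine le_trans ?_ ((le_abs_self _).trans (Complex.abs_re_le_norm _))
      rw [Complex.add_re, Complex.ofReal_re]
      have h3 := (hC ζ hζ s hs).2.1
      have h4 : 0 ≤ ∑ j ∈ Finset.univ.erase i, Real.exp (-gevLog ξ (z j * s)) :=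
        Finset.sum_nonneg fun _ _ => (Real.exp_pos _).le
      linarith [Real.exp_pos (-gevLog ξ s)]
    refine analyticAt_integral_of_dominated hr
      (bound := fun s => gapWeight ξ s * ((∏ j ∈ Finset.univ.erase i, |D j|) * C *
        2 ^ (2 * (N + 2)))) ?_ ?_ ((integrableOn_gapWeight ξ).mul_const _) ?_
    · intro ζ _
      refine Measurable.aestronglyMeasurable ?_
      unfold coreIntegrandC
      fun_prop
    · filter_upwards [ae_restrict_mem hgap] with s hs ζ hζ
      have hne := (norm_pos_iff.1 (one_half_pos.trans_le (hA ζ hζ s hs)))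
      have hdl : DifferentiableAt ℂ (fun ζ : ℂ => gevLogC ξ (ζ * s)) ζ :=
        DifferentiableAt.comp (f := fun ζ : ℂ => ζ * s) (g := gevLogC ξ) ζ
          (differentiableAt_gevLogC (hC ζ hζ s hs).1) (by fun_prop)
      refine DifferentiableAt.differentiableWithinAt ?_
      unfold coreIntegrandC
      refine DifferentiableAt.mul (by fun_prop) (DifferentiableAt.fun_inv (by fun_prop) ?_)
      exact pow_ne_zero _ hne
    · filter_upwards [ae_restrict_mem hgap] with s hs ζ hζ
      unfold coreIntegrandC
      rw [norm_mul, norm_mul, Complex.norm_real, norm_inv, norm_pow, norm_mul,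
        Real.norm_of_nonneg (gapWeight_pos ξ s).le, mul_assoc, mul_assoc, mul_assoc]
      refine mul_le_mul_of_nonneg_left ?_ (gapWeight_pos ξ s).le
      refine mul_le_mul ?_ (mul_le_mul (hC ζ hζ s hs).2.2 ?_ (by positivity) (hC0 s hs))
        (by positivity) (Finset.prod_nonneg fun _ _ => abs_nonneg _)
      · rw [Real.norm_of_nonneg (Finset.prod_nonneg fun _ _ =>
          mul_nonneg hs.1.le (Real.exp_pos _).le)]
        exact Finset.prod_le_prod (fun _ _ => mul_nonneg hs.1.le (Real.exp_pos _).le)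
          fun j _ => (hD' j s hs).trans (le_abs_self _)
      · rw [inv_le_comm₀ (pow_pos (one_half_pos.trans_le (hA ζ hζ s hs)) _) (by positivity),
          ← inv_pow]
        refine pow_le_pow_left₀ (by norm_num) ?_ _
        have := hA ζ hζ s hs
        norm_num at this ⊢
        exact this
  have h2 : AnalyticAt ℝ (fun x : ℝ =>
      (∫ s in gapDom ξ, coreIntegrandC ξ z i (x : ℂ) s).re) x₀ := by
    have h3 : AnalyticAt ℝ (fun ζ => ∫ s in gapDom ξ, coreIntegrandC ξ z i ζ s) (x₀ : ℂ) :=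
      han.restrictScalars
    have h4 : AnalyticAt ℝ (fun x : ℝ => (x : ℂ)) x₀ := Complex.ofRealCLM.analyticAt x₀
    have h5 := (Complex.reCLM.analyticAt _).comp (AnalyticAt.comp h3 h4)
    exact h5
  refine h2.congr ?_
  filter_upwards [Ioo_mem_nhds h0 h1] with x hx
  rw [setIntegral_congr_fun hgap fun s hs => coreIntegrandC_ofReal z i hx.1 hx.2 hs,
    integral_complex_ofReal, Complex.ofReal_re]
  rfl


/-! ### Order statistics and self-normalization -/

theorem orderStat_of_monotone_comp {m : ℕ} {x : Fin m → ℝ} {σ : Equiv.Perm (Fin m)}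
    (h : Monotone (x ∘ σ)) {r : ℕ} (hr : r < m) : orderStat x r = x (σ ⟨r, hr⟩) := by
  have := Tuple.unique_monotone h (Tuple.monotone_sort x)
  rw [orderStat, dif_pos hr]
  exact (congrFun this ⟨r, hr⟩).symm

theorem orderStat_comp_perm {m : ℕ} (x : Fin m → ℝ) (σ : Equiv.Perm (Fin m)) (r : ℕ) :
    orderStat (x ∘ σ) r = orderStat x r := by
  unfold orderStat
  split_ifs with h
  · exact congrFun (Tuple.comp_perm_comp_sort_eq_comp_sort (f := x) (σ := σ)) ⟨r, h⟩
  · rfl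

theorem orderStat_affine {m : ℕ} (x : Fin m → ℝ) {c : ℝ} (hc : 0 < c) (d : ℝ) {r : ℕ}
    (hr : r < m) : orderStat (fun j => c * x j + d) r = c * orderStat x r + d := by
  have h : Monotone ((fun j => c * x j + d) ∘ Tuple.sort x) := by
    intro i j hij
    have := Tuple.monotone_sort x hij
    simp only [Function.comp] at *
    linarith [mul_le_mul_of_nonneg_left this hc.le]
  rw [orderStat_of_monotone_comp h hr, orderStat, dif_pos hr]

theorem selfNorm_affine_perm {N : ℕ} (p : Fin (N + 2) → ℝ) (σ : Equiv.Perm (Fin (N + 2)))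
    {c : ℝ} (hc : 0 < c) (d : ℝ) : selfNorm (fun j => c * p (σ j) + d) = selfNorm p := by
  have h : ∀ r, r < N + 2 →
      orderStat (fun j => c * p (σ j) + d) r = c * orderStat p r + d := by
    intro r hr
    rw [← orderStat_comp_perm p σ]
    exact orderStat_affine (p ∘ σ) hc d hr
  ext j
  unfold selfNorm
  rw [h _ (by omega), h _ (by omega), h _ (by omega)]
  have e : c * orderStat p 0 + d < c * orderStat p (N + 1) + d ↔
      orderStat p 0 < orderStat p (N + 1) := by
    rw [add_lt_add_iff_right, mul_lt_mul_iff_right₀ hc]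
  simp only [e]
  split_ifs
  · rw [add_sub_add_right_eq_sub, add_sub_add_right_eq_sub, ← mul_sub, ← mul_sub,
      mul_div_mul_left _ _ hc.ne']
  · rfl

theorem measurable_selfNorm {N : ℕ} :
    Measurable (selfNorm : (Fin (N + 2) → ℝ) → Fin N → ℝ) := by
  refine measurable_pi_iff.2 fun j => ?_
  unfold selfNorm
  refine Measurable.ite (measurableSet_lt (measurable_orderStat _) (measurable_orderStat _)) ?_
    measurable_const
  exact ((measurable_orderStat _).sub (measurable_orderStat _)).div
    ((measurable_orderStat _).sub (measurable_orderStat _))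

theorem addEnds_zero {N : ℕ} (z : Fin N → ℝ) : addEnds z 0 = 0 := rfl

theorem addEnds_last {N : ℕ} (z : Fin N → ℝ) : addEnds z (Fin.last (N + 1)) = 1 := by
  unfold addEnds
  rw [← Fin.succ_last, Fin.cons_succ, Fin.snoc_last]

theorem addEnds_succ {N : ℕ} (z : Fin N → ℝ) (j : Fin N) : addEnds z j.castSucc.succ = z j := by
  unfold addEnds
  rw [Fin.cons_succ, Fin.snoc_castSucc]

theorem strictMono_addEnds {N : ℕ} {z : Fin N → ℝ} (hz : z ∈ simplex N) :
    StrictMono (addEnds z) := by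
  unfold addEnds
  rw [strictMono_cons, strictMono_snoc]
  refine ⟨⟨hz.1, fun j => (hz.2 j).2⟩, fun j => ?_⟩
  induction j using Fin.lastCases with
  | last => simp
  | cast j => simpa using (hz.2 j).1

theorem selfNorm_of_strictMono {N : ℕ} {p : Fin (N + 2) → ℝ} (hp : StrictMono p) (j : Fin N) :
    selfNorm p j = (p j.castSucc.succ - p 0) / (p (Fin.last (N + 1)) - p 0) := by
  have h : ∀ r (hr : r < N + 2), orderStat p r = p ⟨r, hr⟩ := fun r hr => by
    simpa using orderStat_of_monotone_comp (x := p) (σ := 1) (by simpa using hp.monotone) hr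
  unfold selfNorm
  rw [h 0 (by omega), h (N + 1) (by omega), h (j + 1) (by omega), if_pos]
  · rfl
  · exact hp (Fin.mk_lt_mk.2 (Nat.succ_pos N))

theorem selfNorm_addEnds {N : ℕ} {z : Fin N → ℝ} (hz : z ∈ simplex N) :
    selfNorm (addEnds z) = z := by
  ext j
  rw [selfNorm_of_strictMono (strictMono_addEnds hz), addEnds_zero, addEnds_last, addEnds_succ]
  simp

theorem recon_comp_perm_eq {N : ℕ} (ξ : ℝ) (z : Fin N → ℝ) (p : ℝ × ℝ)
    (σ : Equiv.Perm (Fin (N + 2))) :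
    recon ξ z p ∘ σ = fun j => p.2 ^ (-ξ) * p.1 * addEnds z (σ j) + hFun ξ p.2 := by
  ext j
  simp only [recon, Function.comp]
  ring

theorem selfNorm_recon {N : ℕ} {ξ : ℝ} {z : Fin N → ℝ} (hz : z ∈ simplex N) {p : ℝ × ℝ}
    (h1 : 0 < p.1) (h2 : 0 < p.2) (σ : Equiv.Perm (Fin (N + 2))) :
    selfNorm (recon ξ z p ∘ σ) = z := by
  rw [recon_comp_perm_eq, selfNorm_affine_perm (addEnds z) σ
    (mul_pos (Real.rpow_pos_of_pos h2 _) h1), selfNorm_addEnds hz]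

theorem exists_perm_strictMono {m : ℕ} {p : Fin m → ℝ} (hp : Function.Injective p) :
    ∃ σ : Equiv.Perm (Fin m), StrictMono (p ∘ σ) :=
  ⟨Tuple.sort p, (Tuple.monotone_sort p).strictMono_of_injective
    (hp.comp (Tuple.sort p).injective)⟩

theorem selfNorm_comp_perm {N : ℕ} (p : Fin (N + 2) → ℝ) (σ : Equiv.Perm (Fin (N + 2))) :
    selfNorm (p ∘ σ) = selfNorm p := by
  have := selfNorm_affine_perm p σ one_pos 0
  simpa [Function.comp_def] using this

theorem selfNorm_mem_simplex {N : ℕ} {p : Fin (N + 2) → ℝ} (hp : Function.Injective p) :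
    selfNorm p ∈ simplex N := by
  obtain ⟨σ, hσ⟩ := exists_perm_strictMono hp
  rw [← selfNorm_comp_perm p σ]
  set q := p ∘ σ
  have h0 : 0 < q (Fin.last (N + 1)) - q 0 := sub_pos.2 (hσ (Fin.last_pos))
  refine ⟨fun i j hij => ?_, fun j => ⟨?_, ?_⟩⟩
  · rw [selfNorm_of_strictMono hσ, selfNorm_of_strictMono hσ]
    refine div_lt_div_of_pos_right (sub_lt_sub_right (hσ ?_) _) h0
    simpa using hij
  · rw [selfNorm_of_strictMono hσ]
    exact div_pos (sub_pos.2 (hσ (Fin.succ_pos _))) h0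
  · rw [selfNorm_of_strictMono hσ, div_lt_one h0]
    refine sub_lt_sub_right (hσ ?_) _
    rw [← Fin.succ_last]
    exact Fin.succ_lt_succ_iff.2 (Fin.castSucc_lt_last j)

/-- A vector with distinct entries is an affine image of a permutation of the sorted vector
`(0, selfNorm p, 1)`. -/
theorem exists_eq_affine_addEnds {N : ℕ} {p : Fin (N + 2) → ℝ} (hp : Function.Injective p) :
    ∃ (σ : Equiv.Perm (Fin (N + 2))) (c d : ℝ), 0 < c ∧
      p = fun j => c * addEnds (selfNorm p) (σ j) + d := by
  obtain ⟨σ, hσ⟩ := exists_perm_strictMono hp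
  set q := p ∘ σ with hq
  have h0 : 0 < q (Fin.last (N + 1)) - q 0 := sub_pos.2 (hσ (Fin.last_pos))
  refine ⟨σ.symm, _, q 0, h0, ?_⟩
  have key : ∀ i, q i = (q (Fin.last (N + 1)) - q 0) * addEnds (selfNorm p) i + q 0 := by
    intro i
    induction i using Fin.cases with
    | zero => simp [addEnds_zero]
    | succ i =>
      induction i using Fin.lastCases with
      | last => rw [Fin.succ_last, addEnds_last]; ring
      | cast i =>
        rw [addEnds_succ, ← selfNorm_comp_perm p σ, ← hq, selfNorm_of_strictMono hσ,
          mul_div_cancel₀ _ h0.ne']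
        ring
  ext j
  have := key (σ.symm j)
  rw [← this, hq]
  simp

/-- Maximal invariance: a vector without ties can be moved to `(0, selfNorm p, 1)` by the
transformations that leave the test unchanged. -/
theorem IsEquivariantTest.apply_eq_addEnds {N : ℕ} {φ : ℕ → (Fin (N + 2) → ℝ) → ℝ}
    (hφ : IsEquivariantTest φ) (K : ℕ) {p : Fin (N + 2) → ℝ} (hp : Function.Injective p) :
    φ K p = φ K (addEnds (selfNorm p)) := by
  obtain ⟨σ, c, d, hc, h⟩ := exists_eq_affine_addEnds hp
  conv_lhs => rw [h]
  exact hφ.equivariant K σ c d (addEnds (selfNorm p)) hc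

/-- Away from ties the sorting permutation is locally constant, so locally each component is a ratio
of coordinate differences. -/
theorem continuousAt_selfNorm {N : ℕ} {p : Fin (N + 2) → ℝ} (hp : Function.Injective p) :
    ContinuousAt selfNorm p := by
  obtain ⟨σ, hσ⟩ := exists_perm_strictMono hp
  have hopen : IsOpen {q : Fin (N + 2) → ℝ | StrictMono (q ∘ σ)} := by
    simp only [StrictMono, ofPred_forall]
    exact isOpen_iInter_of_finite fun i => isOpen_iInter_of_finite fun j =>
      isOpen_iInter_of_finite fun _ => isOpen_lt (continuous_apply (σ i)) (continuous_apply (σ j))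
  have hev : ∀ᶠ q in 𝓝 p, StrictMono (q ∘ σ) := hopen.mem_nhds hσ
  refine tendsto_pi_nhds.2 fun j => ?_
  have hne : p (σ (Fin.last (N + 1))) - p (σ 0) ≠ 0 := (sub_pos.2 (hσ (Fin.last_pos))).ne'
  have hc : ContinuousAt (fun q : Fin (N + 2) → ℝ =>
      (q (σ j.castSucc.succ) - q (σ 0)) / (q (σ (Fin.last (N + 1))) - q (σ 0))) p :=
    ContinuousAt.div (by fun_prop) (by fun_prop) hne
  have : (fun q : Fin (N + 2) → ℝ => selfNorm q j) =ᶠ[𝓝 p] fun q =>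
      (q (σ j.castSucc.succ) - q (σ 0)) / (q (σ (Fin.last (N + 1))) - q (σ 0)) := by
    filter_upwards [hev] with q hq
    rw [← selfNorm_comp_perm q σ, selfNorm_of_strictMono hq]
    rfl
  exact (hc.congr this.symm)

/-! ### The law of the self-normalized limit -/

theorem limitDensity_pos {N : ℕ} (ξ : ℝ) {z : Fin N → ℝ} (hz : z ∈ simplex N) :
    0 < limitDensity ξ z := by
  rw [limitDensity_of_mem_simplex ξ hz]
  exact mul_pos (densityConst_pos N) (coreDensity_pos ξ hz.2)

theorem limitDensity_nonneg {N : ℕ} (ξ : ℝ) {z : Fin N → ℝ} (hz : z ∈ simplex N) :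
    0 ≤ limitDensity ξ z := (limitDensity_pos ξ hz).le

theorem continuousAt_limitDensity {N : ℕ} (ξ : ℝ) {z : Fin N → ℝ} (hz : z ∈ simplex N) :
    ContinuousAt (limitDensity ξ) z := by
  have h := (continuousAt_coreDensity ξ hz.2).const_mul (densityConst N)
  refine h.congr ?_
  filter_upwards [(isOpen_simplex N).mem_nhds hz] with w hw
  exact (limitDensity_of_mem_simplex ξ hw).symm

theorem factorial_mul_lintegral_reconWeight {N : ℕ} (ξ : ℝ) {z : Fin N → ℝ}
    (hz : z ∈ simplex N) :
    (Nat.factorial (N + 2) : ENNReal) *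
      ∫⁻ p, ENNReal.ofReal (reconWeight ξ z p) ∂(scaleLoc ξ) =
      ENNReal.ofReal (limitDensity ξ z) := by
  rw [← ofReal_integral_eq_lintegral_ofReal (integrable_reconWeight ξ hz.2) (by
      filter_upwards [ae_scaleLoc ξ] with p hp using (reconWeight_pos ξ z hp.1.1 hp.2).le),
    integral_reconWeight ξ hz.2, limitDensity_of_mem_simplex ξ hz, densityConst, mul_assoc,
    ENNReal.ofReal_mul (Nat.cast_nonneg _), ENNReal.ofReal_natCast]

/-- `selfNorm` undoes `recon` for every order, location and scale. The function `h` therefore leaves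
the inner integral, and the `(N + 2)!` permutations contribute equally. -/
theorem lintegral_selfNorm_limitLaw {N : ℕ} (ξ : ℝ) {h : (Fin N → ℝ) → ENNReal}
    (hh : Measurable h) :
    ∫⁻ y : Fin (N + 2) → ℝ, h (selfNorm y) ∂(Measure.pi fun _ => limitLaw ξ) =
      ∫⁻ z in simplex N, h z * ENNReal.ofReal (limitDensity ξ z) := by
  rw [lintegral_pi_limitLaw N ξ (G := fun y => h (selfNorm y)) (hh.comp measurable_selfNorm)]
  refine setLIntegral_congr_fun (measurableSet_simplex N) fun z hz => ?_
  have h1 : ∀ᵐ p ∂(scaleLoc ξ), (∑ σ : Equiv.Perm (Fin (N + 2)),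
      h (selfNorm (recon ξ z p ∘ σ))) * ENNReal.ofReal (reconWeight ξ z p) =
      (h z * (Nat.factorial (N + 2) : ENNReal)) * ENNReal.ofReal (reconWeight ξ z p) := by
    filter_upwards [ae_scaleLoc ξ] with p hp
    simp only [selfNorm_recon hz hp.1.1 hp.2]
    rw [Finset.sum_const, Finset.card_univ, Fintype.card_perm, Fintype.card_fin, nsmul_eq_mul,
      mul_comm (h z)]
  refine (lintegral_congr_ae h1).trans ?_
  have mw : Measurable fun p : ℝ × ℝ => ENNReal.ofReal (reconWeight ξ z p) :=
    ((measurable_reconWeight ξ).comp (measurable_const.prodMk measurable_id)).ennreal_ofReal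
  rw [lintegral_const_mul _ mw, mul_assoc, factorial_mul_lintegral_reconWeight ξ hz]

/-- The law of the self-normalized limit. -/
def selfNormLaw (N : ℕ) (ξ : ℝ) : Measure (Fin N → ℝ) :=
  (volume.restrict (simplex N)).withDensity fun z => ENNReal.ofReal (limitDensity ξ z)

theorem map_selfNorm_limitLaw (N : ℕ) (ξ : ℝ) :
    (Measure.pi fun _ : Fin (N + 2) => limitLaw ξ).map selfNorm = selfNormLaw N ξ := by
  refine Measure.ext_of_lintegral _ fun h hh => ?_
  rw [lintegral_map hh measurable_selfNorm, lintegral_selfNorm_limitLaw ξ hh, selfNormLaw,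
    lintegral_withDensity_eq_lintegral_mul _ (measurable_limitDensity ξ).ennreal_ofReal hh]
  simp only [Pi.mul_apply, mul_comm]

instance (N : ℕ) (ξ : ℝ) : IsProbabilityMeasure (selfNormLaw N ξ) := by
  rw [← map_selfNorm_limitLaw]
  exact Measure.isProbabilityMeasure_map measurable_selfNorm.aemeasurable

theorem ae_selfNormLaw_mem_simplex (N : ℕ) (ξ : ℝ) : ∀ᵐ z ∂(selfNormLaw N ξ), z ∈ simplex N :=
  withDensity_absolutelyContinuous _ _ (ae_restrict_mem (measurableSet_simplex N))

theorem ae_ne_const_volume (n : ℕ) (c : ℝ) : ∀ᵐ z : Fin n → ℝ, ∀ j, z j ≠ c := by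
  rw [ae_all_iff]
  intro j
  have : (volume : Measure (Fin n → ℝ)) {z | z j = c} = 0 := by
    have := Measure.pi_hyperplane (fun _ : Fin n => (volume : Measure ℝ)) j c
    exact this
  exact measure_mono_null (fun z hz => by simpa using hz) this

/-- The formula is supported on the closed simplex and `selfNormLaw` on the open one; they differ
only where entries coincide or equal `0` or `1`, a null set. -/
theorem withDensity_limitDensity (N : ℕ) (ξ : ℝ) :
    ((volume : Measure (Fin N → ℝ)).withDensity fun z => ENNReal.ofReal (limitDensity ξ z)) =
      selfNormLaw N ξ := by
  rw [selfNormLaw, ← withDensity_indicator (measurableSet_simplex N)]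
  refine withDensity_congr_ae ?_
  filter_upwards [ae_injective_volume N, ae_ne_const_volume N 0, ae_ne_const_volume N 1]
    with z h1 h2 h3
  by_cases hz : z ∈ simplex N
  · rw [indicator_of_mem hz]
  · rw [indicator_of_notMem hz, limitDensity, if_neg, ENNReal.ofReal_zero]
    rintro ⟨h4, h5⟩
    exact hz ⟨h5.strictMono_of_injective h1, fun j =>
      ⟨lt_of_le_of_ne (h4 j).1 (h2 j).symm, lt_of_le_of_ne (h4 j).2 (h3 j)⟩⟩

theorem ae_limitLaw_pi_injective (n : ℕ) (ξ : ℝ) :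
    ∀ᵐ y ∂(Measure.pi fun _ : Fin n => limitLaw ξ), Function.Injective y := by
  have hsf : SigmaFinite ((volume.restrict (gevDom ξ)).withDensity fun y =>
      ENNReal.ofReal (Real.exp (-((2 + ξ) * gevLog ξ y)) *
        Real.exp (-Real.exp (-gevLog ξ y)))) := by
    rw [← limitLaw_eq_withDensity]; infer_instance
  have mlog := measurable_gevLog ξ
  have : (Measure.pi fun _ : Fin n => limitLaw ξ) ≪ volume := by
    rw [limitLaw_eq_withDensity, pi_withDensity _ _ fun _ => by fun_prop]
    refine (withDensity_absolutelyContinuous _ _).trans ?_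
    rw [← Measure.restrict_pi_pi]
    exact Measure.absolutelyContinuous_of_le Measure.restrict_le_self
  exact this (ae_injective_volume n)


/-! ### Zero sets of coordinatewise analytic functions -/

/-- By the identity theorem the zeros of a function that is not identically zero are isolated in
`U`, hence null. -/
theorem eqOn_zero_of_volume_ne_zero {f : ℝ → ℝ} {U : Set ℝ} (hU : IsPreconnected U)
    (hm : MeasurableSet U) (hf : AnalyticOnNhd ℝ f U) (h0 : volume {t ∈ U | f t = 0} ≠ 0) :
    ∀ t ∈ U, f t = 0 := by
  rcases hf.eqOn_zero_or_eventually_ne_zero_of_preconnected hU with h | h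
  · exact h
  · refine absurd ?_ h0
    have h2 := ae_restrict_le_codiscreteWithin (μ := volume) hm h
    rw [mem_ae_iff, Measure.restrict_apply' hm] at h2
    refine measure_mono_null (fun t ht => ?_) h2
    exact ⟨by simpa using ht.2, ht.1⟩

theorem volume_cons {n : ℕ} {A : Set (Fin (n + 1) → ℝ)} (hA : MeasurableSet A) :
    volume A = ∫⁻ y : Fin n → ℝ, volume {t : ℝ | (Fin.cons t y : Fin (n + 1) → ℝ) ∈ A} := by
  have hm : MeasurableSet {p : ℝ × (Fin n → ℝ) | (Fin.cons p.1 p.2 : Fin (n + 1) → ℝ) ∈ A} :=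
    measurable_cons hA
  have h1 := (volume_preserving_piFinSuccAbove (fun _ : Fin (n + 1) => ℝ) 0).symm
  rw [← h1.measure_preimage_equiv A]
  have h2 : (MeasurableEquiv.piFinSuccAbove (fun _ : Fin (n + 1) => ℝ) 0).symm ⁻¹' A =
      {p : ℝ × (Fin n → ℝ) | (Fin.cons p.1 p.2 : Fin (n + 1) → ℝ) ∈ A} := by
    ext p
    rw [mem_preimage, piFinSuccAbove_zero_symm]
    rfl
  rw [h2]
  exact Measure.prod_apply_symm hm

theorem cons_mem_cube {n : ℕ} {t : ℝ} {y : Fin n → ℝ} :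
    (Fin.cons t y : Fin (n + 1) → ℝ) ∈ cube (n + 1) ↔ t ∈ Ioo (0 : ℝ) 1 ∧ y ∈ cube n := by
  simp only [cube, mem_ofPred_eq, mem_Ioo]
  constructor
  · intro h
    exact ⟨by simpa using h 0, fun j => by simpa using h j.succ⟩
  · rintro ⟨h1, h2⟩ j
    induction j using Fin.cases with
    | zero => simpa using h1
    | succ j => simpa using h2 j

/-- A function on the cube that is analytic in each coordinate and vanishes on a set of positive
measure vanishes identically. -/
theorem eq_zero_of_coordinatewise_analytic {n : ℕ} {h : (Fin n → ℝ) → ℝ} (hm : Measurable h)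
    (ha : ∀ z ∈ cube n, ∀ i, ∀ x ∈ Ioo (0 : ℝ) 1,
      AnalyticAt ℝ (fun t => h (Function.update z i t)) x)
    (h0 : volume {z ∈ cube n | h z = 0} ≠ 0) : ∀ z ∈ cube n, h z = 0 := by
  induction n with
  | zero =>
    intro z _
    obtain ⟨w, hw⟩ := nonempty_of_measure_ne_zero h0
    rw [Subsingleton.elim z w]
    exact hw.2
  | succ n ih =>
    have hA : MeasurableSet {z ∈ cube (n + 1) | h z = 0} :=
      (isOpen_cube _).measurableSet.inter (hm (measurableSet_singleton 0))
    -- The points above which the slice of the zero set has positive length. By Fubini `B` is not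
    -- null, and above each of its points the function vanishes on the whole line segment.
    set B : Set (Fin n → ℝ) :=
      {y | volume {t : ℝ | (Fin.cons t y : Fin (n + 1) → ℝ) ∈ {z ∈ cube (n + 1) | h z = 0}} ≠ 0}
    have hB : volume B ≠ 0 := by
      intro hB
      apply h0
      rw [volume_cons hA]
      refine lintegral_eq_zero_of_ae_eq_zero ?_
      exact measure_mono_null (fun y hy => hy) hB
    have hzero : ∀ y ∈ B, y ∈ cube n ∧ ∀ t ∈ Ioo (0 : ℝ) 1, h (Fin.cons t y) = 0 := by
      intro y hy
      obtain ⟨t₀, ht₀⟩ := nonempty_of_measure_ne_zero hy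
      have hyc : y ∈ cube n := (cons_mem_cube.1 ht₀.1).2
      refine ⟨hyc, eqOn_zero_of_volume_ne_zero isPreconnected_Ioo measurableSet_Ioo
        (fun x hx => ?_) ?_⟩
      -- The point `t₀` only supplies an element of the cube; updating coordinate `0` overwrites it.
      · have := ha (Fin.cons t₀ y) ht₀.1 0 x hx
        simpa only [Fin.update_cons_zero] using this
      · refine fun hz => hy (measure_mono_null (fun t ht => ?_) hz)
        exact ⟨(cons_mem_cube.1 ht.1).1, ht.2⟩
    -- For each fixed `t` the slice vanishes on the non-null set `B`, so the induction hypothesis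
    -- applies.
    have hslice : ∀ t ∈ Ioo (0 : ℝ) 1, ∀ y ∈ cube n, h (Fin.cons t y) = 0 := by
      intro t ht
      refine ih (h := fun y => h (Fin.cons t y))
        (hm.comp (measurable_cons.comp (measurable_const.prodMk measurable_id))) ?_ ?_
      · intro y hy i x hx
        have := ha (Fin.cons t y) (cons_mem_cube.2 ⟨ht, hy⟩) i.succ x hx
        simpa only [Fin.cons_update] using this
      · intro hz
        refine hB (measure_mono_null (t := {y ∈ cube n | h (Fin.cons t y) = 0}) ?_ hz)
        exact fun y hy => ⟨(hzero y hy).1, (hzero y hy).2 t ht⟩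
    intro z hz
    rw [← Fin.cons_self_tail z] at hz ⊢
    exact hslice _ (cons_mem_cube.1 hz).1 _ (cons_mem_cube.1 hz).2

/-! ### The tail index is identified by the self-normalized limit -/

theorem hasDerivAt_hFun (ξ : ℝ) {x : ℝ} (hx : 0 < x) :
    HasDerivAt (hFun ξ) (-x ^ (-ξ - 1)) x := by
  by_cases h : ξ = 0
  · have e : hFun ξ = fun x => -Real.log x := by ext; simp [hFun, h]
    rw [e, h]
    refine (Real.hasDerivAt_log hx.ne').fun_neg.congr_deriv ?_
    simp [Real.rpow_neg_one]
  · have e : hFun ξ = fun x => (x ^ (-ξ) - 1) / ξ := by ext; simp [hFun, h]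
    rw [e]
    refine (((Real.hasDerivAt_rpow_const (p := -ξ) (Or.inl hx.ne')).sub_const 1).div_const
      ξ).congr_deriv ?_
    field_simp

theorem strictAntiOn_hFun (ξ : ℝ) : StrictAntiOn (hFun ξ) (Ioi 0) := by
  refine strictAntiOn_of_deriv_neg (convex_Ioi 0)
    (fun x hx => (hasDerivAt_hFun ξ hx).continuousAt.continuousWithinAt) fun x hx => ?_
  rw [interior_Ioi] at hx
  rw [(hasDerivAt_hFun ξ hx).deriv]
  exact neg_neg_of_pos (Real.rpow_pos_of_pos hx _)

/-- Cauchy's mean value theorem; the ratio of the two derivatives at `c` is `c ^ (ξ₀ - ξ₁)`. -/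
theorem exists_hFun_sub_eq (ξ₀ ξ₁ : ℝ) {b a : ℝ} (hb : 0 < b) (hab : b < a) :
    ∃ c ∈ Ioo b a, hFun ξ₁ b - hFun ξ₁ a = c ^ (ξ₀ - ξ₁) * (hFun ξ₀ b - hFun ξ₀ a) := by
  have hpos : ∀ x ∈ Icc b a, 0 < x := fun x hx => hb.trans_le hx.1
  obtain ⟨c, hc, h⟩ := exists_ratio_hasDerivAt_eq_ratio_slope (hFun ξ₁) (fun x => -x ^ (-ξ₁ - 1))
    hab (fun x hx => (hasDerivAt_hFun ξ₁ (hpos x hx)).continuousAt.continuousWithinAt)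
    (fun x hx => hasDerivAt_hFun ξ₁ (hpos x (Ioo_subset_Icc_self hx)))
    (hFun ξ₀) (fun x => -x ^ (-ξ₀ - 1))
    (fun x hx => (hasDerivAt_hFun ξ₀ (hpos x hx)).continuousAt.continuousWithinAt)
    (fun x hx => hasDerivAt_hFun ξ₀ (hpos x (Ioo_subset_Icc_self hx)))
  refine ⟨c, hc, ?_⟩
  have hc0 : 0 < c := hb.trans hc.1
  have e : -c ^ (-ξ₁ - 1) = -(c ^ (ξ₀ - ξ₁) * c ^ (-ξ₀ - 1)) := by
    rw [← Real.rpow_add hc0]; congr 2; ring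
  rw [e] at h
  have hne : c ^ (-ξ₀ - 1) ≠ 0 := (Real.rpow_pos_of_pos hc0 _).ne'
  refine mul_right_cancel₀ hne ?_
  linarith

/-- The first self-normalized spacing of three points decreases strictly in the tail index. -/
theorem hFun_ratio_lt {ξ₀ ξ₁ : ℝ} (hξ : ξ₀ < ξ₁) {a b c : ℝ} (hc : 0 < c) (hcb : c < b)
    (hba : b < a) :
    (hFun ξ₁ b - hFun ξ₁ a) / (hFun ξ₁ c - hFun ξ₁ a) <
      (hFun ξ₀ b - hFun ξ₀ a) / (hFun ξ₀ c - hFun ξ₀ a) := by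
  have hb : 0 < b := hc.trans hcb
  have ha : 0 < a := hb.trans hba
  obtain ⟨u, hu, h1⟩ := exists_hFun_sub_eq ξ₀ ξ₁ hb hba
  obtain ⟨v, hv, h2⟩ := exists_hFun_sub_eq ξ₀ ξ₁ hc hcb
  have hx : ∀ ξ, 0 < hFun ξ b - hFun ξ a := fun ξ =>
    sub_pos.2 (strictAntiOn_hFun ξ hb ha hba)
  have hy : ∀ ξ, 0 < hFun ξ c - hFun ξ b := fun ξ =>
    sub_pos.2 (strictAntiOn_hFun ξ hc hb hcb)
  -- The intermediate points satisfy `v < b < u` and the exponent is negative: passing to the larger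
  -- index stretches the upper gap by more than the lower one.
  have huv : u ^ (ξ₀ - ξ₁) < v ^ (ξ₀ - ξ₁) :=
    Real.rpow_lt_rpow_of_neg (hc.trans hv.1) (hv.2.trans hu.1) (by linarith)
  have hu0 : 0 < u ^ (ξ₀ - ξ₁) := Real.rpow_pos_of_pos (hb.trans hu.1) _
  rw [div_lt_div_iff₀ (by linarith [hx ξ₁, hy ξ₁]) (by linarith [hx ξ₀, hy ξ₀])]
  have e : ∀ ξ, hFun ξ c - hFun ξ a = (hFun ξ b - hFun ξ a) + (hFun ξ c - hFun ξ b) :=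
    fun ξ => by ring
  rw [e, e, h1, h2]
  nlinarith [mul_pos (mul_pos (hx ξ₀) (hy ξ₀)) (sub_pos.2 huv)]

theorem selfNorm_hFun_lt {N : ℕ} (hN : 1 ≤ N) {ξ₀ ξ₁ : ℝ} (hξ : ξ₀ < ξ₁)
    {x : Fin (N + 2) → ℝ} (hx : Function.Injective x) (hpos : ∀ j, 0 < x j) :
    selfNorm (fun j => hFun ξ₁ (x j)) ⟨0, hN⟩ < selfNorm (fun j => hFun ξ₀ (x j)) ⟨0, hN⟩ := by
  obtain ⟨σ, hσ⟩ := exists_perm_strictMono (p := fun j => -x j) (neg_injective.comp hx)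
  have hanti : StrictAnti (x ∘ σ) := fun i j hij => by simpa using hσ hij
  have hmono : ∀ ξ, StrictMono ((fun j => hFun ξ (x j)) ∘ σ) := fun ξ i j hij =>
    strictAntiOn_hFun ξ (hpos _) (hpos _) (hanti hij)
  have key : ∀ ξ, selfNorm (fun j => hFun ξ (x j)) ⟨0, hN⟩ =
      (hFun ξ (x (σ (Fin.castSucc ⟨0, hN⟩).succ)) - hFun ξ (x (σ 0))) /
        (hFun ξ (x (σ (Fin.last (N + 1)))) - hFun ξ (x (σ 0))) := fun ξ => by
    rw [← selfNorm_comp_perm _ σ, selfNorm_of_strictMono (hmono ξ)]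
    rfl
  rw [key, key]
  refine hFun_ratio_lt hξ (hpos _) (hanti ?_) (hanti (Fin.succ_pos _))
  rw [← Fin.succ_last]
  exact Fin.succ_lt_succ_iff.2 (Fin.castSucc_lt_last _)

theorem pi_limitLaw_eq_map (n : ℕ) (ξ : ℝ) :
    (Measure.pi fun _ : Fin n => limitLaw ξ) =
      (Measure.pi fun _ : Fin n => expSumLaw).map fun x j => hFun ξ (x j) := by
  simp only [limitLaw_eq_map]
  have := limitLaw_eq_map ξ
  have hs : ∀ i : Fin n, SigmaFinite (expSumLaw.map (hFun ξ)) := fun i => by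
    rw [← this]; infer_instance
  exact (Measure.pi_map_pi fun _ => (measurable_hFun ξ).aemeasurable).symm

theorem ae_expSumLaw_pi (n : ℕ) :
    ∀ᵐ x ∂(Measure.pi fun _ : Fin n => expSumLaw), Function.Injective x ∧ ∀ j, 0 < x j := by
  have hsf : SigmaFinite ((volume.restrict (Ioi (0 : ℝ))).withDensity fun x =>
      ENNReal.ofReal (x * Real.exp (-x))) := (inferInstance : SigmaFinite expSumLaw)
  have h : (Measure.pi fun _ : Fin n => expSumLaw) ≪
      volume.restrict (univ.pi fun _ => Ioi (0 : ℝ)) := by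
    unfold expSumLaw
    rw [pi_withDensity _ _ fun _ => by fun_prop, ← Measure.restrict_pi_pi]
    exact withDensity_absolutelyContinuous _ _
  refine h ?_
  filter_upwards [ae_restrict_of_ae (ae_injective_volume n),
    ae_restrict_mem (MeasurableSet.univ_pi fun _ => measurableSet_Ioi)] with x h1 h2
  exact ⟨h1, fun j => h2 j (mem_univ j)⟩

/-- Coupling: both laws are driven by the same gamma variables. The first coordinate, which exists
because `1 ≤ N`, is then strictly smaller for the larger index at almost every point, whereas equal
means would force almost everywhere equality. -/
theorem selfNormLaw_ne_of_lt {N : ℕ} (hN : 1 ≤ N) {ξ₀ ξ₁ : ℝ} (hξ : ξ₀ < ξ₁) :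
    selfNormLaw N ξ₀ ≠ selfNormLaw N ξ₁ := by
  intro heq
  have mS : ∀ ξ, Measurable fun x : Fin (N + 2) → ℝ =>
      ENNReal.ofReal (selfNorm (fun j => hFun ξ (x j)) ⟨0, hN⟩) := fun ξ => by
    have mh := measurable_hFun ξ
    exact ((measurable_pi_apply _).comp (measurable_selfNorm.comp (by fun_prop))).ennreal_ofReal
  have key : ∀ ξ, ∫⁻ z, ENNReal.ofReal (z ⟨0, hN⟩) ∂(selfNormLaw N ξ) =
      ∫⁻ x, ENNReal.ofReal (selfNorm (fun j => hFun ξ (x j)) ⟨0, hN⟩)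
        ∂(Measure.pi fun _ : Fin (N + 2) => expSumLaw) := fun ξ => by
    have mh := measurable_hFun ξ
    rw [← map_selfNorm_limitLaw, lintegral_map (by fun_prop) measurable_selfNorm,
      pi_limitLaw_eq_map, lintegral_map _ (by fun_prop)]
    exact ((measurable_pi_apply _).comp measurable_selfNorm).ennreal_ofReal
  have hint : ∫⁻ x, ENNReal.ofReal (selfNorm (fun j => hFun ξ₁ (x j)) ⟨0, hN⟩)
        ∂(Measure.pi fun _ : Fin (N + 2) => expSumLaw) =
      ∫⁻ x, ENNReal.ofReal (selfNorm (fun j => hFun ξ₀ (x j)) ⟨0, hN⟩)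
        ∂(Measure.pi fun _ : Fin (N + 2) => expSumLaw) := by
    rw [← key, ← key, heq]
  have hlt := fun (x : Fin (N + 2) → ℝ) (hx : Function.Injective x ∧ ∀ j, 0 < x j) =>
    selfNorm_hFun_lt hN hξ hx.1 hx.2
  have hle : (fun x : Fin (N + 2) → ℝ =>
      ENNReal.ofReal (selfNorm (fun j => hFun ξ₁ (x j)) ⟨0, hN⟩))
      ≤ᵐ[Measure.pi fun _ : Fin (N + 2) => expSumLaw] fun x =>
      ENNReal.ofReal (selfNorm (fun j => hFun ξ₀ (x j)) ⟨0, hN⟩) := by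
    filter_upwards [ae_expSumLaw_pi (N + 2)] with x hx
    exact ENNReal.ofReal_le_ofReal (hlt x hx).le
  have hmem : ∀ ξ, ∀ x : Fin (N + 2) → ℝ, Function.Injective x ∧ (∀ j, 0 < x j) →
      selfNorm (fun j => hFun ξ (x j)) ∈ simplex N := fun ξ x hx =>
    selfNorm_mem_simplex fun i j hij =>
      hx.1 ((strictAntiOn_hFun ξ).injOn (hx.2 i) (hx.2 j) hij)
  have hfin : ∫⁻ x, ENNReal.ofReal (selfNorm (fun j => hFun ξ₁ (x j)) ⟨0, hN⟩)
        ∂(Measure.pi fun _ : Fin (N + 2) => expSumLaw) ≠ ⊤ := by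
    refine ne_top_of_le_ne_top (b := 1) (by simp) ?_
    refine (lintegral_mono_ae (g := fun _ => 1) ?_).trans (by simp)
    filter_upwards [ae_expSumLaw_pi (N + 2)] with x hx
    simpa using ((hmem ξ₁ x hx).2 ⟨0, hN⟩).2.le
  have hae := ae_eq_of_ae_le_of_lintegral_le hle hfin (mS ξ₀).aemeasurable hint.ge
  obtain ⟨x, hx1, hx2⟩ := (hae.and (ae_expSumLaw_pi (N + 2))).exists
  have h3 := hlt x hx2
  rw [ENNReal.ofReal_eq_ofReal_iff ((hmem ξ₁ x hx2).2 _).1.le ((hmem ξ₀ x hx2).2 _).1.le] at hx1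
  exact h3.ne hx1

theorem selfNormLaw_ne {N : ℕ} (hN : 1 ≤ N) {ξ₀ ξ₁ : ℝ} (hξ : ξ₀ ≠ ξ₁) :
    selfNormLaw N ξ₀ ≠ selfNormLaw N ξ₁ := by
  rcases hξ.lt_or_gt with h | h
  · exact selfNormLaw_ne_of_lt hN h
  · exact (selfNormLaw_ne_of_lt hN h).symm

/-! ### The likelihood ratio has no atoms -/

/-- A level set of positive measure would extend by analyticity to the whole cube. The two laws
would be proportional, total mass would give `c = 1`, and this contradicts `selfNormLaw_ne`. -/
theorem volume_limitDensity_eq_mul {N : ℕ} (hN : 1 ≤ N) {ξ₀ ξ₁ : ℝ} (hξ : ξ₀ ≠ ξ₁) (c : ℝ) :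
    volume {z ∈ simplex N | limitDensity ξ₁ z = c * limitDensity ξ₀ z} = 0 := by
  by_contra hne
  have hcube : ∀ z ∈ cube N, coreDensity ξ₁ z - c * coreDensity ξ₀ z = 0 := by
    refine eq_zero_of_coordinatewise_analytic
      ((measurable_coreDensity ξ₁).sub ((measurable_coreDensity ξ₀).const_mul c)) ?_ ?_
    · intro z hz i x hx
      exact (analyticAt_coreDensity_update ξ₁ hz i hx.1 hx.2).sub
        (analyticAt_const.mul (analyticAt_coreDensity_update ξ₀ hz i hx.1 hx.2))
    · intro h0
      refine hne (measure_mono_null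
        (t := {z ∈ cube N | coreDensity ξ₁ z - c * coreDensity ξ₀ z = 0}) ?_ h0)
      intro z hz
      refine ⟨hz.1.2, ?_⟩
      have h2 := hz.2
      rw [limitDensity_of_mem_simplex _ hz.1, limitDensity_of_mem_simplex _ hz.1] at h2
      have h3 : densityConst N * (coreDensity ξ₁ z - c * coreDensity ξ₀ z) = 0 := by linarith
      exact (mul_eq_zero.1 h3).resolve_left (densityConst_pos N).ne'
  have hsimp : ∀ z ∈ simplex N, limitDensity ξ₁ z = c * limitDensity ξ₀ z := fun z hz => by
    rw [limitDensity_of_mem_simplex _ hz, limitDensity_of_mem_simplex _ hz]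
    linear_combination densityConst N * hcube z hz.2
  obtain ⟨w, hw⟩ := nonempty_of_measure_ne_zero hne
  have hc : 0 < c := by
    have h1 := limitDensity_pos ξ₁ hw.1
    rw [hw.2] at h1
    exact (pos_iff_pos_of_mul_pos h1).2 (limitDensity_pos ξ₀ hw.1)
  have hlaw : selfNormLaw N ξ₁ = ENNReal.ofReal c • selfNormLaw N ξ₀ := by
    unfold selfNormLaw
    rw [← withDensity_smul _ (measurable_limitDensity ξ₀).ennreal_ofReal]
    refine withDensity_congr_ae ?_
    filter_upwards [ae_restrict_mem (measurableSet_simplex N)] with z hz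
    rw [hsimp z hz, ENNReal.ofReal_mul hc.le]
    rfl
  have h1 : ENNReal.ofReal c = 1 := by
    have := congrArg (fun m => m univ) hlaw
    simpa using this.symm
  rw [h1, one_smul] at hlaw
  exact selfNormLaw_ne hN hξ hlaw.symm


/-! ### Weak convergence and almost everywhere continuous functions -/

/-- Continuous mapping theorem by the portmanteau criterion: for closed `F`, the closure of `g ⁻¹'
F` adds only points where `g` is discontinuous, a null set for the limit. -/
theorem tendsto_map_of_ae_continuousAt {Ω Ω' : Type*} [TopologicalSpace Ω] [MeasurableSpace Ω]
    [OpensMeasurableSpace Ω] [HasOuterApproxClosed Ω] [TopologicalSpace Ω'] [MeasurableSpace Ω']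
    [OpensMeasurableSpace Ω'] {μs : ℕ → ProbabilityMeasure Ω} {μ : ProbabilityMeasure Ω}
    (hμ : Tendsto μs atTop (𝓝 μ)) {g : Ω → Ω'} (hg : Measurable g)
    (hc : ∀ᵐ x ∂(μ : Measure Ω), ContinuousAt g x) :
    Tendsto (fun K => (μs K).map hg.aemeasurable) atTop (𝓝 (μ.map hg.aemeasurable)) := by
  refine tendsto_of_forall_isClosed_limsup_le' fun F hF => ?_
  simp only [ProbabilityMeasure.toMeasure_map, Measure.map_apply hg hF.measurableSet]
  calc limsup (fun K => (μs K : Measure Ω) (g ⁻¹' F)) atTop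
      ≤ limsup (fun K => (μs K : Measure Ω) (closure (g ⁻¹' F))) atTop :=
        limsup_le_limsup (Eventually.of_forall fun K => measure_mono subset_closure)
    _ ≤ (μ : Measure Ω) (closure (g ⁻¹' F)) :=
        ProbabilityMeasure.limsup_measure_closed_le_of_tendsto hμ isClosed_closure
    _ ≤ (μ : Measure Ω) (g ⁻¹' F) := by
        refine measure_mono_ae ?_
        filter_upwards [hc] with x hx hxF
        have h : g x ∈ closure F :=
          hx.continuousWithinAt.mem_closure (s := g ⁻¹' F) hxF (fun y hy => hy)
        exact hF.closure_eq ▸ h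

/-- The truncation of a real number to `[-B, B]`. -/
def clip (B : ℝ) : BoundedContinuousFunction ℝ ℝ :=
  BoundedContinuousFunction.ofNormedAddCommGroup (fun x => max (-B) (min x B)) (by fun_prop)
    |B| (fun x => by
      rw [Real.norm_eq_abs, abs_le]
      constructor
      · exact (neg_le_neg (le_abs_self B)).trans (le_max_left _ _)
      · exact max_le (neg_le_abs B) ((min_le_right _ _).trans (le_abs_self B)))

theorem clip_apply {B x : ℝ} (h : |x| ≤ B) : clip B x = x := by
  rw [abs_le] at h
  change max (-B) (min x B) = x
  rw [min_eq_left h.2, max_eq_right h.1]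

/-- The values of `g` lie where `clip B` is the identity, so `clip B` is an admissible bounded
continuous test function for the image laws. -/
theorem tendsto_integral_of_ae_continuousAt {Ω : Type*} [TopologicalSpace Ω] [MeasurableSpace Ω]
    [OpensMeasurableSpace Ω] [HasOuterApproxClosed Ω]
    {μs : ℕ → ProbabilityMeasure Ω} {μ : ProbabilityMeasure Ω}
    (hμ : Tendsto μs atTop (𝓝 μ)) {g : Ω → ℝ} (hg : Measurable g) {B : ℝ}
    (hB : ∀ x, |g x| ≤ B) (hc : ∀ᵐ x ∂(μ : Measure Ω), ContinuousAt g x) :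
    Tendsto (fun K => ∫ x, g x ∂(μs K : Measure Ω)) atTop (𝓝 (∫ x, g x ∂(μ : Measure Ω))) := by
  have h := ProbabilityMeasure.tendsto_iff_forall_integral_tendsto.1
    (tendsto_map_of_ae_continuousAt hμ hg hc) (clip B)
  have e : ∀ ν : ProbabilityMeasure Ω,
      ∫ y, clip B y ∂(ν.map hg.aemeasurable : Measure ℝ) = ∫ x, g x ∂(ν : Measure Ω) := fun ν => by
    rw [ProbabilityMeasure.toMeasure_map,
      integral_map hg.aemeasurable (clip B).continuous.aestronglyMeasurable]
    simp only [clip_apply (hB _)]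
  simpa only [e] using h

/-! ### Price models -/

theorem measurable_normalize {n : ℕ} (a b : ℝ) :
    Measurable fun (p : Fin n → ℝ) j => (p j - b) / a := by fun_prop

/-- The limit law of normalized prices, as a probability measure. -/
def limitProb (n : ℕ) (ξ : ℝ) : ProbabilityMeasure (Fin n → ℝ) :=
  ⟨Measure.pi fun _ => limitLaw ξ, inferInstance⟩

theorem IsPriceModel.exists_tendsto {n : ℕ} {ξ : ℝ} {P : ℕ → Measure (Fin n → ℝ)}
    (hP : IsPriceModel ξ P) :
    ∃ (a b : ℕ → ℝ) (Q : ℕ → ProbabilityMeasure (Fin n → ℝ)), (∀ K, 0 < a K) ∧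
      (∀ K, (Q K : Measure (Fin n → ℝ)) = (P K).map fun p j => (p j - b K) / a K) ∧
      Tendsto Q atTop (𝓝 (limitProb n ξ)) := by
  obtain ⟨hp, a, b, ha, h⟩ := hP
  refine ⟨a, b, fun K => ⟨(P K).map fun p j => (p j - b K) / a K,
    Measure.isProbabilityMeasure_map (measurable_normalize _ _).aemeasurable⟩, ha,
    fun K => rfl, ?_⟩
  refine ProbabilityMeasure.tendsto_iff_forall_integral_tendsto.2 fun g => ?_
  refine (h g).congr fun K => ?_
  exact (integral_map (measurable_normalize (a K) (b K)).aemeasurable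
    g.continuous.aestronglyMeasurable).symm

theorem selfNorm_normalize {N : ℕ} (p : Fin (N + 2) → ℝ) {a : ℝ} (ha : 0 < a) (b : ℝ) :
    selfNorm (fun j => (p j - b) / a) = selfNorm p := by
  rw [← selfNorm_affine_perm p 1 (inv_pos.2 ha) (-b / a)]
  congr 1
  ext j
  simp only [Equiv.Perm.coe_one, id]
  field_simp
  ring

/-- The normalizing constants cancel in `selfNorm`, which is continuous off the ties, and ties have
probability zero under the limit. -/
theorem IsPriceModel.tendsto_integral_selfNorm {N : ℕ} {ξ : ℝ}
    {P : ℕ → Measure (Fin (N + 2) → ℝ)} (hP : IsPriceModel ξ P) {h : (Fin N → ℝ) → ℝ}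
    (hm : Measurable h) {B : ℝ} (hB : ∀ z, |h z| ≤ B)
    (hc : ∀ᵐ z ∂(selfNormLaw N ξ), ContinuousAt h z) :
    Tendsto (fun K => ∫ p, h (selfNorm p) ∂(P K)) atTop (𝓝 (∫ z, h z ∂(selfNormLaw N ξ))) := by
  obtain ⟨a, b, Q, ha, hQ, ht⟩ := hP.exists_tendsto
  have hlim : ((limitProb (N + 2) ξ : ProbabilityMeasure _) : Measure (Fin (N + 2) → ℝ)) =
    Measure.pi fun _ => limitLaw ξ := rfl
  rw [← map_selfNorm_limitLaw] at hc
  have h1 := ae_of_ae_map measurable_selfNorm.aemeasurable hc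
  have := tendsto_integral_of_ae_continuousAt ht (g := fun p => h (selfNorm p))
    (hm.comp measurable_selfNorm) (fun x => hB _) (by
      rw [hlim]
      filter_upwards [h1, ae_limitLaw_pi_injective (N + 2) ξ] with x hx hxi
      exact ContinuousAt.comp hx (continuousAt_selfNorm hxi))
  rw [hlim, ← integral_map (f := h) measurable_selfNorm.aemeasurable hm.aestronglyMeasurable,
    map_selfNorm_limitLaw] at this
  refine this.congr fun K => ?_
  rw [hQ, integral_map (measurable_normalize (a K) (b K)).aemeasurable
    (f := fun p => h (selfNorm p)) (hm.comp measurable_selfNorm).aestronglyMeasurable]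
  simp only [selfNorm_normalize _ (ha K)]


/-! ### Integrals against the self-normalized limit law -/

theorem integral_selfNormLaw {N : ℕ} (ξ : ℝ) (g : (Fin N → ℝ) → ℝ) :
    ∫ z, g z ∂(selfNormLaw N ξ) = ∫ z in simplex N, limitDensity ξ z * g z := by
  rw [selfNormLaw, integral_withDensity_eq_integral_toReal_smul
    (measurable_limitDensity ξ).ennreal_ofReal (Eventually.of_forall fun _ => ENNReal.ofReal_lt_top)]
  refine setIntegral_congr_fun (measurableSet_simplex N) fun z hz => ?_
  simp only [ENNReal.toReal_ofReal (limitDensity_nonneg ξ hz), smul_eq_mul]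

theorem integrable_limitDensity (N : ℕ) (ξ : ℝ) :
    IntegrableOn (limitDensity ξ) (simplex N) := by
  refine ⟨(measurable_limitDensity ξ).aestronglyMeasurable, ?_⟩
  have h : selfNormLaw N ξ univ = 1 := measure_univ
  rw [selfNormLaw, withDensity_apply _ MeasurableSet.univ, Measure.restrict_univ] at h
  rw [hasFiniteIntegral_iff_ofReal, h]
  · exact ENNReal.one_lt_top
  · filter_upwards [ae_restrict_mem (measurableSet_simplex N)] with z hz
    exact limitDensity_nonneg ξ hz

theorem integrable_limitDensity_mul {N : ℕ} (ξ : ℝ) {g : (Fin N → ℝ) → ℝ} (hg : Measurable g)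
    {B : ℝ} (hB : ∀ z, |g z| ≤ B) :
    IntegrableOn (fun z => limitDensity ξ z * g z) (simplex N) :=
  (integrable_limitDensity N ξ).mul_bdd (c := B) hg.aestronglyMeasurable (Eventually.of_forall hB)

/-! ### The critical value -/

theorem continuous_cdf_of_noAtoms (μ : Measure ℝ) [IsProbabilityMeasure μ] [NullSingletonClass μ] :
    Continuous (cdf μ) := by
  refine continuous_iff_continuousAt.2 fun x => ?_
  rw [(monotone_cdf μ).continuousAt_iff_leftLim_eq_rightLim, StieltjesFunction.rightLim_eq]
  have h : (cdf μ).measure {x} = 0 := by rw [measure_cdf]; exact measure_singleton x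
  rw [StieltjesFunction.measure_singleton, ENNReal.ofReal_eq_zero] at h
  exact le_antisymm ((monotone_cdf μ).leftLim_le le_rfl) (by linarith)

/-- Without atoms the CDF is continuous: the infimum is attained, which gives `≥`, and approaching
it from the left gives `≤`. -/
theorem cdf_sInf_of_noAtoms (μ : Measure ℝ) [IsProbabilityMeasure μ] [NullSingletonClass μ] {β : ℝ}
    (h0 : 0 < β) (h1 : β < 1) : cdf μ (sInf {t | β ≤ cdf μ t}) = β := by
  have hc := continuous_cdf_of_noAtoms μ
  have hne : {t | β ≤ cdf μ t}.Nonempty :=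
    ((tendsto_cdf_atTop μ).eventually_const_le h1).exists
  have hbdd : BddBelow {t | β ≤ cdf μ t} := by
    obtain ⟨t, ht⟩ := ((tendsto_cdf_atBot μ).eventually_lt_const h0).exists
    refine ⟨t, fun s hs => ?_⟩
    by_contra hst
    exact absurd (hs.trans (monotone_cdf μ (not_le.1 hst).le)) (not_le.2 ht)
  have hmem : β ≤ cdf μ (sInf {t | β ≤ cdf μ t}) :=
    (isClosed_le continuous_const hc).csInf_mem hne hbdd
  refine le_antisymm ?_ hmem
  refine le_of_tendsto (hc.continuousWithinAt (s := Iio (sInf {t | β ≤ cdf μ t}))) ?_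
  filter_upwards [self_mem_nhdsWithin] with t ht
  by_contra hlt
  exact absurd (csInf_le hbdd (not_le.1 hlt).le) (not_le.2 ht)

theorem measurable_likelihoodRatio {N : ℕ} (ξ₀ ξ₁ : ℝ) :
    Measurable (likelihoodRatio ξ₀ ξ₁ : (Fin N → ℝ) → ℝ) :=
  (measurable_limitDensity ξ₁).div (measurable_limitDensity ξ₀)

theorem likelihoodRatio_pos {N : ℕ} (ξ₀ ξ₁ : ℝ) {z : Fin N → ℝ} (hz : z ∈ simplex N) :
    0 < likelihoodRatio ξ₀ ξ₁ z := div_pos (limitDensity_pos _ hz) (limitDensity_pos _ hz)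

theorem continuousAt_likelihoodRatio {N : ℕ} (ξ₀ ξ₁ : ℝ) {z : Fin N → ℝ} (hz : z ∈ simplex N) :
    ContinuousAt (likelihoodRatio ξ₀ ξ₁) z :=
  (continuousAt_limitDensity ξ₁ hz).div (continuousAt_limitDensity ξ₀ hz)
    (limitDensity_pos ξ₀ hz).ne'

theorem ae_likelihoodRatio_ne {N : ℕ} (hN : 1 ≤ N) {ξ₀ ξ₁ : ℝ} (hξ : ξ₀ ≠ ξ₁) (ξ c : ℝ) :
    ∀ᵐ z ∂(selfNormLaw N ξ), z ∈ simplex N ∧ likelihoodRatio ξ₀ ξ₁ z ≠ c := by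
  refine withDensity_absolutelyContinuous _ _ ?_
  have h : ∀ᵐ z : Fin N → ℝ, ¬ (z ∈ simplex N ∧ limitDensity ξ₁ z = c * limitDensity ξ₀ z) := by
    rw [ae_iff]
    simpa only [not_not] using volume_limitDensity_eq_mul hN hξ c
  filter_upwards [ae_restrict_of_ae h, ae_restrict_mem (measurableSet_simplex N)] with z h1 h2
  refine ⟨h2, fun h3 => h1 ⟨h2, ?_⟩⟩
  rw [likelihoodRatio, div_eq_iff (limitDensity_pos ξ₀ h2).ne'] at h3
  exact h3

theorem selfNormLaw_likelihoodRatio_le {N : ℕ} (hN : 1 ≤ N) {ξ₀ ξ₁ : ℝ} (hξ : ξ₀ ≠ ξ₁) {α : ℝ}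
    (hα₀ : 0 < α) (hα₁ : α < 1) :
    (selfNormLaw N ξ₀).real {z | likelihoodRatio ξ₀ ξ₁ z ≤ critValue N ξ₀ ξ₁ α} = 1 - α := by
  have hm := measurable_likelihoodRatio (N := N) ξ₀ ξ₁
  set L := (selfNormLaw N ξ₀).map (likelihoodRatio ξ₀ ξ₁) with hL
  have : IsProbabilityMeasure L := Measure.isProbabilityMeasure_map hm.aemeasurable
  have : NullSingletonClass L := ⟨fun c => by
    rw [hL, Measure.map_apply hm (measurableSet_singleton c)]
    refine measure_mono_null (t := {z | ¬ (z ∈ simplex N ∧ likelihoodRatio ξ₀ ξ₁ z ≠ c)})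
      (fun z hz h => h.2 hz) (ae_likelihoodRatio_ne hN hξ ξ₀ c)⟩
  have e : ∀ t, (selfNormLaw N ξ₀).real {z | likelihoodRatio ξ₀ ξ₁ z ≤ t} = cdf L t := fun t => by
    rw [cdf_eq_real, hL, map_measureReal_apply hm measurableSet_Iic]
    rfl
  simp only [critValue, withDensity_limitDensity, e]
  exact cdf_sInf_of_noAtoms L (by linarith) (by linarith)

/-- The likelihood ratio is almost surely positive, so a nonpositive critical value would give
acceptance probability `0` instead of `1 - α`. Positivity makes the cap `q⁻¹` meaningful. -/
theorem critValue_pos {N : ℕ} (hN : 1 ≤ N) {ξ₀ ξ₁ : ℝ} (hξ : ξ₀ ≠ ξ₁) {α : ℝ}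
    (hα₀ : 0 < α) (hα₁ : α < 1) : 0 < critValue N ξ₀ ξ₁ α := by
  by_contra hq
  have h := selfNormLaw_likelihoodRatio_le hN hξ hα₀ hα₁
  have h0 : (selfNormLaw N ξ₀) {z | likelihoodRatio ξ₀ ξ₁ z ≤ critValue N ξ₀ ξ₁ α} = 0 := by
    refine measure_mono_null (t := {z | ¬ z ∈ simplex N}) (fun z hz hs => ?_)
      (ae_selfNormLaw_mem_simplex N ξ₀)
    exact absurd (likelihoodRatio_pos ξ₀ ξ₁ hs) (not_lt.2 (le_trans hz (not_lt.1 hq)))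
  rw [measureReal_def, h0] at h
  simp only [ENNReal.toReal_zero] at h
  linarith

theorem selfNormLaw_critValue_lt {N : ℕ} (hN : 1 ≤ N) {ξ₀ ξ₁ : ℝ} (hξ : ξ₀ ≠ ξ₁) {α : ℝ}
    (hα₀ : 0 < α) (hα₁ : α < 1) :
    (selfNormLaw N ξ₀).real {z | critValue N ξ₀ ξ₁ α < likelihoodRatio ξ₀ ξ₁ z} = α := by
  have h := selfNormLaw_likelihoodRatio_le hN hξ hα₀ hα₁
  have e : {z | critValue N ξ₀ ξ₁ α < likelihoodRatio ξ₀ ξ₁ z} =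
      {z : Fin N → ℝ | likelihoodRatio ξ₀ ξ₁ z ≤ critValue N ξ₀ ξ₁ α}ᶜ := by
    ext z; simp
  rw [e, probReal_compl_eq_one_sub (measurableSet_le (measurable_likelihoodRatio ξ₀ ξ₁)
    measurable_const), h]
  ring

/-! ### The likelihood-ratio test -/

/-- The indicator of the rejection region of the likelihood-ratio test. -/
def rejects {N : ℕ} (ξ₀ ξ₁ α : ℝ) (z : Fin N → ℝ) : ℝ :=
  open scoped Classical in
  if critValue N ξ₀ ξ₁ α < likelihoodRatio ξ₀ ξ₁ z then 1 else 0

theorem lrTest_eq {N : ℕ} (ξ₀ ξ₁ α : ℝ) (p : Fin (N + 2) → ℝ) :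
    lrTest ξ₀ ξ₁ α p = rejects ξ₀ ξ₁ α (selfNorm p) := rfl

theorem measurable_rejects {N : ℕ} (ξ₀ ξ₁ α : ℝ) :
    Measurable (rejects ξ₀ ξ₁ α : (Fin N → ℝ) → ℝ) := by
  unfold rejects
  exact Measurable.ite (measurableSet_lt measurable_const (measurable_likelihoodRatio ξ₀ ξ₁))
    measurable_const measurable_const

theorem rejects_mem_Icc {N : ℕ} (ξ₀ ξ₁ α : ℝ) (z : Fin N → ℝ) :
    rejects ξ₀ ξ₁ α z ∈ Icc (0 : ℝ) 1 := by
  unfold rejects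
  split_ifs <;> simp

theorem abs_rejects_le {N : ℕ} (ξ₀ ξ₁ α : ℝ) (z : Fin N → ℝ) : |rejects ξ₀ ξ₁ α z| ≤ 1 := by
  rw [abs_of_nonneg (rejects_mem_Icc ξ₀ ξ₁ α z).1]
  exact (rejects_mem_Icc ξ₀ ξ₁ α z).2

theorem isEquivariantTest_lrTest (N : ℕ) (ξ₀ ξ₁ α : ℝ) :
    IsEquivariantTest (fun (_ : ℕ) (p : Fin (N + 2) → ℝ) => lrTest ξ₀ ξ₁ α p) where
  meas _ := (measurable_rejects ξ₀ ξ₁ α).comp measurable_selfNorm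
  mem_Icc _ p := rejects_mem_Icc ξ₀ ξ₁ α _
  equivariant _ σ c d p hc := by
    simp only [lrTest_eq, selfNorm_affine_perm p σ hc d]

theorem continuousAt_rejects {N : ℕ} {ξ₀ ξ₁ α : ℝ} {z : Fin N → ℝ} (hz : z ∈ simplex N)
    (hne : likelihoodRatio ξ₀ ξ₁ z ≠ critValue N ξ₀ ξ₁ α) :
    ContinuousAt (rejects ξ₀ ξ₁ α) z := by
  have hc := continuousAt_likelihoodRatio ξ₀ ξ₁ hz
  rcases hne.lt_or_gt with h | h
  · refine (continuousAt_const (y := (0 : ℝ))).congr ?_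
    filter_upwards [hc.eventually_lt_const h] with w hw
    simp [rejects, not_lt.2 hw.le]
  · refine (continuousAt_const (y := (1 : ℝ))).congr ?_
    filter_upwards [hc.eventually_const_lt h] with w hw
    simp [rejects, hw]

theorem integral_rejects {N : ℕ} (ξ₀ ξ₁ α ξ : ℝ) :
    ∫ z, rejects ξ₀ ξ₁ α z ∂(selfNormLaw N ξ) =
      (selfNormLaw N ξ).real {z | critValue N ξ₀ ξ₁ α < likelihoodRatio ξ₀ ξ₁ z} := by
  rw [← integral_indicator_one (measurableSet_lt measurable_const
    (measurable_likelihoodRatio ξ₀ ξ₁))]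
  refine integral_congr_ae (Eventually.of_forall fun z => ?_)
  simp only [rejects, indicator, mem_ofPred_eq, Pi.one_apply]

/-- On the simplex the rejection indicator can be discontinuous only where the likelihood ratio
equals the critical value, a null set under the limit for every index `ξ`. -/
theorem IsPriceModel.tendsto_lrTest {N : ℕ} (hN : 1 ≤ N) {ξ₀ ξ₁ : ℝ} (hξ : ξ₀ ≠ ξ₁) (α : ℝ)
    {ξ : ℝ} {P : ℕ → Measure (Fin (N + 2) → ℝ)} (hP : IsPriceModel ξ P) :
    Tendsto (fun K => ∫ p, lrTest ξ₀ ξ₁ α p ∂(P K)) atTop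
      (𝓝 (∫ z, rejects ξ₀ ξ₁ α z ∂(selfNormLaw N ξ))) := by
  refine hP.tendsto_integral_selfNorm (measurable_rejects ξ₀ ξ₁ α) (abs_rejects_le ξ₀ ξ₁ α) ?_
  filter_upwards [ae_likelihoodRatio_ne hN hξ ξ (critValue N ξ₀ ξ₁ α)] with z hz
  exact continuousAt_rejects hz.1 hz.2


/-! ### The Neyman–Pearson bound -/

/-- The default value `0` of `selfNorm` violates strict positivity of the first coordinate, so the
prices do not all coincide; strict order of the self-normalized vector then excludes every tie.
Price laws in a price process may charge ties, so this is needed for each finite `K`. -/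
theorem injective_of_selfNorm_mem_simplex {N : ℕ} (hN : 1 ≤ N) {p : Fin (N + 2) → ℝ}
    (hp : selfNorm p ∈ simplex N) : Function.Injective p := by
  have hlt : orderStat p 0 < orderStat p (N + 1) := by
    by_contra h
    have := (hp.2 ⟨0, hN⟩).1
    rw [selfNorm, if_neg h] at this
    exact lt_irrefl _ this
  have h0 : 0 < orderStat p (N + 1) - orderStat p 0 := sub_pos.2 hlt
  have e0 : orderStat p 0 = p (Tuple.sort p 0) := dif_pos (Nat.succ_pos _)
  have e1 : orderStat p (N + 1) = p (Tuple.sort p (Fin.last (N + 1))) := dif_pos (Nat.lt_succ_self _)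
  have key : ∀ i, addEnds (selfNorm p) i =
      (p (Tuple.sort p i) - orderStat p 0) / (orderStat p (N + 1) - orderStat p 0) := by
    intro i
    induction i using Fin.cases with
    | zero => rw [addEnds_zero, e0, sub_self, zero_div]
    | succ i =>
      induction i using Fin.lastCases with
      | last => rw [Fin.succ_last, addEnds_last, ← e1, div_self h0.ne']
      | cast i =>
        rw [addEnds_succ, selfNorm, if_pos hlt]
        congr 2
        exact dif_pos (Nat.succ_lt_succ (i.2.trans (Nat.lt_succ_self _)))
  have hinj := (strictMono_addEnds hp).injective
  have hs : Function.Injective (p ∘ Tuple.sort p) := fun i j hij => hinj (by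
    rw [key, key]
    simp only [Function.comp] at hij
    rw [hij])
  exact (Function.Injective.of_comp_iff' p (Tuple.sort p).bijective).1 hs

theorem IsEquivariantTest.abs_le {n : ℕ} {φ : ℕ → (Fin n → ℝ) → ℝ} (hφ : IsEquivariantTest φ)
    (K : ℕ) (p : Fin n → ℝ) : |φ K p| ≤ 1 := by
  rw [abs_of_nonneg (hφ.mem_Icc K p).1]
  exact (hφ.mem_Icc K p).2

theorem IsEquivariantTest.integrable {n : ℕ} {φ : ℕ → (Fin n → ℝ) → ℝ}
    (hφ : IsEquivariantTest φ) (K : ℕ) (P : Measure (Fin n → ℝ)) [IsFiniteMeasure P] :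
    Integrable (φ K) P :=
  Integrable.of_bound (hφ.meas K).aestronglyMeasurable 1 (Eventually.of_forall (hφ.abs_le K))

/-- The weight `min (f_{ξ₀} / f_{ξ₁}, 1 / q)` on the simplex, and `0` elsewhere. -/
def capRatio {N : ℕ} (ξ₀ ξ₁ q : ℝ) : (Fin N → ℝ) → ℝ :=
  (simplex N).indicator fun z => min (limitDensity ξ₀ z / limitDensity ξ₁ z) q⁻¹

theorem measurable_capRatio {N : ℕ} (ξ₀ ξ₁ q : ℝ) :
    Measurable (capRatio ξ₀ ξ₁ q : (Fin N → ℝ) → ℝ) :=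
  (((measurable_limitDensity ξ₀).div (measurable_limitDensity ξ₁)).min
    measurable_const).indicator (measurableSet_simplex N)

theorem capRatio_nonneg {N : ℕ} (ξ₀ ξ₁ : ℝ) {q : ℝ} (hq : 0 < q) (z : Fin N → ℝ) :
    0 ≤ capRatio ξ₀ ξ₁ q z := by
  refine indicator_nonneg (fun z hz => ?_) z
  exact le_min (div_pos (limitDensity_pos ξ₀ hz) (limitDensity_pos ξ₁ hz)).le (inv_pos.2 hq).le

theorem capRatio_le {N : ℕ} (ξ₀ ξ₁ : ℝ) {q : ℝ} (hq : 0 < q) (z : Fin N → ℝ) :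
    capRatio ξ₀ ξ₁ q z ≤ q⁻¹ :=
  indicator_le' (fun _ _ => min_le_right _ _) (fun _ _ => (inv_pos.2 hq).le) z

theorem capRatio_mul_le {N : ℕ} (ξ₀ ξ₁ q : ℝ) {z : Fin N → ℝ} (hz : z ∈ simplex N) :
    capRatio ξ₀ ξ₁ q z * limitDensity ξ₁ z ≤ limitDensity ξ₀ z := by
  rw [capRatio, indicator_of_mem hz]
  calc _ ≤ limitDensity ξ₀ z / limitDensity ξ₁ z * limitDensity ξ₁ z :=
        mul_le_mul_of_nonneg_right (min_le_left _ _) (limitDensity_nonneg ξ₁ hz)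
    _ = _ := div_mul_cancel₀ _ (limitDensity_pos ξ₁ hz).ne'

theorem continuousAt_capRatio {N : ℕ} (ξ₀ ξ₁ q : ℝ) {z : Fin N → ℝ} (hz : z ∈ simplex N) :
    ContinuousAt (capRatio ξ₀ ξ₁ q) z := by
  have h : ContinuousAt (fun z => min (limitDensity ξ₀ z / limitDensity ξ₁ z) q⁻¹) z :=
    ((continuousAt_limitDensity ξ₀ hz).div (continuousAt_limitDensity ξ₁ hz)
      (limitDensity_pos ξ₁ hz).ne').min continuousAt_const
  refine h.congr ?_
  filter_upwards [(isOpen_simplex N).mem_nhds hz] with w hw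
  rw [capRatio, indicator_of_mem hw]

/-- A test is bounded by the likelihood-ratio test up to its size under the weighted law. -/
theorem le_one_sub_capRatio_add {N : ℕ} (ξ₀ ξ₁ : ℝ) {q : ℝ} (hq : 0 < q) (z : Fin N → ℝ)
    {x : ℝ} (hx : x ≤ 1) :
    x ≤ (1 - q * capRatio ξ₀ ξ₁ q z) + q * (capRatio ξ₀ ξ₁ q z * x) := by
  have h : q * capRatio ξ₀ ξ₁ q z ≤ 1 := by
    have := mul_le_mul_of_nonneg_left (capRatio_le ξ₀ ξ₁ hq z) hq.le
    rwa [mul_inv_cancel₀ hq.ne'] at this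
  nlinarith [mul_nonneg (sub_nonneg.2 h) (sub_nonneg.2 hx)]

/-- Both sides are the positive part of `f_ξ₁ - q f_ξ₀`: the cap is inactive where the test rejects,
and where it is active the factor `1 - q r` vanishes. -/
theorem one_sub_capRatio_mul {N : ℕ} {ξ₀ ξ₁ α : ℝ} (hq : 0 < critValue N ξ₀ ξ₁ α)
    {z : Fin N → ℝ} (hz : z ∈ simplex N) :
    limitDensity ξ₁ z * (1 - critValue N ξ₀ ξ₁ α * capRatio ξ₀ ξ₁ (critValue N ξ₀ ξ₁ α) z) =
      limitDensity ξ₁ z * rejects ξ₀ ξ₁ α z -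
        critValue N ξ₀ ξ₁ α * (limitDensity ξ₀ z * rejects ξ₀ ξ₁ α z) := by
  set q := critValue N ξ₀ ξ₁ α with hqd
  have h0 := limitDensity_pos ξ₀ hz
  have h1 := limitDensity_pos ξ₁ hz
  rw [capRatio, indicator_of_mem hz]
  by_cases h : q < likelihoodRatio ξ₀ ξ₁ z
  · have hr : rejects ξ₀ ξ₁ α z = 1 := by simp [rejects, ← hqd, h]
    have hm : limitDensity ξ₀ z / limitDensity ξ₁ z ≤ q⁻¹ := by
      rw [likelihoodRatio, lt_div_iff₀ h0] at h
      rw [div_le_iff₀ h1, inv_mul_eq_div, le_div_iff₀ hq]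
      linarith
    rw [min_eq_left hm, hr]
    field_simp
  · have hr : rejects ξ₀ ξ₁ α z = 0 := by simp [rejects, ← hqd, h]
    have hm : q⁻¹ ≤ limitDensity ξ₀ z / limitDensity ξ₁ z := by
      rw [likelihoodRatio, not_lt, div_le_iff₀ h0] at h
      rw [le_div_iff₀ h1, inv_mul_eq_div, div_le_iff₀ hq]
      linarith
    rw [min_eq_right hm, hr, mul_inv_cancel₀ hq.ne']
    ring

theorem abs_one_sub_capRatio_le {N : ℕ} (ξ₀ ξ₁ : ℝ) {q : ℝ} (hq : 0 < q) (z : Fin N → ℝ) :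
    |1 - q * capRatio ξ₀ ξ₁ q z| ≤ 1 := by
  have h1 := mul_nonneg hq.le (capRatio_nonneg ξ₀ ξ₁ hq z)
  have h2 := mul_le_mul_of_nonneg_left (capRatio_le ξ₀ ξ₁ hq z) hq.le
  rw [mul_inv_cancel₀ hq.ne'] at h2
  rw [abs_le]
  constructor <;> linarith

/-- The Neyman–Pearson bound is attained: the test has size exactly `α`, so the term subtracted in
`one_sub_capRatio_mul` integrates to `q * α`. -/
theorem integral_one_sub_capRatio {N : ℕ} (hN : 1 ≤ N) {ξ₀ ξ₁ : ℝ} (hξ : ξ₀ ≠ ξ₁) {α : ℝ}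
    (hα₀ : 0 < α) (hα₁ : α < 1) :
    (∫ z, (1 - critValue N ξ₀ ξ₁ α * capRatio ξ₀ ξ₁ (critValue N ξ₀ ξ₁ α) z)
        ∂(selfNormLaw N ξ₁)) + critValue N ξ₀ ξ₁ α * α =
      ∫ z, rejects ξ₀ ξ₁ α z ∂(selfNormLaw N ξ₁) := by
  have hq := critValue_pos hN hξ hα₀ hα₁
  have hsize : ∫ z, rejects ξ₀ ξ₁ α z ∂(selfNormLaw N ξ₀) = α := by
    rw [integral_rejects, selfNormLaw_critValue_lt hN hξ hα₀ hα₁]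
  rw [integral_selfNormLaw] at hsize ⊢
  rw [integral_selfNormLaw, setIntegral_congr_fun (measurableSet_simplex N)
      fun z hz => one_sub_capRatio_mul hq hz, integral_sub, integral_const_mul, hsize]
  · ring
  · exact integrable_limitDensity_mul ξ₁ (measurable_rejects ξ₀ ξ₁ α) (abs_rejects_le ξ₀ ξ₁ α)
  · exact (integrable_limitDensity_mul ξ₀ (measurable_rejects ξ₀ ξ₁ α)
      (abs_rejects_le ξ₀ ξ₁ α)).const_mul _

/-- Common end of both optimality proofs: `v` is a rejection probability under index `ξ₀` and `m`
the mass of the comparison measure. Eventually `v K` is below `α + ε`; then `ε` tends to zero. -/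
theorem limsup_le_of_le_add_mul {u A m v : ℕ → ℝ} {a c α : ℝ} (hc : 0 ≤ c) (hu : ∀ K, 0 ≤ u K)
    (hm : ∀ K, 0 ≤ m K) (hv : ∀ K, v K ∈ Icc (0 : ℝ) 1)
    (hle : ∀ K, u K ≤ A K + c * (m K * v K)) (hA : Tendsto A atTop (𝓝 a))
    (hmt : Tendsto m atTop (𝓝 1)) (hlim : limsup v atTop ≤ α) :
    limsup u atTop ≤ a + c * α := by
  have hvb : IsBoundedUnder (· ≤ ·) atTop v := isBoundedUnder_of ⟨1, fun K => (hv K).2⟩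
  have key : ∀ ε > 0, limsup u atTop ≤ a + c * (α + ε) := fun ε hε => by
    have hev : ∀ᶠ K in atTop, v K < α + ε :=
      eventually_lt_of_limsup_lt (lt_of_le_of_lt hlim (by linarith)) hvb
    have ht : Tendsto (fun K => A K + c * (m K * (α + ε))) atTop (𝓝 (a + c * (1 * (α + ε)))) :=
      hA.add ((hmt.mul_const _).const_mul c)
    rw [one_mul] at ht
    rw [← ht.limsup_eq]
    refine limsup_le_limsup ?_ ?_ ht.isBoundedUnder_le
    · filter_upwards [hev] with K hK
      refine (hle K).trans (add_le_add le_rfl ?_)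
      exact mul_le_mul_of_nonneg_left (mul_le_mul_of_nonneg_left hK.le (hm K)) hc
    · exact isCoboundedUnder_le_of_le atTop (x := 0) hu
  have hcont : Tendsto (fun ε => a + c * (α + ε)) (𝓝[>] 0) (𝓝 (a + c * (α + 0))) :=
    (Continuous.tendsto (by fun_prop) 0).mono_left nhdsWithin_le_nhds
  rw [add_zero] at hcont
  exact ge_of_tendsto hcont (eventually_nhdsWithin_of_forall key)


/-! ### A price model with prescribed self-normalized law -/

/-- The unnormalized conditional integral of `G` given that the self-normalization is `z`. -/
def condLintegral {N : ℕ} (ξ : ℝ) (G : (Fin (N + 2) → ℝ) → ENNReal) (z : Fin N → ℝ) : ENNReal :=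
  ∫⁻ p, (∑ σ : Equiv.Perm (Fin (N + 2)), G (recon ξ z p ∘ σ)) *
    ENNReal.ofReal (reconWeight ξ z p) ∂(scaleLoc ξ)

theorem measurable_recon_comp_perm {N : ℕ} (ξ : ℝ) (σ : Equiv.Perm (Fin (N + 2))) :
    Measurable fun q : (Fin N → ℝ) × (ℝ × ℝ) => recon ξ q.1 q.2 ∘ σ :=
  (measurePreserving_comp_perm volume σ).measurable.comp (measurable_recon ξ)

theorem measurable_sum_recon {N : ℕ} (ξ : ℝ) {G : (Fin (N + 2) → ℝ) → ENNReal}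
    (hG : Measurable G) :
    Measurable fun q : (Fin N → ℝ) × (ℝ × ℝ) =>
      (∑ σ : Equiv.Perm (Fin (N + 2)), G (recon ξ q.1 q.2 ∘ σ)) *
        ENNReal.ofReal (reconWeight ξ q.1 q.2) :=
  (Finset.measurable_sum _ fun σ _ => hG.comp (measurable_recon_comp_perm ξ σ)).mul
    (measurable_reconWeight ξ).ennreal_ofReal

theorem measurable_sum_recon_right {N : ℕ} (ξ : ℝ) {G : (Fin (N + 2) → ℝ) → ENNReal}
    (hG : Measurable G) (z : Fin N → ℝ) :
    Measurable fun p : ℝ × ℝ => (∑ σ : Equiv.Perm (Fin (N + 2)), G (recon ξ z p ∘ σ)) *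
      ENNReal.ofReal (reconWeight ξ z p) := by
  have h := measurable_sum_recon ξ hG
  have hz : Measurable fun p : ℝ × ℝ => (z, p) := measurable_prodMk_left
  have h' := h.comp hz
  exact h'

theorem measurable_condLintegral {N : ℕ} (ξ : ℝ) {G : (Fin (N + 2) → ℝ) → ENNReal}
    (hG : Measurable G) : Measurable (condLintegral (N := N) ξ G) :=
  (measurable_sum_recon ξ hG).lintegral_prod_right'

theorem condLintegral_of_eq {N : ℕ} {ξ : ℝ} {G : (Fin (N + 2) → ℝ) → ENNReal} {c : ENNReal}
    {z : Fin N → ℝ} (hz : z ∈ simplex N)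
    (h : ∀ p : ℝ × ℝ, 0 < p.1 → 0 < p.2 → ∀ σ : Equiv.Perm (Fin (N + 2)),
      G (recon ξ z p ∘ σ) = c) :
    condLintegral ξ G z = c * ENNReal.ofReal (limitDensity ξ z) := by
  have mw : Measurable fun p : ℝ × ℝ => ENNReal.ofReal (reconWeight ξ z p) :=
    ((measurable_reconWeight ξ).comp (measurable_const.prodMk measurable_id)).ennreal_ofReal
  rw [← factorial_mul_lintegral_reconWeight ξ hz, ← mul_assoc, ← lintegral_const_mul _ mw]
  refine lintegral_congr_ae ?_
  filter_upwards [ae_scaleLoc ξ] with p hp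
  simp only [h p hp.1.1 hp.2]
  rw [Finset.sum_const, Finset.card_univ, Fintype.card_perm, Fintype.card_fin, nsmul_eq_mul,
    mul_comm c]

theorem condLintegral_mul_selfNorm {N : ℕ} {ξ : ℝ} {G : (Fin (N + 2) → ℝ) → ENNReal}
    (hG : Measurable G) (k : (Fin N → ℝ) → ENNReal) {z : Fin N → ℝ} (hz : z ∈ simplex N) :
    condLintegral ξ (fun x => G x * k (selfNorm x)) z = condLintegral ξ G z * k z := by
  unfold condLintegral
  rw [← lintegral_mul_const _ (measurable_sum_recon_right ξ hG z)]
  refine lintegral_congr_ae ?_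
  filter_upwards [ae_scaleLoc ξ] with p hp
  simp only [selfNorm_recon hz hp.1.1 hp.2, ← Finset.sum_mul]
  ring

theorem condLintegral_test {N : ℕ} {ξ : ℝ} {φ : ℕ → (Fin (N + 2) → ℝ) → ℝ}
    (hφ : IsEquivariantTest φ) (K : ℕ) {z : Fin N → ℝ} (hz : z ∈ simplex N) :
    condLintegral ξ (fun x => ENNReal.ofReal (φ K x)) z =
      ENNReal.ofReal (φ K (addEnds z)) * ENNReal.ofReal (limitDensity ξ z) := by
  refine condLintegral_of_eq hz fun p h1 h2 σ => ?_
  rw [recon_comp_perm_eq, hφ.equivariant K σ _ _ (addEnds z)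
    (mul_pos (Real.rpow_pos_of_pos h2 _) h1)]

theorem lintegral_limitLaw_eq_condLintegral {N : ℕ} (ξ : ℝ) {G : (Fin (N + 2) → ℝ) → ENNReal}
    (hG : Measurable G) :
    ∫⁻ x, G x ∂(Measure.pi fun _ => limitLaw ξ) = ∫⁻ z in simplex N, condLintegral ξ G z :=
  lintegral_pi_limitLaw N ξ hG

theorem continuous_addEnds (N : ℕ) : Continuous (addEnds : (Fin N → ℝ) → Fin (N + 2) → ℝ) := by
  refine continuous_pi fun i => ?_
  induction i using Fin.cases with
  | zero => exact continuous_const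
  | succ i =>
    induction i using Fin.lastCases with
    | last => simp only [Fin.succ_last, addEnds_last]; exact continuous_const
    | cast i => simp only [addEnds_succ]; exact continuous_apply i

theorem continuous_recon {N : ℕ} (ξ : ℝ) (p : ℝ × ℝ) :
    Continuous fun z : Fin N → ℝ => recon ξ z p := by
  have h : ∀ j, Continuous fun z : Fin N → ℝ => addEnds z j := fun j =>
    (continuous_apply j).comp (continuous_addEnds N)
  unfold recon
  fun_prop

/-- The mixture of the conditional limit laws given the self-normalization, with mixing measure
`Q` weighted by `r`. -/
def mixedLaw {N : ℕ} (ξ : ℝ) (r : (Fin N → ℝ) → ℝ) (Q : Measure (Fin N → ℝ)) :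
    Measure (Fin (N + 2) → ℝ) :=
  ∑ σ : Equiv.Perm (Fin (N + 2)),
    ((((Q.restrict (simplex N)).prod (scaleLoc ξ)).withDensity fun x =>
      ENNReal.ofReal (r x.1 / limitDensity ξ x.1) *
        ENNReal.ofReal (reconWeight ξ x.1 x.2)).map fun x => recon ξ x.1 x.2 ∘ σ)

theorem lintegral_mixedLaw {N : ℕ} (ξ : ℝ) {r : (Fin N → ℝ) → ℝ} (hr : Measurable r)
    (Q : Measure (Fin N → ℝ)) [IsFiniteMeasure Q] {G : (Fin (N + 2) → ℝ) → ENNReal}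
    (hG : Measurable G) :
    ∫⁻ x, G x ∂(mixedLaw ξ r Q) =
      ∫⁻ z in simplex N, ENNReal.ofReal (r z / limitDensity ξ z) * condLintegral ξ G z ∂Q := by
  have md : Measurable fun x : (Fin N → ℝ) × (ℝ × ℝ) =>
      ENNReal.ofReal (r x.1 / limitDensity ξ x.1) *
        ENNReal.ofReal (reconWeight ξ x.1 x.2) := by
    have h1 := measurable_limitDensity (N := N) ξ
    exact ((hr.div h1).comp measurable_fst).ennreal_ofReal.mul
      (measurable_reconWeight ξ).ennreal_ofReal
  have mG : ∀ σ : Equiv.Perm (Fin (N + 2)), Measurable fun x : (Fin N → ℝ) × (ℝ × ℝ) =>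
      G (recon ξ x.1 x.2 ∘ σ) := fun σ => hG.comp (measurable_recon_comp_perm ξ σ)
  have mdG : ∀ σ ∈ (Finset.univ : Finset (Equiv.Perm (Fin (N + 2)))),
      Measurable fun x : (Fin N → ℝ) × (ℝ × ℝ) =>
        (ENNReal.ofReal (r x.1 / limitDensity ξ x.1) *
          ENNReal.ofReal (reconWeight ξ x.1 x.2)) * G (recon ξ x.1 x.2 ∘ σ) :=
    fun σ _ => md.mul (mG σ)
  have h1 : ∀ σ : Equiv.Perm (Fin (N + 2)),
      ∫⁻ x, G x ∂((((Q.restrict (simplex N)).prod (scaleLoc ξ)).withDensity fun x =>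
        ENNReal.ofReal (r x.1 / limitDensity ξ x.1) *
        ENNReal.ofReal (reconWeight ξ x.1 x.2)).map fun x => recon ξ x.1 x.2 ∘ σ) =
      ∫⁻ x, (ENNReal.ofReal (r x.1 / limitDensity ξ x.1) *
        ENNReal.ofReal (reconWeight ξ x.1 x.2)) * G (recon ξ x.1 x.2 ∘ σ)
        ∂((Q.restrict (simplex N)).prod (scaleLoc ξ)) := fun σ => by
    rw [lintegral_map hG (measurable_recon_comp_perm ξ σ)]
    exact lintegral_withDensity_eq_lintegral_mul _ md (mG σ)
  rw [mixedLaw, lintegral_finsetSum_measure]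
  simp only [h1]
  rw [← lintegral_finsetSum _ mdG]
  have e : ∀ x : (Fin N → ℝ) × (ℝ × ℝ), (∑ σ : Equiv.Perm (Fin (N + 2)),
      (ENNReal.ofReal (r x.1 / limitDensity ξ x.1) *
        ENNReal.ofReal (reconWeight ξ x.1 x.2)) * G (recon ξ x.1 x.2 ∘ σ)) =
      ENNReal.ofReal (r x.1 / limitDensity ξ x.1) *
        ((∑ σ : Equiv.Perm (Fin (N + 2)), G (recon ξ x.1 x.2 ∘ σ)) *
          ENNReal.ofReal (reconWeight ξ x.1 x.2)) := fun x => by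
    rw [← Finset.mul_sum]
    ring
  simp only [e]
  have mt : Measurable fun x : (Fin N → ℝ) × (ℝ × ℝ) =>
      ENNReal.ofReal (r x.1 / limitDensity ξ x.1) *
        ((∑ σ : Equiv.Perm (Fin (N + 2)), G (recon ξ x.1 x.2 ∘ σ)) *
          ENNReal.ofReal (reconWeight ξ x.1 x.2)) :=
    ((hr.div (measurable_limitDensity ξ)).comp measurable_fst).ennreal_ofReal.mul
      (measurable_sum_recon ξ hG)
  rw [lintegral_prod _ mt.aemeasurable]
  refine lintegral_congr fun z => ?_
  rw [condLintegral, ← lintegral_const_mul _ (measurable_sum_recon_right ξ hG z)]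

/-- `mixedLaw` completed to a law that is close to the limit law of index `ξ₀` when `Q` is close to
the self-normalized limit law of index `ξ₁`. -/
def matchedLaw {N : ℕ} (ξ₀ ξ₁ q : ℝ) (Q : Measure (Fin N → ℝ)) : Measure (Fin (N + 2) → ℝ) :=
  mixedLaw ξ₀ (capRatio ξ₀ ξ₁ q) Q +
    (Measure.pi fun _ => limitLaw ξ₀).withDensity fun x => ENNReal.ofReal
      (1 - capRatio ξ₀ ξ₁ q (selfNorm x) * limitDensity ξ₁ (selfNorm x) /
        limitDensity ξ₀ (selfNorm x))

/-- The contribution of `mixedLaw` to the integral of `G`, as a function of the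
self-normalization. -/
def mixedFun {N : ℕ} (ξ₀ ξ₁ q : ℝ) (G : (Fin (N + 2) → ℝ) → ENNReal) : (Fin N → ℝ) → ℝ :=
  (simplex N).indicator fun z => (ENNReal.ofReal (capRatio ξ₀ ξ₁ q z / limitDensity ξ₀ z) *
    condLintegral ξ₀ G z).toReal

theorem measurable_mixedFun {N : ℕ} (ξ₀ ξ₁ q : ℝ) {G : (Fin (N + 2) → ℝ) → ENNReal}
    (hG : Measurable G) : Measurable (mixedFun ξ₀ ξ₁ q G) :=
  ((((measurable_capRatio ξ₀ ξ₁ q).div (measurable_limitDensity ξ₀)).ennreal_ofReal.mul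
    (measurable_condLintegral ξ₀ hG)).ennreal_toReal).indicator (measurableSet_simplex N)

theorem condLintegral_le {N : ℕ} (ξ : ℝ) {G : (Fin (N + 2) → ℝ) → ENNReal} {C : ENNReal}
    (hC : ∀ x, G x ≤ C) {z : Fin N → ℝ} (hz : z ∈ simplex N) :
    condLintegral ξ G z ≤ C * ENNReal.ofReal (limitDensity ξ z) := by
  rw [← condLintegral_of_eq (G := fun _ => C) hz fun _ _ _ _ => rfl]
  exact lintegral_mono fun p => mul_le_mul' (Finset.sum_le_sum fun σ _ => hC _) le_rfl

/-- The ratio `f_ξ₀ / f_ξ₁` may be unbounded near the boundary of the simplex; the cap in `capRatio`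
makes the weight bounded, as weak convergence requires. -/
theorem ofReal_mul_condLintegral_le {N : ℕ} (ξ₀ ξ₁ : ℝ) {q : ℝ} (hq : 0 < q)
    {G : (Fin (N + 2) → ℝ) → ENNReal} {C : ENNReal} (hC : ∀ x, G x ≤ C) {z : Fin N → ℝ}
    (hz : z ∈ simplex N) :
    ENNReal.ofReal (capRatio ξ₀ ξ₁ q z / limitDensity ξ₀ z) * condLintegral ξ₀ G z ≤
      C * ENNReal.ofReal q⁻¹ := by
  have h0 := limitDensity_pos ξ₀ hz
  calc _ ≤ ENNReal.ofReal (capRatio ξ₀ ξ₁ q z / limitDensity ξ₀ z) *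
        (C * ENNReal.ofReal (limitDensity ξ₀ z)) := mul_le_mul' le_rfl (condLintegral_le ξ₀ hC hz)
    _ = C * ENNReal.ofReal (capRatio ξ₀ ξ₁ q z) := by
        rw [mul_left_comm, ← ENNReal.ofReal_mul
          (div_nonneg (capRatio_nonneg ξ₀ ξ₁ hq z) h0.le), div_mul_cancel₀ _ h0.ne']
    _ ≤ _ := mul_le_mul' le_rfl (ENNReal.ofReal_le_ofReal (capRatio_le ξ₀ ξ₁ hq z))

theorem lintegral_mixedLaw_capRatio {N : ℕ} (ξ₀ ξ₁ : ℝ) {q : ℝ} (hq : 0 < q)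
    (Q : Measure (Fin N → ℝ)) [IsFiniteMeasure Q] {G : (Fin (N + 2) → ℝ) → ENNReal}
    (hG : Measurable G) {C : NNReal} (hC : ∀ x, G x ≤ C) :
    ∫⁻ x, G x ∂(mixedLaw ξ₀ (capRatio ξ₀ ξ₁ q) Q) =
      ENNReal.ofReal (∫ z, mixedFun ξ₀ ξ₁ q G z ∂Q) := by
  have hm : Measurable fun z : Fin N → ℝ =>
      ENNReal.ofReal (capRatio ξ₀ ξ₁ q z / limitDensity ξ₀ z) * condLintegral ξ₀ G z :=
    ((measurable_capRatio ξ₀ ξ₁ q).div (measurable_limitDensity ξ₀)).ennreal_ofReal.mul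
      (measurable_condLintegral ξ₀ hG)
  have hle : ∀ᵐ z ∂(Q.restrict (simplex N)),
      ENNReal.ofReal (capRatio ξ₀ ξ₁ q z / limitDensity ξ₀ z) * condLintegral ξ₀ G z ≤
        C * ENNReal.ofReal q⁻¹ := by
    filter_upwards [ae_restrict_mem (measurableSet_simplex N)] with z hz
    exact ofReal_mul_condLintegral_le ξ₀ ξ₁ hq hC hz
  have hfin : (C : ENNReal) * ENNReal.ofReal q⁻¹ < ⊤ :=
    ENNReal.mul_lt_top ENNReal.coe_lt_top ENNReal.ofReal_lt_top
  rw [lintegral_mixedLaw ξ₀ (measurable_capRatio ξ₀ ξ₁ q) Q hG, mixedFun,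
    integral_indicator (measurableSet_simplex N), integral_toReal hm.aemeasurable
      (hle.mono fun z hz => hz.trans_lt hfin), ENNReal.ofReal_toReal]
  refine ne_top_of_le_ne_top ?_ (lintegral_mono_ae hle)
  rw [lintegral_const]
  exact (ENNReal.mul_lt_top hfin (measure_lt_top _ _)).ne

theorem abs_mixedFun_le {N : ℕ} (ξ₀ ξ₁ : ℝ) {q : ℝ} (hq : 0 < q)
    {G : (Fin (N + 2) → ℝ) → ENNReal} {C : NNReal} (hC : ∀ x, G x ≤ C) (z : Fin N → ℝ) :
    |mixedFun ξ₀ ξ₁ q G z| ≤ C * q⁻¹ := by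
  have hfin : (C : ENNReal) * ENNReal.ofReal q⁻¹ ≠ ⊤ :=
    (ENNReal.mul_lt_top ENNReal.coe_lt_top ENNReal.ofReal_lt_top).ne
  unfold mixedFun
  by_cases hz : z ∈ simplex N
  · rw [indicator_of_mem hz, abs_of_nonneg ENNReal.toReal_nonneg]
    refine (ENNReal.toReal_mono hfin (ofReal_mul_condLintegral_le ξ₀ ξ₁ hq hC hz)).trans_eq ?_
    rw [ENNReal.toReal_mul, ENNReal.toReal_ofReal (inv_pos.2 hq).le, ENNReal.coe_toReal]
  · rw [indicator_of_notMem hz, abs_zero]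
    exact mul_nonneg C.2 (inv_pos.2 hq).le

theorem toReal_condLintegral {N : ℕ} (ξ : ℝ)
    (g : BoundedContinuousFunction (Fin (N + 2) → ℝ) NNReal) (z : Fin N → ℝ) :
    (condLintegral ξ (fun x => (g x : ENNReal)) z).toReal =
      ∫ p, (∑ σ : Equiv.Perm (Fin (N + 2)), (g (recon ξ z p ∘ σ) : ℝ)) * reconWeight ξ z p
        ∂(scaleLoc ξ) := by
  have hm : Measurable fun p : ℝ × ℝ =>
      (∑ σ : Equiv.Perm (Fin (N + 2)), (g (recon ξ z p ∘ σ) : ℝ)) * reconWeight ξ z p := by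
    refine Measurable.mul (Finset.measurable_sum _ fun σ _ => ?_)
      ((measurable_reconWeight ξ).comp (measurable_prodMk_left (x := z)))
    exact measurable_coe_nnreal_real.comp (g.continuous.measurable.comp
      ((measurable_recon_comp_perm ξ σ).comp (measurable_prodMk_left (x := z))))
  rw [integral_eq_lintegral_of_nonneg_ae _ hm.aestronglyMeasurable, condLintegral]
  · congr 1
    refine lintegral_congr fun p => ?_
    rw [ENNReal.ofReal_mul (Finset.sum_nonneg fun σ _ => NNReal.coe_nonneg _),
      ENNReal.ofReal_sum_of_nonneg fun σ _ => NNReal.coe_nonneg _]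
    simp only [ENNReal.ofReal_coe_nnreal]
  · filter_upwards [ae_scaleLoc ξ] with p hp
    exact mul_nonneg (Finset.sum_nonneg fun σ _ => NNReal.coe_nonneg _)
      (reconWeight_pos ξ z hp.1.1 hp.2).le

/-- For fixed location and scale the reconstructed sample is continuous in the self-normalization,
and `g` is bounded, so `continuousAt_integral_reconWeight` applies. -/
theorem continuousAt_mixedFun {N : ℕ} (ξ₀ ξ₁ : ℝ) {q : ℝ} (hq : 0 < q)
    (g : BoundedContinuousFunction (Fin (N + 2) → ℝ) NNReal) {z : Fin N → ℝ}
    (hz : z ∈ simplex N) : ContinuousAt (mixedFun ξ₀ ξ₁ q fun x => (g x : ENNReal)) z := by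
  have h1 : ContinuousAt (fun z : Fin N → ℝ => ∫ p, (∑ σ : Equiv.Perm (Fin (N + 2)),
      (g (recon ξ₀ z p ∘ σ) : ℝ)) * reconWeight ξ₀ z p ∂(scaleLoc ξ₀)) z := by
    refine continuousAt_integral_reconWeight ξ₀ hz.2
      (g := fun z p => ∑ σ : Equiv.Perm (Fin (N + 2)), (g (recon ξ₀ z p ∘ σ) : ℝ))
      (B := ∑ _σ : Equiv.Perm (Fin (N + 2)), (nndist g 0 : ℝ)) ?_ ?_ ?_
    · intro z p
      rw [abs_of_nonneg (Finset.sum_nonneg fun σ _ => NNReal.coe_nonneg _)]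
      exact Finset.sum_le_sum fun σ _ => BoundedContinuousFunction.NNReal.upper_bound g _
    · intro z
      refine Finset.measurable_sum _ fun σ _ => ?_
      exact measurable_coe_nnreal_real.comp (g.continuous.measurable.comp
        ((measurable_recon_comp_perm ξ₀ σ).comp (measurable_prodMk_left (x := z))))
    · intro p
      refine Continuous.continuousAt (continuous_finsetSum _ fun σ _ => ?_)
      refine NNReal.continuous_coe.comp (g.continuous.comp (continuous_pi fun j => ?_))
      exact (continuous_apply (σ j)).comp (continuous_recon ξ₀ p)
  have h2 := ((continuousAt_capRatio ξ₀ ξ₁ q hz).div (continuousAt_limitDensity ξ₀ hz)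
    (limitDensity_pos ξ₀ hz).ne').mul h1
  refine h2.congr ?_
  filter_upwards [(isOpen_simplex N).mem_nhds hz] with w hw
  simp only [Pi.mul_apply, Pi.div_apply]
  rw [mixedFun, indicator_of_mem hw, ENNReal.toReal_mul, ENNReal.toReal_ofReal
    (div_nonneg (capRatio_nonneg ξ₀ ξ₁ hq w) (limitDensity_pos ξ₀ hw).le), toReal_condLintegral]

theorem measurable_complement {N : ℕ} (ξ₀ ξ₁ q : ℝ) : Measurable fun z : Fin N → ℝ =>
    ENNReal.ofReal (1 - capRatio ξ₀ ξ₁ q z * limitDensity ξ₁ z / limitDensity ξ₀ z) := by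
  have h0 := measurable_limitDensity (N := N) ξ₀
  have h1 := measurable_limitDensity (N := N) ξ₁
  have h2 := measurable_capRatio (N := N) ξ₀ ξ₁ q
  fun_prop

/-- With the self-normalized limit law of index `ξ₁` as mixing measure, the matched law is the
limit law of index `ξ₀`. -/
theorem matchedLaw_selfNormLaw {N : ℕ} (ξ₀ ξ₁ : ℝ) {q : ℝ} (hq : 0 < q) :
    matchedLaw ξ₀ ξ₁ q (selfNormLaw N ξ₁) = Measure.pi fun _ => limitLaw ξ₀ := by
  refine Measure.ext_of_lintegral _ fun G hG => ?_
  have mk := (measurable_complement (N := N) ξ₀ ξ₁ q)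
  have mk' : Measurable fun x : Fin (N + 2) → ℝ => ENNReal.ofReal
      (1 - capRatio ξ₀ ξ₁ q (selfNorm x) * limitDensity ξ₁ (selfNorm x) /
        limitDensity ξ₀ (selfNorm x)) := mk.comp measurable_selfNorm
  have mr : Measurable fun z : Fin N → ℝ =>
      ENNReal.ofReal (capRatio ξ₀ ξ₁ q z / limitDensity ξ₀ z) * condLintegral ξ₀ G z :=
    ((measurable_capRatio ξ₀ ξ₁ q).div (measurable_limitDensity ξ₀)).ennreal_ofReal.mul
      (measurable_condLintegral ξ₀ hG)
  have mf : Measurable fun z : Fin N → ℝ => ENNReal.ofReal (limitDensity ξ₁ z) :=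
    (measurable_limitDensity ξ₁).ennreal_ofReal
  have hrestrict : (selfNormLaw N ξ₁).restrict (simplex N) = selfNormLaw N ξ₁ :=
    Measure.restrict_eq_self_of_ae_mem (ae_selfNormLaw_mem_simplex N ξ₁)
  have e1 := lintegral_withDensity_eq_lintegral_mul
    (Measure.pi fun _ : Fin (N + 2) => limitLaw ξ₀) mk' hG
  have e2 := lintegral_withDensity_eq_lintegral_mul (volume.restrict (simplex N)) mf mr
  rw [matchedLaw, lintegral_add_measure, lintegral_mixedLaw ξ₀ (measurable_capRatio ξ₀ ξ₁ q) _ hG,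
    hrestrict, e1, selfNormLaw, e2, lintegral_limitLaw_eq_condLintegral ξ₀ (mk'.mul hG),
    lintegral_limitLaw_eq_condLintegral ξ₀ hG, ← lintegral_add_left (mf.mul mr)]
  refine setLIntegral_congr_fun (measurableSet_simplex N) fun z hz => ?_
  have h0 := limitDensity_pos ξ₀ hz
  have h1 := limitDensity_nonneg ξ₁ hz
  have hc := capRatio_nonneg ξ₀ ξ₁ hq z
  have h2 : condLintegral ξ₀ ((fun x : Fin (N + 2) → ℝ => ENNReal.ofReal
      (1 - capRatio ξ₀ ξ₁ q (selfNorm x) * limitDensity ξ₁ (selfNorm x) /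
        limitDensity ξ₀ (selfNorm x))) * G) z = condLintegral ξ₀ G z *
      ENNReal.ofReal (1 - capRatio ξ₀ ξ₁ q z * limitDensity ξ₁ z / limitDensity ξ₀ z) := by
    rw [← condLintegral_mul_selfNorm hG (fun z => ENNReal.ofReal
      (1 - capRatio ξ₀ ξ₁ q z * limitDensity ξ₁ z / limitDensity ξ₀ z)) hz]
    simp only [Pi.mul_def, mul_comm]
  simp only [Pi.mul_apply]
  rw [h2, ← mul_assoc, ← ENNReal.ofReal_mul h1, mul_comm (condLintegral ξ₀ G z), ← add_mul,
    ← ENNReal.ofReal_add (by positivity) ?_]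
  -- The redrawn part and the added part carry complementary weights, and the second is nonnegative
  -- because `r f_ξ₁ ≤ f_ξ₀`.
  · have : limitDensity ξ₁ z * (capRatio ξ₀ ξ₁ q z / limitDensity ξ₀ z) +
        (1 - capRatio ξ₀ ξ₁ q z * limitDensity ξ₁ z / limitDensity ξ₀ z) = 1 := by ring
    rw [this, ENNReal.ofReal_one, one_mul]
  · rw [sub_nonneg, div_le_one h0]
    exact capRatio_mul_le ξ₀ ξ₁ q hz


/-! ### Asymptotic power of asymptotically valid tests -/

theorem isFiniteMeasure_matchedLaw {N : ℕ} (ξ₀ ξ₁ : ℝ) {q : ℝ} (hq : 0 < q)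
    (Q : Measure (Fin N → ℝ)) [IsFiniteMeasure Q] : IsFiniteMeasure (matchedLaw ξ₀ ξ₁ q Q) := by
  have h1 : IsFiniteMeasure (mixedLaw ξ₀ (capRatio ξ₀ ξ₁ q) Q) := ⟨by
    rw [← lintegral_one, lintegral_mixedLaw_capRatio ξ₀ ξ₁ hq Q measurable_const
      (C := 1) (fun _ => by simp)]
    exact ENNReal.ofReal_lt_top⟩
  have h2 : IsFiniteMeasure ((Measure.pi fun _ : Fin (N + 2) => limitLaw ξ₀).withDensity fun x =>
      ENNReal.ofReal (1 - capRatio ξ₀ ξ₁ q (selfNorm x) * limitDensity ξ₁ (selfNorm x) /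
        limitDensity ξ₀ (selfNorm x))) := by
    refine isFiniteMeasure_withDensity ?_
    refine ne_top_of_le_ne_top (b := 1) (by simp) ?_
    refine (lintegral_mono_ae (g := fun _ => 1) ?_).trans (by simp)
    filter_upwards [ae_limitLaw_pi_injective (N + 2) ξ₀] with x hx
    have hz := selfNorm_mem_simplex hx
    rw [ENNReal.ofReal_le_one]
    have := div_nonneg (mul_nonneg (capRatio_nonneg ξ₀ ξ₁ hq (selfNorm x))
      (limitDensity_nonneg ξ₁ hz)) (limitDensity_nonneg ξ₀ hz)
    linarith
  unfold matchedLaw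
  infer_instance

/-- The matched law as a finite measure. -/
def matchedFinite {N : ℕ} (ξ₀ ξ₁ : ℝ) {q : ℝ} (hq : 0 < q) (Q : Measure (Fin N → ℝ))
    [IsFiniteMeasure Q] : FiniteMeasure (Fin (N + 2) → ℝ) :=
  ⟨matchedLaw ξ₀ ξ₁ q Q, isFiniteMeasure_matchedLaw ξ₀ ξ₁ hq Q⟩

/-- The matched law depends on the prices only through the law of `selfNorm`, by integrals of the
bounded and almost everywhere continuous `mixedFun`; its other summand is fixed. The limit is
identified by `matchedLaw_selfNormLaw`. -/
theorem IsPriceModel.tendsto_matchedFinite {N : ℕ} {ξ₀ ξ₁ : ℝ} {q : ℝ} (hq : 0 < q)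
    {P : ℕ → Measure (Fin (N + 2) → ℝ)} (hP : IsPriceModel ξ₁ P)
    [∀ K, IsFiniteMeasure ((P K).map selfNorm)] :
    Tendsto (fun K => matchedFinite ξ₀ ξ₁ hq ((P K).map selfNorm)) atTop
      (𝓝 (limitProb (N + 2) ξ₀).toFiniteMeasure) := by
  refine FiniteMeasure.tendsto_iff_forall_lintegral_tendsto.2 fun g => ?_
  have hG : Measurable fun x : Fin (N + 2) → ℝ => (g x : ENNReal) :=
    measurable_coe_nnreal_ennreal.comp g.continuous.measurable
  have hC : ∀ x, (g x : ENNReal) ≤ (nndist g 0 : NNReal) := fun x =>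
    ENNReal.coe_le_coe.2 (BoundedContinuousFunction.NNReal.upper_bound g x)
  have hm := measurable_mixedFun ξ₀ ξ₁ q hG
  have hlim : ((limitProb (N + 2) ξ₀).toFiniteMeasure : Measure (Fin (N + 2) → ℝ)) =
      matchedLaw ξ₀ ξ₁ q (selfNormLaw N ξ₁) := (matchedLaw_selfNormLaw ξ₀ ξ₁ hq).symm
  rw [hlim]
  change Tendsto (fun K => ∫⁻ x, (g x : ENNReal) ∂(matchedLaw ξ₀ ξ₁ q ((P K).map selfNorm))) _ _
  simp only [matchedLaw, lintegral_add_measure, lintegral_mixedLaw_capRatio ξ₀ ξ₁ hq _ hG hC]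
  refine Tendsto.add (ENNReal.tendsto_ofReal ?_) tendsto_const_nhds
  have h := hP.tendsto_integral_selfNorm hm (abs_mixedFun_le ξ₀ ξ₁ hq hC) (by
    filter_upwards [ae_selfNormLaw_mem_simplex N ξ₁] with z hz
    exact continuousAt_mixedFun ξ₀ ξ₁ hq g hz)
  refine h.congr fun K => ?_
  rw [integral_map measurable_selfNorm.aemeasurable hm.aestronglyMeasurable]

/-- The added summand is dropped. In the redrawn one an equivariant test ignores order, location and
scale, so the conditional integral is the test value times `f_ξ₀`, which cancels. Where the prices
have ties, `capRatio` is zero. -/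
theorem ofReal_integral_capRatio_mul_le {N : ℕ} (hN : 1 ≤ N) (ξ₀ ξ₁ : ℝ) {q : ℝ} (hq : 0 < q)
    {φ : ℕ → (Fin (N + 2) → ℝ) → ℝ} (hφ : IsEquivariantTest φ) (K : ℕ)
    (P : Measure (Fin (N + 2) → ℝ)) [IsProbabilityMeasure P]
    [IsFiniteMeasure (P.map selfNorm)] :
    ENNReal.ofReal (∫ p, capRatio ξ₀ ξ₁ q (selfNorm p) * φ K p ∂P) ≤
      ∫⁻ x, ENNReal.ofReal (φ K x) ∂(matchedLaw ξ₀ ξ₁ q (P.map selfNorm)) := by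
  have hG : Measurable fun x => ENNReal.ofReal (φ K x) := (hφ.meas K).ennreal_ofReal
  have mc := measurable_capRatio (N := N) ξ₀ ξ₁ q
  have m1 : Measurable fun z : Fin N → ℝ =>
      ENNReal.ofReal (capRatio ξ₀ ξ₁ q z) * ENNReal.ofReal (φ K (addEnds z)) :=
    mc.ennreal_ofReal.mul ((hφ.meas K).comp measurable_addEnds).ennreal_ofReal
  rw [matchedLaw, lintegral_add_measure, lintegral_mixedLaw ξ₀ mc _ hG]
  refine le_trans ?_ le_self_add
  have e1 : ∫⁻ z in simplex N, ENNReal.ofReal (capRatio ξ₀ ξ₁ q z / limitDensity ξ₀ z) *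
        condLintegral ξ₀ (fun x => ENNReal.ofReal (φ K x)) z ∂(P.map selfNorm) =
      ∫⁻ z in simplex N, ENNReal.ofReal (capRatio ξ₀ ξ₁ q z) * ENNReal.ofReal (φ K (addEnds z))
        ∂(P.map selfNorm) := by
    refine setLIntegral_congr_fun (measurableSet_simplex N) fun z hz => ?_
    have h0 := limitDensity_pos ξ₀ hz
    rw [condLintegral_test hφ K hz, mul_left_comm, ← ENNReal.ofReal_mul
      (div_nonneg (capRatio_nonneg ξ₀ ξ₁ hq z) h0.le), div_mul_cancel₀ _ h0.ne', mul_comm]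
  rw [e1, setLIntegral_map (measurableSet_simplex N) m1 measurable_selfNorm,
    ofReal_integral_eq_lintegral_ofReal,
    ← lintegral_indicator (measurable_selfNorm (measurableSet_simplex N))]
  · refine lintegral_mono fun p => ?_
    by_cases hz : selfNorm p ∈ simplex N
    · rw [indicator_of_mem (show p ∈ selfNorm ⁻¹' simplex N from hz),
        ENNReal.ofReal_mul (capRatio_nonneg ξ₀ ξ₁ hq _),
        hφ.apply_eq_addEnds K (injective_of_selfNorm_mem_simplex hN hz)]
    · simp [capRatio, indicator_of_notMem hz]
  · exact (hφ.integrable K P).bdd_mul (c := q⁻¹)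
      (mc.comp measurable_selfNorm).aestronglyMeasurable (Eventually.of_forall fun p => by
        rw [Real.norm_of_nonneg (capRatio_nonneg ξ₀ ξ₁ hq _)]
        exact capRatio_le ξ₀ ξ₁ hq _)
  · exact Eventually.of_forall fun p =>
      mul_nonneg (capRatio_nonneg ξ₀ ξ₁ hq _) (hφ.mem_Icc K p).1

theorem integral_test_le {N : ℕ} (hN : 1 ≤ N) (ξ₀ ξ₁ : ℝ) {q : ℝ} (hq : 0 < q)
    {φ : ℕ → (Fin (N + 2) → ℝ) → ℝ} (hφ : IsEquivariantTest φ) (K : ℕ)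
    (P : Measure (Fin (N + 2) → ℝ)) [IsProbabilityMeasure P]
    [IsFiniteMeasure (P.map selfNorm)] :
    ∫ p, φ K p ∂P ≤ (∫ p, (1 - q * capRatio ξ₀ ξ₁ q (selfNorm p)) ∂P) +
      q * ((matchedFinite ξ₀ ξ₁ hq (P.map selfNorm)).mass *
        ∫ x, φ K x ∂((matchedFinite ξ₀ ξ₁ hq (P.map selfNorm)).normalize :
          Measure (Fin (N + 2) → ℝ))) := by
  set M := matchedFinite ξ₀ ξ₁ hq (P.map selfNorm) with hM
  have mc := measurable_capRatio (N := N) ξ₀ ξ₁ q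
  have i1 : Integrable (fun p => 1 - q * capRatio ξ₀ ξ₁ q (selfNorm p)) P :=
    Integrable.of_bound (((mc.comp measurable_selfNorm).const_mul q).const_sub
      1).aestronglyMeasurable 1 (Eventually.of_forall fun p => abs_one_sub_capRatio_le ξ₀ ξ₁ hq _)
  have i2 : Integrable (fun p => capRatio ξ₀ ξ₁ q (selfNorm p) * φ K p) P :=
    (hφ.integrable K P).bdd_mul (c := q⁻¹)
      (mc.comp measurable_selfNorm).aestronglyMeasurable (Eventually.of_forall fun p => by
        rw [Real.norm_of_nonneg (capRatio_nonneg ξ₀ ξ₁ hq _)]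
        exact capRatio_le ξ₀ ξ₁ hq _)
  have h1 : ∫ p, φ K p ∂P ≤ (∫ p, (1 - q * capRatio ξ₀ ξ₁ q (selfNorm p)) ∂P) +
      q * ∫ p, capRatio ξ₀ ξ₁ q (selfNorm p) * φ K p ∂P := by
    rw [← integral_const_mul, ← integral_add i1 (i2.const_mul q)]
    exact integral_mono (hφ.integrable K P) (i1.add (i2.const_mul q)) fun p =>
      le_one_sub_capRatio_add ξ₀ ξ₁ hq _ (hφ.mem_Icc K p).2
  refine h1.trans (add_le_add le_rfl (mul_le_mul_of_nonneg_left ?_ hq.le))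
  have h2 := ofReal_integral_capRatio_mul_le hN ξ₀ ξ₁ hq hφ K P
  have h3 : matchedLaw ξ₀ ξ₁ q (P.map selfNorm) =
      M.mass • (M.normalize : Measure (Fin (N + 2) → ℝ)) := by
    have h := congrArg Subtype.val M.self_eq_mass_smul_normalize
    exact h.trans (FiniteMeasure.toMeasure_smul _ _)
  rw [h3, lintegral_smul_measure, ← ofReal_integral_eq_lintegral_ofReal
    (hφ.integrable K _) (Eventually.of_forall fun p => (hφ.mem_Icc K p).1)] at h2
  have h4 : M.mass • ENNReal.ofReal (∫ x, φ K x ∂(M.normalize : Measure (Fin (N + 2) → ℝ))) =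
      ENNReal.ofReal (M.mass * ∫ x, φ K x ∂(M.normalize : Measure (Fin (N + 2) → ℝ))) := by
    rw [ENNReal.ofReal_mul (NNReal.coe_nonneg _), ENNReal.ofReal_coe_nnreal]
    rfl
  rw [h4] at h2
  exact (ENNReal.ofReal_le_ofReal_iff (mul_nonneg (NNReal.coe_nonneg _)
    (integral_nonneg fun p => (hφ.mem_Icc K p).1))).1 h2

theorem integral_test_mem_Icc {n : ℕ} {φ : ℕ → (Fin n → ℝ) → ℝ} (hφ : IsEquivariantTest φ)
    (K : ℕ) (P : Measure (Fin n → ℝ)) [IsProbabilityMeasure P] :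
    ∫ p, φ K p ∂P ∈ Icc (0 : ℝ) 1 := by
  refine ⟨integral_nonneg fun p => (hφ.mem_Icc K p).1, ?_⟩
  refine (integral_mono (hφ.integrable K P) (integrable_const 1) fun p =>
    (hφ.mem_Icc K p).2).trans ?_
  simp

/-- No asymptotically valid equivariant test has larger asymptotic power than the
likelihood-ratio test. -/
theorem limsup_le_of_isAsymptoticallyValid {N : ℕ} (hN : 1 ≤ N) {ξ₀ ξ₁ : ℝ} (hξ : ξ₀ ≠ ξ₁)
    {α : ℝ} (hα₀ : 0 < α) (hα₁ : α < 1) {φ : ℕ → (Fin (N + 2) → ℝ) → ℝ}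
    (hφ : IsEquivariantTest φ) (hv : IsAsymptoticallyValid ξ₀ α φ)
    {P : ℕ → Measure (Fin (N + 2) → ℝ)} (hP : IsPriceModel ξ₁ P) :
    limsup (fun K => ∫ p, φ K p ∂(P K)) atTop ≤
      limsup (fun K => ∫ p, lrTest ξ₀ ξ₁ α p ∂(P K)) atTop := by
  have hq := critValue_pos hN hξ hα₀ hα₁
  have hPK := hP.1
  have hfin : ∀ K, IsFiniteMeasure ((P K).map selfNorm) := fun K => inferInstance
  have ht := hP.tendsto_matchedFinite (ξ₀ := ξ₀) hq
  have hne : (limitProb (N + 2) ξ₀).toFiniteMeasure ≠ 0 :=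
    ProbabilityMeasure.toFiniteMeasure_nonzero _
  have hnorm := FiniteMeasure.tendsto_normalize_of_tendsto ht hne
  rw [ProbabilityMeasure.toFiniteMeasure_normalize_eq_self] at hnorm
  have hmass := ht.mass
  rw [ProbabilityMeasure.mass_toFiniteMeasure] at hmass
  -- Matched laws are built on the scale of the limit, so the constants `1` and `0` normalize them.
  -- Their mass only tends to one, hence the explicit normalization.
  have hmodel : IsPriceModel ξ₀ fun K => ((matchedFinite ξ₀ ξ₁ hq
      ((P K).map selfNorm)).normalize : Measure (Fin (N + 2) → ℝ)) := by
    refine ⟨fun K => inferInstance, fun _ => 1, fun _ => 0, fun _ => one_pos, fun g => ?_⟩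
    simp only [sub_zero, div_one]
    exact ProbabilityMeasure.tendsto_iff_forall_integral_tendsto.1 hnorm g
  -- The power of the likelihood-ratio test converges, and its limit is rewritten in the form of the
  -- upper bound.
  rw [(hP.tendsto_lrTest hN hξ α).limsup_eq, ← integral_one_sub_capRatio hN hξ hα₀ hα₁]
  have mc := measurable_capRatio (N := N) ξ₀ ξ₁ (critValue N ξ₀ ξ₁ α)
  refine limsup_le_of_le_add_mul hq.le (fun K => (integral_test_mem_Icc hφ K (P K)).1)
    (fun K => NNReal.coe_nonneg _)
    (fun K => integral_test_mem_Icc hφ K _) (fun K => integral_test_le hN ξ₀ ξ₁ hq hφ K (P K))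
    (hP.tendsto_integral_selfNorm ((mc.const_mul _).const_sub 1)
      (abs_one_sub_capRatio_le ξ₀ ξ₁ hq) ?_) ?_ (hv _ hmodel)
  · filter_upwards [ae_selfNormLaw_mem_simplex N ξ₁] with z hz
    exact continuousAt_const.sub (continuousAt_const.mul (continuousAt_capRatio ξ₀ ξ₁ _ hz))
  · exact (NNReal.continuous_coe.tendsto _).comp hmass


/-! ### Weak convergence on the line -/

/-- Squeezing by monotonicity: any interval of positive mass contains a point of convergence, and
the limit CDF is continuous. Convergence of prices is available only inside the support of the limit
law, and this extends it to the whole line. -/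
theorem tendsto_cdf_of_ae {μs : ℕ → Measure ℝ} {μ : Measure ℝ} [∀ K, IsProbabilityMeasure (μs K)]
    [IsProbabilityMeasure μ] [NullSingletonClass μ]
    (h : ∀ᵐ y ∂μ, Tendsto (fun K => cdf (μs K) y) atTop (𝓝 (cdf μ y))) (x : ℝ) :
    Tendsto (fun K => cdf (μs K) x) atTop (𝓝 (cdf μ x)) := by
  have hc := continuous_cdf_of_noAtoms μ
  have hpos : ∀ s t, cdf μ s < cdf μ t →
      ∃ y ∈ Ioc s t, Tendsto (fun K => cdf (μs K) y) atTop (𝓝 (cdf μ y)) := fun s t hst => by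
    have hm : μ (Ioc s t) ≠ 0 := by
      rw [← measure_cdf μ, StieltjesFunction.measure_Ioc, Ne, ENNReal.ofReal_eq_zero, not_le]
      linarith
    by_contra! hne
    refine hm (measure_mono_null (t := {y | ¬ Tendsto (fun K => cdf (μs K) y) atTop
      (𝓝 (cdf μ y))}) (fun y hy => hne y hy) h)
  refine tendsto_order.2 ⟨fun a ha => ?_, fun a ha => ?_⟩
  -- Bounds outside `[0, 1]` are trivial; excluding them lets the intermediate value theorem find a
  -- point where the CDF takes the value `u`.
  · by_cases h0 : a < 0
    · exact Eventually.of_forall fun K => h0.trans_le (cdf_nonneg _ _)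
    obtain ⟨u, hu1, hu2⟩ := exists_between ha
    obtain ⟨s, hs⟩ := mem_range_of_exists_le_of_exists_ge hc
      (((tendsto_cdf_atBot μ).eventually_le_const ((not_lt.1 h0).trans_lt hu1)).exists)
      ⟨x, hu2.le⟩
    obtain ⟨y, hy, hyt⟩ := hpos s x (hs ▸ hu2)
    have : a < cdf μ y := hu1.trans_le (hs ▸ monotone_cdf μ hy.1.le)
    filter_upwards [hyt.eventually_const_lt this] with K hK
    exact hK.trans_le (monotone_cdf _ hy.2)
  · by_cases h1 : 1 < a
    · exact Eventually.of_forall fun K => (cdf_le_one _ _).trans_lt h1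
    obtain ⟨u, hu1, hu2⟩ := exists_between ha
    obtain ⟨t, ht⟩ := mem_range_of_exists_le_of_exists_ge hc ⟨x, hu1.le⟩
      (((tendsto_cdf_atTop μ).eventually_const_le (hu2.trans_le (not_lt.1 h1))).exists)
    obtain ⟨y, hy, hyt⟩ := hpos x t (ht ▸ hu1)
    have : cdf μ y < a := (ht ▸ monotone_cdf μ hy.2 : cdf μ y ≤ u).trans_lt hu2
    filter_upwards [hyt.eventually_lt_const this] with K hK
    exact (monotone_cdf _ hy.1.le).trans_lt hK

theorem tendsto_probabilityMeasure_of_tendsto_cdf {μs : ℕ → ProbabilityMeasure ℝ}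
    {μ : ProbabilityMeasure ℝ}
    (h : ∀ x, Tendsto (fun K => cdf (μs K : Measure ℝ) x) atTop (𝓝 (cdf (μ : Measure ℝ) x))) :
    Tendsto μs atTop (𝓝 μ) := by
  refine (isPiSystem_Ioc (id : ℝ → ℝ) id).tendsto_probabilityMeasure_of_tendsto_of_mem ?_ ?_ ?_
  · rintro s ⟨l, u, -, rfl⟩
    exact measurableSet_Ioc
  · intro u hu x hx
    obtain ⟨ε, hε, hball⟩ := Metric.isOpen_iff.1 hu x hx
    refine ⟨Ioc (x - ε / 2) (x + ε / 2), ⟨x - ε / 2, x + ε / 2, by simp; linarith, rfl⟩,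
      Ioc_mem_nhds (by linarith) (by linarith), fun y hy => hball ?_⟩
    rw [Metric.mem_ball, Real.dist_eq, abs_lt]
    constructor <;> linarith [hy.1, hy.2]
  · rintro s ⟨l, u, hlu, rfl⟩
    have e : ∀ ν : ProbabilityMeasure ℝ, ((ν (Ioc (id l) (id u)) : NNReal) : ℝ) =
        cdf (ν : Measure ℝ) u - cdf (ν : Measure ℝ) l := fun ν => by
      change (ν : Measure ℝ).real (Ioc l u) = _
      have hd : Disjoint (Iic l) (Ioc l u) :=
        Set.disjoint_left.2 fun y hy hy' => absurd hy'.1 (not_lt.2 hy)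
      have := measureReal_union (μ := (ν : Measure ℝ)) hd measurableSet_Ioc
      rw [Iic_union_Ioc_eq_Iic (show l ≤ u from le_of_lt hlu)] at this
      rw [cdf_eq_real, cdf_eq_real, this]
      ring
    rw [← NNReal.tendsto_coe]
    simp only [e]
    exact (h u).sub (h l)

/-! ### The second-highest of independent draws -/

/-- The law of the second-highest of `m` independent draws from `ν`. -/
def secondLaw (ν : Measure ℝ) (m : ℕ) : Measure ℝ :=
  (Measure.pi fun _ : Fin m => ν).map secondPrice

theorem measurable_secondPrice (m : ℕ) : Measurable (secondPrice : (Fin m → ℝ) → ℝ) :=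
  measurable_orderStat _

instance (ν : Measure ℝ) [IsProbabilityMeasure ν] (m : ℕ) :
    IsProbabilityMeasure (secondLaw ν m) :=
  Measure.isProbabilityMeasure_map (measurable_secondPrice m).aemeasurable

theorem priceLaw_eq_pi {n : ℕ} (ν : Measure ℝ) [IsProbabilityMeasure ν] (k : Fin n → ℕ) :
    priceLaw ν k = Measure.pi fun j => secondLaw ν (k j) := by
  have hs : ∀ j, SigmaFinite ((Measure.pi fun _ : Fin (k j) => ν).map secondPrice) := fun j =>
    (inferInstance : SigmaFinite (secondLaw ν (k j)))
  exact Measure.pi_map_pi (fun j => (measurable_secondPrice (k j)).aemeasurable)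

theorem orderStat_le_iff {m : ℕ} (x : Fin m → ℝ) {r : ℕ} (hr : r < m) (c : ℝ) :
    orderStat x r ≤ c ↔ r < (Finset.univ.filter fun i => x i ≤ c).card := by
  have h1 := Tuple.lt_card_le_iff_apply_le_of_monotone (f := x ∘ Tuple.sort x) (a := c)
    (j := ⟨r, hr⟩) (Tuple.monotone_sort x)
  have h2 : Fintype.card {i : Fin m // (x ∘ Tuple.sort x) i ≤ c} =
      Fintype.card {i : Fin m // x i ≤ c} :=
    Fintype.card_congr ((Tuple.sort x).subtypeEquiv fun _ => Iff.rfl)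
  rw [orderStat, dif_pos hr, ← Fintype.card_subtype, ← h2, Fintype.card_subtype]
  exact h1.symm

/-- The second-highest entry is at most `c` exactly when at most one entry exceeds `c`; the union
runs over which one does. For `m < 2` the rank `m - 2` would truncate to `0`. -/
theorem secondPrice_preimage_Iic {m : ℕ} (hm : 2 ≤ m) (c : ℝ) :
    (secondPrice : (Fin m → ℝ) → ℝ) ⁻¹' Iic c =
      (univ.pi fun _ => Iic c) ∪ ⋃ i ∈ (Finset.univ : Finset (Fin m)),
        univ.pi (Function.update (fun _ => Iic c) i (Ioi c)) := by
  ext x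
  have hcard : (Finset.univ.filter fun i => x i ≤ c).card +
      (Finset.univ.filter fun i => ¬ x i ≤ c).card = m := by
    rw [Finset.card_filter_add_card_filter_not, Finset.card_univ, Fintype.card_fin]
  rw [mem_preimage, mem_Iic, secondPrice, orderStat_le_iff x (by omega) c]
  have h1 : m - 2 < (Finset.univ.filter fun i => x i ≤ c).card ↔
      (Finset.univ.filter fun i => ¬ x i ≤ c).card ≤ 1 := by omega
  have : Nonempty (Fin m) := ⟨⟨0, by omega⟩⟩
  rw [h1, Finset.card_le_one_iff_subset_singleton]
  constructor
  · rintro ⟨i, hi⟩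
    by_cases hic : x i ≤ c
    · left
      intro j _
      by_contra hj
      have := hi (Finset.mem_filter.2 ⟨Finset.mem_univ j, hj⟩)
      rw [Finset.mem_singleton] at this
      exact hj (this ▸ hic)
    · right
      simp only [mem_iUnion]
      refine ⟨i, Finset.mem_univ i, fun j _ => ?_⟩
      by_cases hji : j = i
      · subst hji
        simpa using hic
      · rw [Function.update_of_ne hji]
        by_contra hj
        exact hji (Finset.mem_singleton.1 (hi (Finset.mem_filter.2 ⟨Finset.mem_univ j, hj⟩)))
  · rintro (h | h)
    -- No entry exceeds `c` here, so any index serves.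
    · refine ⟨⟨0, by omega⟩, fun j hj => ?_⟩
      exact absurd (h j (mem_univ j)) (Finset.mem_filter.1 hj).2
    · simp only [mem_iUnion] at h
      obtain ⟨i, -, hi⟩ := h
      refine ⟨i, fun j hj => ?_⟩
      rw [Finset.mem_singleton]
      by_contra hji
      have := hi j (mem_univ j)
      rw [Function.update_of_ne hji] at this
      exact (Finset.mem_filter.1 hj).2 this

/-- The CDF of the second-highest of `m` draws, as a function of the CDF `u` of one draw. -/
def secondCdf (m : ℕ) (u : ℝ) : ℝ := u ^ m + m * u ^ (m - 1) * (1 - u)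

theorem cdf_secondLaw (ν : Measure ℝ) [IsProbabilityMeasure ν] {m : ℕ} (hm : 2 ≤ m) (c : ℝ) :
    cdf (secondLaw ν m) c = secondCdf m (cdf ν c) := by
  have hmeas : ∀ i : Fin m,
      MeasurableSet (univ.pi (Function.update (fun _ : Fin m => Iic c) i (Ioi c))) := fun i =>
    MeasurableSet.univ_pi fun j => by
      by_cases hji : j = i
      · subst hji; simp
      · simp [Function.update_of_ne hji]
  have hdisj : ((Finset.univ : Finset (Fin m)) : Set (Fin m)).PairwiseDisjoint
      fun i => univ.pi (Function.update (fun _ : Fin m => Iic c) i (Ioi c)) := by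
    intro i _ j _ hij
    refine Set.disjoint_left.2 fun x hx hx' => ?_
    have h1 := hx i (mem_univ i)
    have h2 := hx' i (mem_univ i)
    rw [Function.update_self] at h1
    rw [Function.update_of_ne hij] at h2
    exact not_le.2 (mem_Ioi.1 h1) (mem_Iic.1 h2)
  have hdisj' : Disjoint (univ.pi fun _ : Fin m => Iic c)
      (⋃ i ∈ (Finset.univ : Finset (Fin m)),
        univ.pi (Function.update (fun _ : Fin m => Iic c) i (Ioi c))) := by
    refine Set.disjoint_left.2 fun x hx hx' => ?_
    simp only [mem_iUnion] at hx'
    obtain ⟨i, -, hi⟩ := hx'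
    have h1 := hi i (mem_univ i)
    rw [Function.update_self] at h1
    exact not_le.2 (mem_Ioi.1 h1) (mem_Iic.1 (hx i (mem_univ i)))
  have hIoi : ν.real (Ioi c) = 1 - cdf ν c := by
    rw [← compl_Iic, probReal_compl_eq_one_sub measurableSet_Iic, cdf_eq_real]
  have hi : ∀ i : Fin m, (Measure.pi fun _ : Fin m => ν).real
      (univ.pi (Function.update (fun _ : Fin m => Iic c) i (Ioi c))) =
        cdf ν c ^ (m - 1) * (1 - cdf ν c) := fun i => by
    rw [measureReal_def, Measure.pi_pi, ENNReal.toReal_prod,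
      ← Finset.mul_prod_erase _ _ (Finset.mem_univ i), Function.update_self]
    have : ∀ j ∈ Finset.univ.erase i,
        (ν (Function.update (fun _ : Fin m => Iic c) i (Ioi c) j)).toReal = cdf ν c :=
      fun j hj => by
        rw [Function.update_of_ne (Finset.ne_of_mem_erase hj), cdf_eq_real, measureReal_def]
    rw [Finset.prod_congr rfl this, Finset.prod_const, Finset.card_erase_of_mem
      (Finset.mem_univ i), Finset.card_univ, Fintype.card_fin, ← measureReal_def, hIoi]
    ring
  have h0 : (Measure.pi fun _ : Fin m => ν).real (univ.pi fun _ => Iic c) = cdf ν c ^ m := by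
    rw [measureReal_def, Measure.pi_pi, ENNReal.toReal_prod, Finset.prod_const, Finset.card_univ,
      Fintype.card_fin, cdf_eq_real, measureReal_def]
  rw [cdf_eq_real, secondLaw, map_measureReal_apply (measurable_secondPrice m) measurableSet_Iic,
    secondPrice_preimage_Iic hm, measureReal_union hdisj'
      (Finset.measurableSet_biUnion _ fun i _ => hmeas i) (measure_ne_top _ _) (measure_ne_top _ _),
    measureReal_biUnion_finset hdisj fun i _ => hmeas i]
  simp only [hi, h0, Finset.sum_const, Finset.card_univ, Fintype.card_fin, nsmul_eq_mul]
  rw [secondCdf]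
  ring

/-! ### Extreme value asymptotics -/

theorem tendsto_mul_neg_log {u : ℕ → ℝ} {τ : ℝ}
    (h : Tendsto (fun K => u K ^ K) atTop (𝓝 (Real.exp (-τ)))) :
    Tendsto (fun K : ℕ => (K : ℝ) * -Real.log (u K)) atTop (𝓝 τ) := by
  have h1 := ((Real.continuousAt_log (Real.exp_pos (-τ)).ne').tendsto.comp h).neg
  rw [Real.log_exp, neg_neg] at h1
  refine h1.congr fun K => ?_
  simp only [Function.comp, Real.log_pow]
  ring

theorem eventually_pos_of_tendsto_pow {u : ℕ → ℝ} (h0 : ∀ K, 0 ≤ u K) {τ : ℝ}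
    (h : Tendsto (fun K => u K ^ K) atTop (𝓝 (Real.exp (-τ)))) : ∀ᶠ K in atTop, 0 < u K := by
  filter_upwards [h.eventually_const_lt (Real.exp_pos _), eventually_ne_atTop 0] with K hK hK0
  refine (h0 K).lt_of_ne fun e => ?_
  rw [← e, zero_pow hK0] at hK
  exact lt_irrefl _ hK

theorem tendsto_neg_log_zero {u : ℕ → ℝ} {τ : ℝ}
    (h : Tendsto (fun K => u K ^ K) atTop (𝓝 (Real.exp (-τ)))) :
    Tendsto (fun K : ℕ => -Real.log (u K)) atTop (𝓝 0) := by
  have h1 := (tendsto_mul_neg_log h).mul tendsto_inv_atTop_nhds_zero_nat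
  rw [mul_zero] at h1
  refine h1.congr' ?_
  filter_upwards [eventually_ne_atTop 0] with K hK
  have : (K : ℝ) ≠ 0 := Nat.cast_ne_zero.2 hK
  field_simp

/-- With `L = -log u`, the quantity `1 - u` lies between `L / (1 + L)` and `L`, while `K * L` tends
to `τ` and `L` to zero. -/
theorem tendsto_mul_one_sub {u : ℕ → ℝ} (h0 : ∀ K, 0 ≤ u K) (h1 : ∀ K, u K ≤ 1) {τ : ℝ}
    (h : Tendsto (fun K => u K ^ K) atTop (𝓝 (Real.exp (-τ)))) :
    Tendsto (fun K : ℕ => (K : ℝ) * (1 - u K)) atTop (𝓝 τ) := by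
  have hl := tendsto_mul_neg_log h
  have hl0 := tendsto_neg_log_zero h
  have hdiv : Tendsto (fun K : ℕ => (K : ℝ) * -Real.log (u K) / (1 + -Real.log (u K))) atTop
      (𝓝 τ) := by
    have := hl.div (hl0.const_add 1) (by norm_num)
    rwa [add_zero, div_one] at this
  refine tendsto_of_tendsto_of_tendsto_of_le_of_le' hdiv hl ?_ ?_
  · filter_upwards [eventually_pos_of_tendsto_pow h0 h] with K hK
    have hL : 0 ≤ -Real.log (u K) := neg_nonneg.2 (Real.log_nonpos (h0 K) (h1 K))
    rw [mul_div_assoc]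
    refine mul_le_mul_of_nonneg_left ?_ (Nat.cast_nonneg K)
    have h2 := Real.add_one_le_exp (-Real.log (u K))
    rw [Real.exp_neg, Real.exp_log hK] at h2
    rw [div_le_iff₀ (by linarith)]
    have h3 : u K * (-Real.log (u K) + 1) ≤ 1 := by
      calc _ ≤ u K * (u K)⁻¹ := mul_le_mul_of_nonneg_left h2 hK.le
        _ = 1 := mul_inv_cancel₀ hK.ne'
    linarith
  · filter_upwards [eventually_pos_of_tendsto_pow h0 h] with K hK
    refine mul_le_mul_of_nonneg_left ?_ (Nat.cast_nonneg K)
    have := Real.add_one_le_exp (Real.log (u K))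
    rw [Real.exp_log hK] at this
    linarith

theorem tendsto_pow_of_div {u : ℕ → ℝ} (h0 : ∀ K, 0 ≤ u K) {τ : ℝ}
    (h : Tendsto (fun K => u K ^ K) atTop (𝓝 (Real.exp (-τ)))) {m : ℕ → ℕ}
    (hm : Tendsto (fun K : ℕ => (m K : ℝ) / K) atTop (𝓝 1)) :
    Tendsto (fun K => u K ^ m K) atTop (𝓝 (Real.exp (-τ))) := by
  have h1 := (Real.continuous_exp.tendsto _).comp (((tendsto_mul_neg_log h).mul hm).neg)
  rw [mul_one] at h1
  refine h1.congr' ?_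
  filter_upwards [eventually_pos_of_tendsto_pow h0 h, eventually_ne_atTop 0] with K hK hK0
  have : (K : ℝ) ≠ 0 := Nat.cast_ne_zero.2 hK0
  have e : -(K * -Real.log (u K) * (m K / K)) = Real.log (u K) * m K := by field_simp
  simp only [Function.comp]
  rw [e, ← Real.rpow_natCast, Real.rpow_def_of_pos hK]

theorem tendsto_sub_div {m : ℕ → ℕ} (hm : Tendsto (fun K : ℕ => (m K : ℝ) / K) atTop (𝓝 1))
    (hmK : ∀ K, K ≤ m K) (r : ℕ) :
    Tendsto (fun K : ℕ => ((m K - r : ℕ) : ℝ) / K) atTop (𝓝 1) := by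
  have h1 := hm.sub (tendsto_inv_atTop_nhds_zero_nat (𝕜 := ℝ).const_mul (r : ℝ))
  rw [mul_zero, sub_zero] at h1
  refine h1.congr' ?_
  filter_upwards [eventually_ge_atTop r] with K hK
  rw [Nat.cast_sub (hK.trans (hmK K))]
  ring

/-- Poisson heuristics made exact: no exceedance has limiting probability `exp (-τ)`, exactly one
has `τ * exp (-τ)`. Bidder numbers enter only through `m K / K → 1`. -/
theorem tendsto_secondCdf {u : ℕ → ℝ} (h0 : ∀ K, 0 ≤ u K) (h1 : ∀ K, u K ≤ 1) {τ : ℝ}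
    (h : Tendsto (fun K => u K ^ K) atTop (𝓝 (Real.exp (-τ)))) {m : ℕ → ℕ}
    (hm : Tendsto (fun K : ℕ => (m K : ℝ) / K) atTop (𝓝 1)) (hmK : ∀ K, K ≤ m K) :
    Tendsto (fun K => secondCdf (m K) (u K)) atTop (𝓝 ((1 + τ) * Real.exp (-τ))) := by
  have h2 := (tendsto_pow_of_div h0 h hm).add
    ((hm.mul (tendsto_mul_one_sub h0 h1 h)).mul
      (tendsto_pow_of_div h0 h (tendsto_sub_div hm hmK 1)))
  have e : Real.exp (-τ) + 1 * τ * Real.exp (-τ) = (1 + τ) * Real.exp (-τ) := by ring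
  rw [e] at h2
  refine h2.congr' ?_
  filter_upwards [eventually_ne_atTop 0] with K hK
  have : (K : ℝ) ≠ 0 := Nat.cast_ne_zero.2 hK
  rw [secondCdf]
  field_simp

/-! ### Prices in the domain of attraction -/

theorem ae_limitLaw_mem_gevDom (ξ : ℝ) : ∀ᵐ y ∂(limitLaw ξ), y ∈ gevDom ξ := by
  rw [limitLaw_eq_withDensity]
  exact withDensity_absolutelyContinuous _ _ (ae_restrict_mem (isOpen_gevDom ξ).measurableSet)

instance (ξ : ℝ) : NullSingletonClass (limitLaw ξ) := ⟨fun x => by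
  rw [limitLaw_eq_withDensity]
  exact withDensity_absolutelyContinuous _ _ (measure_singleton x)⟩

theorem continuousAt_gev {ξ y : ℝ} (hy : y ∈ gevDom ξ) : ContinuousAt (gev ξ) y := by
  have h : ContinuousAt (fun y => Real.exp (-Real.exp (-gevLog ξ y))) y :=
    (Real.continuous_exp.continuousAt.comp (Real.continuous_exp.continuousAt.comp
      (hasDerivAt_gevLog hy).continuousAt.neg).neg)
  refine h.congr ?_
  filter_upwards [(isOpen_gevDom ξ).mem_nhds hy] with x hx
  exact (gev_eq hx).symm

theorem IsNormalizing.tendsto_pow {ν : Measure ℝ} {ξ : ℝ} {a b : ℕ → ℝ}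
    (h : IsNormalizing ν ξ a b) {y : ℝ} (hy : y ∈ gevDom ξ) :
    Tendsto (fun K : ℕ => cdf ν (a K * y + b K) ^ K) atTop
      (𝓝 (Real.exp (-Real.exp (-gevLog ξ y)))) := by
  rw [← gev_eq hy]
  exact h.2 y (continuousAt_gev hy)

/-- The law of the normalized price in an auction with `m` bidders. -/
def normLaw (ν : Measure ℝ) (m : ℕ) (a b : ℝ) : Measure ℝ :=
  (secondLaw ν m).map fun x => (x - b) / a

theorem measurable_sub_div (a b : ℝ) : Measurable fun x : ℝ => (x - b) / a := by fun_prop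

instance (ν : Measure ℝ) [IsProbabilityMeasure ν] (m : ℕ) (a b : ℝ) :
    IsProbabilityMeasure (normLaw ν m a b) :=
  Measure.isProbabilityMeasure_map (measurable_sub_div a b).aemeasurable

theorem cdf_normLaw (ν : Measure ℝ) [IsProbabilityMeasure ν] {m : ℕ} (hm : 2 ≤ m) {a : ℝ}
    (ha : 0 < a) (b y : ℝ) :
    cdf (normLaw ν m a b) y = secondCdf m (cdf ν (a * y + b)) := by
  rw [← cdf_secondLaw ν hm, cdf_eq_real, cdf_eq_real, normLaw,
    map_measureReal_apply (measurable_sub_div a b) measurableSet_Iic]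
  congr 1
  ext x
  simp only [mem_preimage, mem_Iic]
  rw [div_le_iff₀ ha]
  constructor <;> intro h <;> linarith

theorem map_normalize_priceLaw {n : ℕ} (ν : Measure ℝ) [IsProbabilityMeasure ν] (k : Fin n → ℕ)
    (a b : ℝ) : (priceLaw ν k).map (fun p j => (p j - b) / a) =
      Measure.pi fun j => normLaw ν (k j) a b := by
  have hs : ∀ j, SigmaFinite ((secondLaw ν (k j)).map fun x => (x - b) / a) := fun j =>
    (inferInstance : SigmaFinite (normLaw ν (k j) a b))
  rw [priceLaw_eq_pi]
  exact Measure.pi_map_pi fun j => (measurable_sub_div a b).aemeasurable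

theorem tendsto_cdf_normLaw {ν : Measure ℝ} [IsProbabilityMeasure ν] {ξ : ℝ} {a b : ℕ → ℝ}
    (h : IsNormalizing ν ξ a b) {m : ℕ → ℕ}
    (hm : Tendsto (fun K : ℕ => (m K : ℝ) / K) atTop (𝓝 1)) (hmK : ∀ K, K ≤ m K) {y : ℝ}
    (hy : y ∈ gevDom ξ) :
    Tendsto (fun K => cdf (normLaw ν (m K) (a K) (b K)) y) atTop (𝓝 (cdf (limitLaw ξ) y)) := by
  rw [cdf_eq_real, limitLaw_Iic hy]
  refine (tendsto_secondCdf (fun K => cdf_nonneg ν _) (fun K => cdf_le_one ν _)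
    (h.tendsto_pow hy) hm hmK).congr' ?_
  filter_upwards [eventually_ge_atTop 2] with K hK
  exact (cdf_normLaw ν (hK.trans (hmK K)) (h.1 K) (b K) y).symm

/-- `normLaw` as a probability measure. -/
def normProb (ν : Measure ℝ) [IsProbabilityMeasure ν] (m : ℕ) (a b : ℝ) : ProbabilityMeasure ℝ :=
  ⟨normLaw ν m a b, inferInstance⟩

/-- Prices of different auctions are independent, so joint convergence follows from the marginals,
and one pair of normalizing constants serves all auctions. -/
theorem isPriceModel_priceLaw {n : ℕ} {ν : Measure ℝ} [IsProbabilityMeasure ν] {ξ : ℝ}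
    (hν : InDomain ν ξ) {k : ℕ → Fin n → ℕ} (hk : IsBidderArray k) :
    IsPriceModel ξ (fun K => priceLaw ν (k K)) := by
  obtain ⟨a, b, h⟩ := hν
  have hconv : ∀ j, Tendsto (fun K => normProb ν (k K j) (a K) (b K)) atTop
      (𝓝 (⟨limitLaw ξ, inferInstance⟩ : ProbabilityMeasure ℝ)) := fun j => by
    refine tendsto_probabilityMeasure_of_tendsto_cdf fun x => ?_
    refine tendsto_cdf_of_ae (μs := fun K => normLaw ν (k K j) (a K) (b K)) (μ := limitLaw ξ) ?_ x
    filter_upwards [ae_limitLaw_mem_gevDom ξ] with y hy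
    exact tendsto_cdf_normLaw h (hk.2 j) (fun K => (hk.1 K).1 j) hy
  have hpi := (ProbabilityMeasure.continuous_pi.tendsto _).comp (tendsto_pi_nhds.2 hconv)
  refine ⟨fun K => ?_, a, b, h.1, fun g => ?_⟩
  · simp only [priceLaw_eq_pi]
    infer_instance
  · have := ProbabilityMeasure.tendsto_iff_forall_integral_tendsto.1 hpi g
    refine this.congr fun K => ?_
    rw [← integral_map (f := g) (measurable_normalize (a K) (b K)).aemeasurable
      g.continuous.aestronglyMeasurable, map_normalize_priceLaw]
    rfl


/-! ### Convergence of densities -/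

theorem integrable_of_withDensity {X : Type*} [MeasurableSpace X] {m ρ : Measure X}
    [IsProbabilityMeasure ρ] {d : X → ℝ} (hd : Measurable d) (hd0 : ∀ x, 0 ≤ d x)
    (h : ρ = m.withDensity fun x => ENNReal.ofReal (d x)) : Integrable d m := by
  refine ⟨hd.aestronglyMeasurable, ?_⟩
  rw [hasFiniteIntegral_iff_ofReal (Eventually.of_forall hd0)]
  have h1 : ρ univ = 1 := measure_univ
  rw [h, withDensity_apply _ MeasurableSet.univ, Measure.restrict_univ] at h1
  rw [h1]
  exact ENNReal.one_lt_top

theorem integral_of_withDensity {X : Type*} [MeasurableSpace X] {m ρ : Measure X}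
    {d : X → ℝ} (hd : Measurable d) (hd0 : ∀ x, 0 ≤ d x)
    (h : ρ = m.withDensity fun x => ENNReal.ofReal (d x)) (g : X → ℝ) :
    ∫ x, g x ∂ρ = ∫ x, d x * g x ∂m := by
  rw [h, integral_withDensity_eq_integral_toReal_smul hd.ennreal_ofReal
    (Eventually.of_forall fun _ => ENNReal.ofReal_lt_top)]
  simp only [ENNReal.toReal_ofReal (hd0 _), smul_eq_mul]

/-- Scheffé's lemma, uniformly over functions with values in `[0, 1]`. -/
theorem tendsto_integral_sub_of_tendsto_density {X : Type*} [MeasurableSpace X] {m : Measure X}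
    {ρs : ℕ → Measure X} {ρ : Measure X} [∀ K, IsProbabilityMeasure (ρs K)]
    [IsProbabilityMeasure ρ] {ds : ℕ → X → ℝ} {d : X → ℝ} (hds : ∀ K, Measurable (ds K))
    (hds0 : ∀ K x, 0 ≤ ds K x) (hd : Measurable d) (hd0 : ∀ x, 0 ≤ d x)
    (hρs : ∀ᶠ K in atTop, ρs K = m.withDensity fun x => ENNReal.ofReal (ds K x))
    (hρ : ρ = m.withDensity fun x => ENNReal.ofReal (d x))
    (hlim : ∀ᵐ x ∂m, d x ≠ 0 → Tendsto (fun K => ds K x) atTop (𝓝 (d x)))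
    {φ : ℕ → X → ℝ} (hφ : ∀ K, Measurable (φ K)) (hφ1 : ∀ K x, φ K x ∈ Icc (0 : ℝ) 1) :
    Tendsto (fun K => ∫ x, φ K x ∂(ρs K) - ∫ x, φ K x ∂ρ) atTop (𝓝 0) := by
  have id := integrable_of_withDensity hd hd0 hρ
  have hb : ∀ K x, ‖max (d x - ds K x) 0‖ ≤ d x := fun K x => by
    rw [Real.norm_of_nonneg (le_max_right _ _)]
    exact max_le (by linarith [hds0 K x]) (hd0 x)
  -- Only the deficit is dominated, by `d` itself. It vanishes where `d` is zero, so convergence of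
  -- densities is not needed there.
  have h0 : Tendsto (fun K => ∫ x, max (d x - ds K x) 0 ∂m) atTop (𝓝 0) := by
    have := tendsto_integral_of_dominated_convergence (μ := m)
      (F := fun K x => max (d x - ds K x) 0) (f := fun _ => (0 : ℝ)) d
      (fun K => ((hd.sub (hds K)).max measurable_const).aestronglyMeasurable) id
      (fun K => Eventually.of_forall (hb K)) ?_
    · simpa using this
    · filter_upwards [hlim] with x hx
      by_cases hx0 : d x = 0
      · refine tendsto_const_nhds.congr fun K => ?_
        rw [hx0, max_eq_right]
        linarith [hds0 K x]
      · have := ((hx hx0).const_sub (d x)).max (tendsto_const_nhds (x := (0 : ℝ)))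
        simpa using this
  refine squeeze_zero_norm' ?_ h0
  filter_upwards [hρs] with K hK
  have ids := integrable_of_withDensity (hds K) (hds0 K) hK
  have hφb : ∀ᵐ x ∂m, ‖φ K x‖ ≤ 1 := Eventually.of_forall fun x => by
    rw [Real.norm_of_nonneg (hφ1 K x).1]
    exact (hφ1 K x).2
  have i1 : Integrable (fun x => ds K x * φ K x) m :=
    ids.mul_bdd (c := 1) (hφ K).aestronglyMeasurable hφb
  have i2 : Integrable (fun x => d x * φ K x) m :=
    id.mul_bdd (c := 1) (hφ K).aestronglyMeasurable hφb
  have i3 : Integrable (fun x => max (d x - ds K x) 0) m := id.mono'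
    ((hd.sub (hds K)).max measurable_const).aestronglyMeasurable (Eventually.of_forall (hb K))
  have e1 : ∫ x, ds K x ∂m = 1 := by
    have := integral_of_withDensity (hds K) (hds0 K) hK fun _ => (1 : ℝ)
    simpa using this.symm
  have e2 : ∫ x, d x ∂m = 1 := by
    have := integral_of_withDensity hd hd0 hρ fun _ => (1 : ℝ)
    simpa using this.symm
  rw [integral_of_withDensity (hds K) (hds0 K) hK, integral_of_withDensity hd hd0 hρ,
    Real.norm_eq_abs, abs_le']
  have hpt : ∀ x, ∀ t ∈ Icc (0 : ℝ) 1, (d x - ds K x) * t ≤ max (d x - ds K x) 0 := fun x t ht =>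
    (mul_le_mul_of_nonneg_right (le_max_left _ _) ht.1).trans
      (mul_le_of_le_one_right (le_max_right _ _) ht.2)
  constructor
  · have i4 : Integrable (fun x => d x - ds K x) m := id.sub ids
    have i5 : Integrable (fun x => ds K x * φ K x - d x * φ K x) m := i1.sub i2
    -- Both densities have integral one, so the excess of `φ` equals the deficit of `1 - φ`, and the
    -- same bound serves both signs.
    have h1 : ∫ x, ds K x * φ K x ∂m - ∫ x, d x * φ K x ∂m =
        ∫ x, ((d x - ds K x) + (ds K x * φ K x - d x * φ K x)) ∂m := by
      rw [integral_add i4 i5, integral_sub id ids, integral_sub i1 i2, e1, e2]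
      ring
    rw [h1]
    refine integral_mono (i4.add i5) i3 fun x => ?_
    have := hpt x (1 - φ K x) ⟨sub_nonneg.2 (hφ1 K x).2, by linarith [(hφ1 K x).1]⟩
    simp only
    linarith
  · rw [neg_sub, ← integral_sub i2 i1]
    refine integral_mono (i2.sub i1) i3 fun x => ?_
    simp only
    rw [← sub_mul]
    exact hpt x _ (hφ1 K x)

/-! ### Densities of normalized prices -/

theorem secondLaw_absolutelyContinuous {ν : Measure ℝ} [IsProbabilityMeasure ν]
    (hν : ν ≪ (volume : Measure ℝ)) {m : ℕ} (hm : 2 ≤ m) :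
    secondLaw ν m ≪ (volume : Measure ℝ) := by
  refine Measure.AbsolutelyContinuous.mk fun A hA h0 => ?_
  rw [secondLaw, Measure.map_apply (measurable_secondPrice m) hA]
  refine measure_mono_null (t := ⋃ i : Fin m, Function.eval i ⁻¹' A) (fun x hx => ?_)
    (measure_iUnion_null fun i => ?_)
  · have h : secondPrice x = x (Tuple.sort x ⟨m - 2, by omega⟩) := dif_pos (by omega)
    rw [mem_preimage, h] at hx
    exact mem_iUnion.2 ⟨_, hx⟩
  · rw [(measurePreserving_eval (fun _ : Fin m => ν) i).measure_preimage hA.nullMeasurableSet]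
    exact hν h0

theorem normLaw_absolutelyContinuous {ν : Measure ℝ} [IsProbabilityMeasure ν]
    (hν : ν ≪ (volume : Measure ℝ)) {m : ℕ} (hm : 2 ≤ m) {a : ℝ} (ha : 0 < a) (b : ℝ) :
    normLaw ν m a b ≪ (volume : Measure ℝ) := by
  refine Measure.AbsolutelyContinuous.mk fun A hA h0 => ?_
  rw [normLaw, Measure.map_apply (measurable_sub_div a b) hA]
  refine secondLaw_absolutelyContinuous hν hm ?_
  have e : (fun x : ℝ => (x - b) / a) ⁻¹' A =
      (fun x => x + -b) ⁻¹' ((fun x => x * a⁻¹) ⁻¹' A) := by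
    ext x
    simp only [mem_preimage, div_eq_mul_inv, sub_eq_add_neg]
  rw [e, measure_preimage_add_right, Real.volume_preimage_mul_right (inv_ne_zero ha.ne'), h0,
    mul_zero]

/-- A density of the normalized price law. -/
def normDensity (ν : Measure ℝ) (m : ℕ) (a b : ℝ) (y : ℝ) : ℝ :=
  ((normLaw ν m a b).rnDeriv volume y).toReal

theorem measurable_normDensity (ν : Measure ℝ) (m : ℕ) (a b : ℝ) :
    Measurable (normDensity ν m a b) := (Measure.measurable_rnDeriv _ _).ennreal_toReal

theorem normLaw_eq_withDensity {ν : Measure ℝ} [IsProbabilityMeasure ν]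
    (hν : ν ≪ (volume : Measure ℝ)) {m : ℕ} (hm : 2 ≤ m) {a : ℝ} (ha : 0 < a) (b : ℝ) :
    normLaw ν m a b = (volume : Measure ℝ).withDensity fun y =>
      ENNReal.ofReal (normDensity ν m a b y) := by
  have h := Measure.withDensity_rnDeriv_eq (normLaw ν m a b) volume
    (normLaw_absolutelyContinuous hν hm ha b)
  refine h.symm.trans (withDensity_congr_ae ?_)
  filter_upwards [Measure.rnDeriv_lt_top (normLaw ν m a b) volume] with y hy
  exact (ENNReal.ofReal_toReal hy.ne).symm

/-- The derivative of `secondCdf`. -/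
theorem hasDerivAt_secondCdf {m : ℕ} (hm : 2 ≤ m) (u : ℝ) :
    HasDerivAt (secondCdf m) (m * ((m - 1 : ℕ) : ℝ) * u ^ (m - 2) * (1 - u)) u := by
  have h1 := (hasDerivAt_pow m u).add ((((hasDerivAt_pow (m - 1) u).const_mul (m : ℝ))).mul
    ((hasDerivAt_id u).const_sub 1))
  refine h1.congr_deriv ?_
  rw [show m - 1 - 1 = m - 2 by omega]
  simp only [id]
  ring

/-- Almost everywhere the density is the derivative of the CDF by Lebesgue differentiation, and the
CDF is `secondCdf` of the monotone, hence almost everywhere differentiable, CDF of one draw.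
Uniqueness of derivatives identifies the two expressions. -/
theorem ae_normDensity_eq {ν : Measure ℝ} [IsProbabilityMeasure ν] {m : ℕ} (hm : 2 ≤ m) {a : ℝ}
    (ha : 0 < a) (b : ℝ) :
    ∀ᵐ y : ℝ, ∃ u', HasDerivAt (fun y => cdf ν (a * y + b)) u' y ∧ normDensity ν m a b y =
      m * ((m - 1 : ℕ) : ℝ) * cdf ν (a * y + b) ^ (m - 2) * (1 - cdf ν (a * y + b)) * u' := by
  have hmono : Monotone fun y => cdf ν (a * y + b) := fun x y hxy =>
    monotone_cdf ν (by linarith [mul_le_mul_of_nonneg_left hxy ha.le])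
  filter_upwards [hmono.ae_differentiableAt, (cdf (normLaw ν m a b)).ae_hasDerivAt] with y h1 h2
  refine ⟨_, h1.hasDerivAt, ?_⟩
  rw [measure_cdf] at h2
  have e : (cdf (normLaw ν m a b) : ℝ → ℝ) = secondCdf m ∘ fun y => cdf ν (a * y + b) :=
    funext fun x => cdf_normLaw ν hm ha b x
  have h3 := (hasDerivAt_secondCdf hm (cdf ν (a * y + b))).comp y h1.hasDerivAt
  rw [← e] at h3
  exact h2.unique h3

/-- The density of `limitLaw ξ`. -/
def limitLawDensity (ξ y : ℝ) : ℝ :=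
  (gevDom ξ).indicator (fun y => Real.exp (-((2 + ξ) * gevLog ξ y)) *
    Real.exp (-Real.exp (-gevLog ξ y))) y

theorem measurable_limitLawDensity (ξ : ℝ) : Measurable (limitLawDensity ξ) := by
  have := measurable_gevLog ξ
  exact Measurable.indicator (by fun_prop) (isOpen_gevDom ξ).measurableSet

theorem limitLawDensity_nonneg (ξ y : ℝ) : 0 ≤ limitLawDensity ξ y :=
  indicator_nonneg (fun _ _ => by positivity) y

theorem limitLaw_eq_withDensity_volume (ξ : ℝ) : limitLaw ξ =
    (volume : Measure ℝ).withDensity fun y => ENNReal.ofReal (limitLawDensity ξ y) := by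
  rw [limitLaw_eq_withDensity, ← withDensity_indicator (isOpen_gevDom ξ).measurableSet]
  congr 1
  ext y
  by_cases hy : y ∈ gevDom ξ
  · simp [limitLawDensity, hy]
  · simp [limitLawDensity, hy]

theorem hasDerivAt_gev {ξ y : ℝ} (hy : y ∈ gevDom ξ) :
    HasDerivAt (gev ξ) (Real.exp (-Real.exp (-gevLog ξ y)) *
      Real.exp (-((1 + ξ) * gevLog ξ y))) y := by
  have h := ((hasDerivAt_gevLog hy).fun_neg.exp.fun_neg).exp
  have h2 : HasDerivAt (gev ξ) _ y := h.congr_of_eventuallyEq (by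
    filter_upwards [(isOpen_gevDom ξ).mem_nhds hy] with x hx using gev_eq hx)
  refine h2.congr_deriv ?_
  have e : Real.exp (-((1 + ξ) * gevLog ξ y)) =
      Real.exp (-gevLog ξ y) * Real.exp (-(ξ * gevLog ξ y)) := by
    rw [← Real.exp_add]; congr 1; ring
  rw [e]
  ring

/-- Convergence of the density of the normalized maximum implies that of the normalized second
price. -/
theorem tendsto_normDensity {ν : Measure ℝ} [IsProbabilityMeasure ν] {ξ : ℝ} {a b : ℕ → ℝ}
    (h : IsNormalizing ν ξ a b)
    (hd : ∀ᵐ x : ℝ, Tendsto (fun K : ℕ => deriv (fun y : ℝ => (cdf ν (a K * y + b K)) ^ K) x)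
      atTop (𝓝 (deriv (gev ξ) x)))
    {m : ℕ → ℕ} (hm : Tendsto (fun K : ℕ => (m K : ℝ) / K) atTop (𝓝 1)) (hmK : ∀ K, K ≤ m K) :
    ∀ᵐ y : ℝ, y ∈ gevDom ξ →
      Tendsto (fun K => normDensity ν (m K) (a K) (b K) y) atTop (𝓝 (limitLawDensity ξ y)) := by
  have hall : ∀ᵐ y : ℝ, ∀ K, 2 ≤ K → ∃ u', HasDerivAt (fun y => cdf ν (a K * y + b K)) u' y ∧
      normDensity ν (m K) (a K) (b K) y = m K * ((m K - 1 : ℕ) : ℝ) *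
        cdf ν (a K * y + b K) ^ (m K - 2) * (1 - cdf ν (a K * y + b K)) * u' := by
    rw [ae_all_iff]
    intro K
    by_cases hK : 2 ≤ K
    · filter_upwards [ae_normDensity_eq (ν := ν) (hK.trans (hmK K)) (h.1 K) (b K)] with y hy _
      exact hy
    · exact Eventually.of_forall fun y hy => absurd hy hK
  filter_upwards [hall, hd] with y hy hdy hdom
  set τ := Real.exp (-gevLog ξ y) with hτ
  set u : ℕ → ℝ := fun K => cdf ν (a K * y + b K) with hu
  have h0 : ∀ K, 0 ≤ u K := fun K => cdf_nonneg ν _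
  have h1 : ∀ K, u K ≤ 1 := fun K => cdf_le_one ν _
  have hpow : Tendsto (fun K => u K ^ K) atTop (𝓝 (Real.exp (-τ))) := h.tendsto_pow hdom
  have hid : Tendsto (fun K : ℕ => (K : ℝ) / K) atTop (𝓝 1) := by
    refine tendsto_const_nhds.congr' ?_
    filter_upwards [eventually_ne_atTop 0] with K hK
    rw [div_self (Nat.cast_ne_zero.2 hK)]
  -- The derivative of `u ^ K` is `K u ^ (K - 1) u'`; dividing by the limit of `u ^ (K - 1)`
  -- isolates the limit of `K u'`.
  have hpow1 := tendsto_pow_of_div h0 hpow (tendsto_sub_div hid (fun K => le_rfl) 1)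
  rw [(hasDerivAt_gev hdom).deriv] at hdy
  have hder := hdy.div hpow1 (Real.exp_pos _).ne'
  rw [mul_div_cancel_left₀ _ (Real.exp_pos _).ne'] at hder
  -- The density is split as `(m / K) ((m - 1) / K) u ^ (m - 2)` times `K (1 - u)` times `K u'`, and
  -- each factor converges.
  have hprod := (((hm.mul (tendsto_sub_div hm hmK 1)).mul
    (tendsto_pow_of_div h0 hpow (tendsto_sub_div hm hmK 2))).mul
      (tendsto_mul_one_sub h0 h1 hpow)).mul hder
  have elim : 1 * 1 * Real.exp (-τ) * τ * Real.exp (-((1 + ξ) * gevLog ξ y)) =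
      limitLawDensity ξ y := by
    rw [limitLawDensity, indicator_of_mem hdom, hτ]
    have : Real.exp (-((2 + ξ) * gevLog ξ y)) =
        Real.exp (-gevLog ξ y) * Real.exp (-((1 + ξ) * gevLog ξ y)) := by
      rw [← Real.exp_add]; congr 1; ring
    rw [this]
    ring
  rw [elim] at hprod
  refine hprod.congr' ?_
  filter_upwards [eventually_ge_atTop 2, eventually_pos_of_tendsto_pow h0 hpow] with K hK hpos
  obtain ⟨u', hu', e⟩ := hy K hK
  have hdp : deriv (fun y : ℝ => (cdf ν (a K * y + b K)) ^ K) y = K * u K ^ (K - 1) * u' :=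
    (hu'.fun_pow K).deriv
  have hK0 : (K : ℝ) ≠ 0 := Nat.cast_ne_zero.2 (by omega)
  have hp0 : u K ^ (K - 1) ≠ 0 := (pow_pos hpos _).ne'
  rw [e, Pi.div_apply, hdp]
  change _ = m K * ((m K - 1 : ℕ) : ℝ) * u K ^ (m K - 2) * (1 - u K) * u'
  field_simp

/-! ### Rejection probabilities under convergent densities -/

theorem IsEquivariantTest.apply_normalize {n : ℕ} {φ : ℕ → (Fin n → ℝ) → ℝ}
    (hφ : IsEquivariantTest φ) (K : ℕ) {a : ℝ} (ha : 0 < a) (b : ℝ) (p : Fin n → ℝ) :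
    φ K (fun j => (p j - b) / a) = φ K p := by
  rw [← hφ.equivariant K 1 a⁻¹ (-b / a) p (inv_pos.2 ha)]
  congr 1
  ext j
  simp only [Equiv.Perm.coe_one, id]
  field_simp
  ring

/-- Normalizing the prices does not change the test, and the normalized laws converge in total
variation. The tests may therefore vary with `K` and need no continuity. -/
theorem tendsto_integral_test_sub {n : ℕ} {ν : Measure ℝ} [IsProbabilityMeasure ν]
    (hν : ν ≪ (volume : Measure ℝ)) {ξ : ℝ} (hloc : InLocalDomain ν ξ) {k : ℕ → Fin n → ℕ}
    (hk : IsBidderArray k) {φ : ℕ → (Fin n → ℝ) → ℝ} (hφ : IsEquivariantTest φ) :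
    Tendsto (fun K => ∫ p, φ K p ∂(priceLaw ν (k K)) -
      ∫ x, φ K x ∂(Measure.pi fun _ => limitLaw ξ)) atTop (𝓝 0) := by
  obtain ⟨a, b, h, hd⟩ := hloc
  have e : ∀ K, ∫ p, φ K p ∂(priceLaw ν (k K)) =
      ∫ p, φ K p ∂(Measure.pi fun j => normLaw ν (k K j) (a K) (b K)) := fun K => by
    rw [← map_normalize_priceLaw, integral_map (measurable_normalize (a K) (b K)).aemeasurable
      (hφ.meas K).aestronglyMeasurable]
    simp only [hφ.apply_normalize K (h.1 K)]
  simp only [e]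
  refine tendsto_integral_sub_of_tendsto_density (m := (volume : Measure (Fin n → ℝ)))
    (ds := fun K x => ∏ j, normDensity ν (k K j) (a K) (b K) (x j))
    (d := fun x => ∏ j, limitLawDensity ξ (x j))
    (fun K => Finset.measurable_prod _ fun j _ =>
      (measurable_normDensity _ _ _ _).comp (measurable_pi_apply j))
    (fun K x => Finset.prod_nonneg fun j _ => ENNReal.toReal_nonneg)
    (Finset.measurable_prod _ fun j _ =>
      (measurable_limitLawDensity ξ).comp (measurable_pi_apply j))
    (fun x => Finset.prod_nonneg fun j _ => limitLawDensity_nonneg ξ _) ?_ ?_ ?_ hφ.meas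
    hφ.mem_Icc
  · filter_upwards [eventually_ge_atTop 2] with K hK
    have ej : ∀ j, normLaw ν (k K j) (a K) (b K) = (volume : Measure ℝ).withDensity fun y =>
        ENNReal.ofReal (normDensity ν (k K j) (a K) (b K) y) := fun j =>
      normLaw_eq_withDensity hν (hK.trans ((hk.1 K).1 j)) (h.1 K) (b K)
    have hs : ∀ j, SigmaFinite ((volume : Measure ℝ).withDensity fun y =>
        ENNReal.ofReal (normDensity ν (k K j) (a K) (b K) y)) := fun j => by
      rw [← ej]; infer_instance
    have hp := pi_withDensity (fun _ : Fin n => (volume : Measure ℝ))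
      (fun j y => ENNReal.ofReal (normDensity ν (k K j) (a K) (b K) y))
      (fun j => (measurable_normDensity _ _ _ _).ennreal_ofReal)
    rw [show (fun j => normLaw ν (k K j) (a K) (b K)) = _ from funext ej]
    refine hp.trans ?_
    congr 1
    ext x
    exact (ENNReal.ofReal_prod_of_nonneg fun j _ => ENNReal.toReal_nonneg).symm
  · have hs : ∀ _ : Fin n, SigmaFinite ((volume : Measure ℝ).withDensity fun y =>
        ENNReal.ofReal (limitLawDensity ξ y)) := fun _ => by
      rw [← limitLaw_eq_withDensity_volume]; infer_instance
    have hp := pi_withDensity (fun _ : Fin n => (volume : Measure ℝ))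
      (fun _ y => ENNReal.ofReal (limitLawDensity ξ y))
      (fun _ => (measurable_limitLawDensity ξ).ennreal_ofReal)
    simp only [limitLaw_eq_withDensity_volume]
    refine hp.trans ?_
    congr 1
    ext x
    exact (ENNReal.ofReal_prod_of_nonneg fun j _ => limitLawDensity_nonneg ξ _).symm
  · have hae : ∀ᵐ x : Fin n → ℝ, ∀ j, x j ∈ gevDom ξ →
        Tendsto (fun K => normDensity ν (k K j) (a K) (b K) (x j)) atTop
          (𝓝 (limitLawDensity ξ (x j))) := by
      rw [ae_all_iff]
      intro j
      exact (Measure.quasiMeasurePreserving_eval (fun _ : Fin n => (volume : Measure ℝ)) j).ae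
        (tendsto_normDensity h hd (hk.2 j) fun K => (hk.1 K).1 j)
    filter_upwards [hae] with x hx hne
    refine tendsto_finsetProd _ fun j _ => hx j ?_
    -- A nonzero product density puts every coordinate inside the support, where the marginal
    -- densities are known to converge.
    by_contra hj
    refine hne (Finset.prod_eq_zero (Finset.mem_univ j) ?_)
    rw [limitLawDensity, indicator_of_notMem hj]

theorem integral_test_limitLaw {N : ℕ} (ξ : ℝ) {φ : ℕ → (Fin (N + 2) → ℝ) → ℝ}
    (hφ : IsEquivariantTest φ) (K : ℕ) :
    ∫ x, φ K x ∂(Measure.pi fun _ => limitLaw ξ) =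
      ∫ z in simplex N, limitDensity ξ z * φ K (addEnds z) := by
  rw [← integral_selfNormLaw ξ fun z => φ K (addEnds z), ← map_selfNorm_limitLaw,
    integral_map (f := fun z => φ K (addEnds z)) measurable_selfNorm.aemeasurable
      ((hφ.meas K).comp measurable_addEnds).aestronglyMeasurable]
  refine integral_congr_ae ?_
  filter_upwards [ae_limitLaw_pi_injective (N + 2) ξ] with x hx
  exact hφ.apply_eq_addEnds K hx

/-- The Neyman–Pearson inequality in the limit experiment, for each `K` separately: the bound `φ ≤
(1 - q r) + q r φ` is integrated against `f_ξ₁`, and `r f_ξ₁ ≤ f_ξ₀`. -/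
theorem integral_test_limitLaw_le {N : ℕ} (ξ₀ ξ₁ : ℝ) {q : ℝ} (hq : 0 < q)
    {φ : ℕ → (Fin (N + 2) → ℝ) → ℝ} (hφ : IsEquivariantTest φ) (K : ℕ) :
    ∫ x, φ K x ∂(Measure.pi fun _ => limitLaw ξ₁) ≤
      (∫ z, (1 - q * capRatio ξ₀ ξ₁ q z) ∂(selfNormLaw N ξ₁)) +
        q * ∫ x, φ K x ∂(Measure.pi fun _ => limitLaw ξ₀) := by
  have mc := measurable_capRatio (N := N) ξ₀ ξ₁ q
  have mψ : Measurable fun z : Fin N → ℝ => φ K (addEnds z) :=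
    (hφ.meas K).comp measurable_addEnds
  rw [integral_test_limitLaw ξ₁ hφ, integral_test_limitLaw ξ₀ hφ, integral_selfNormLaw,
    ← integral_const_mul]
  have i1 := integrable_limitDensity_mul ξ₁ mψ (B := 1) fun z => hφ.abs_le K _
  have i0 := (integrable_limitDensity_mul ξ₀ mψ (B := 1) fun z => hφ.abs_le K _).const_mul q
  have i2 := integrable_limitDensity_mul ξ₁ ((mc.const_mul q).const_sub 1)
    (abs_one_sub_capRatio_le ξ₀ ξ₁ hq)
  rw [← integral_add i2 i0]
  refine setIntegral_mono_on i1 (i2.add i0) (measurableSet_simplex N) fun z hz => ?_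
  have hx := hφ.mem_Icc K (addEnds z)
  have h1 := mul_le_mul_of_nonneg_left (le_one_sub_capRatio_add ξ₀ ξ₁ hq z hx.2)
    (limitDensity_nonneg ξ₁ hz)
  have h2 := mul_le_mul_of_nonneg_left (mul_le_mul_of_nonneg_right
    (capRatio_mul_le ξ₀ ξ₁ q hz) hx.1) hq.le
  linarith

/-- Both auction laws are replaced by their limits at vanishing cost, so size control under a single
null process already controls the size in the limit experiment and no matched process is needed. -/
theorem limsup_le_of_inLocalDomain {N : ℕ} (hN : 1 ≤ N) {ξ₀ ξ₁ : ℝ} (hξ : ξ₀ ≠ ξ₁)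
    {α : ℝ} (hα₀ : 0 < α) (hα₁ : α < 1) {φ : ℕ → (Fin (N + 2) → ℝ) → ℝ}
    (hφ : IsEquivariantTest φ) {ν₀ ν₁ : Measure ℝ} {k₀ k₁ : ℕ → Fin (N + 2) → ℕ}
    (hν₀ : IsValuationLaw ν₀) (hl₀ : InLocalDomain ν₀ ξ₀) (hk₀ : IsBidderArray k₀)
    (hν₁ : IsValuationLaw ν₁) (hl₁ : InLocalDomain ν₁ ξ₁) (hk₁ : IsBidderArray k₁)
    (hv : ValidUnder α φ (fun K => priceLaw ν₀ (k₀ K))) :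
    limsup (fun K => ∫ p, φ K p ∂(priceLaw ν₁ (k₁ K))) atTop ≤
      limsup (fun K => ∫ p, lrTest ξ₀ ξ₁ α p ∂(priceLaw ν₁ (k₁ K))) atTop := by
  have hq := critValue_pos hN hξ hα₀ hα₁
  have hp₀ := hν₀.isProb
  have hp₁ := hν₁.isProb
  have hdom : ∀ {ν ξ}, InLocalDomain ν ξ → InDomain ν ξ := fun ⟨a, b, h, _⟩ => ⟨a, b, h⟩
  have hP₀ := isPriceModel_priceLaw (hdom hl₀) hk₀
  have hP₁ := isPriceModel_priceLaw (hdom hl₁) hk₁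
  have hPp₀ := hP₀.1
  have hPp₁ := hP₁.1
  have t₀ := tendsto_integral_test_sub hν₀.absCont hl₀ hk₀ hφ
  have t₁ := tendsto_integral_test_sub hν₁.absCont hl₁ hk₁ hφ
  rw [(hP₁.tendsto_lrTest hN hξ α).limsup_eq, ← integral_one_sub_capRatio hN hξ hα₀ hα₁]
  have hA := (t₁.add_const (∫ z, (1 - critValue N ξ₀ ξ₁ α *
    capRatio ξ₀ ξ₁ (critValue N ξ₀ ξ₁ α) z) ∂(selfNormLaw N ξ₁))).sub
    (t₀.const_mul (critValue N ξ₀ ξ₁ α))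
  rw [zero_add, mul_zero, sub_zero] at hA
  refine limsup_le_of_le_add_mul (m := fun _ => 1) hq.le
    (fun K => (integral_test_mem_Icc hφ K _).1) (fun _ => zero_le_one)
    (fun K => integral_test_mem_Icc hφ K _) (fun K => ?_) hA tendsto_const_nhds hv
  have := integral_test_limitLaw_le ξ₀ ξ₁ hq hφ K
  linarith

end Auction

end

theorem theorem3 (N : ℕ) (hN : 1 ≤ N) (ξ₀ ξ₁ : ℝ) (hξ : ξ₀ ≠ ξ₁) (α : ℝ) (hα₀ : 0 < α)
    (hα₁ : α < 1) :
    -- second-price auctions in the domain of attraction of `G_ξ` have tail index `ξ`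
    (∀ (ξ : ℝ) (ν : Measure ℝ) (k : ℕ → Fin (N + 2) → ℕ), Auction.IsValuationLaw ν →
      Auction.InDomain ν ξ → Auction.IsBidderArray k →
      Auction.IsPriceModel ξ (fun K => Auction.priceLaw ν (k K))) ∧
    -- the size of the likelihood-ratio test is asymptotically exactly `α`
    (∀ (ν : Measure ℝ) (k : ℕ → Fin (N + 2) → ℕ), Auction.IsValuationLaw ν →
      Auction.InDomain ν ξ₀ → Auction.IsBidderArray k →
      Tendsto (fun K => ∫ p, Auction.lrTest ξ₀ ξ₁ α p ∂(Auction.priceLaw ν (k K)))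
        atTop (𝓝 α)) ∧
    -- the likelihood-ratio test is an equivariant, asymptotically valid test
    (Auction.IsEquivariantTest
        (fun (_ : ℕ) (p : Fin (N + 2) → ℝ) => Auction.lrTest ξ₀ ξ₁ α p) ∧
      Auction.IsAsymptoticallyValid ξ₀ α
        (fun (_ : ℕ) (p : Fin (N + 2) → ℝ) => Auction.lrTest ξ₀ ξ₁ α p)) ∧
    -- it is asymptotically most powerful among such tests
    (∀ φ : ℕ → (Fin (N + 2) → ℝ) → ℝ, Auction.IsEquivariantTest φ →
      Auction.IsAsymptoticallyValid ξ₀ α φ →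
      ∀ (ν : Measure ℝ) (k : ℕ → Fin (N + 2) → ℕ), Auction.IsValuationLaw ν →
        Auction.InDomain ν ξ₁ → Auction.IsBidderArray k →
        limsup (fun K => ∫ p, φ K p ∂(Auction.priceLaw ν (k K))) atTop ≤
          limsup (fun K => ∫ p, Auction.lrTest ξ₀ ξ₁ α p ∂(Auction.priceLaw ν (k K))) atTop) ∧
    -- where densities converge too, validity under one auction process with index `ξ₀` suffices
    (∀ φ : ℕ → (Fin (N + 2) → ℝ) → ℝ, Auction.IsEquivariantTest φ →
      ∀ (ν₀ ν₁ : Measure ℝ) (k₀ k₁ : ℕ → Fin (N + 2) → ℕ),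
        Auction.IsValuationLaw ν₀ → Auction.InLocalDomain ν₀ ξ₀ → Auction.IsBidderArray k₀ →
        Auction.IsValuationLaw ν₁ → Auction.InLocalDomain ν₁ ξ₁ → Auction.IsBidderArray k₁ →
        Auction.ValidUnder α φ (fun K => Auction.priceLaw ν₀ (k₀ K)) →
        limsup (fun K => ∫ p, φ K p ∂(Auction.priceLaw ν₁ (k₁ K))) atTop ≤
          limsup (fun K => ∫ p, Auction.lrTest ξ₀ ξ₁ α p ∂(Auction.priceLaw ν₁ (k₁ K)))
            atTop) := by
  have hprice : ∀ {ξ : ℝ} {ν : Measure ℝ} {k : ℕ → Fin (N + 2) → ℕ}, Auction.IsValuationLaw ν →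
      Auction.InDomain ν ξ → Auction.IsBidderArray k →
      Auction.IsPriceModel ξ (fun K => Auction.priceLaw ν (k K)) := fun hν hd hk =>
    have := hν.isProb
    Auction.isPriceModel_priceLaw hd hk
  have hsize : ∀ {P : ℕ → Measure (Fin (N + 2) → ℝ)}, Auction.IsPriceModel ξ₀ P →
      Tendsto (fun K => ∫ p, Auction.lrTest ξ₀ ξ₁ α p ∂(P K)) atTop (𝓝 α) := fun hP => by
    have h := hP.tendsto_lrTest hN hξ α
    rwa [Auction.integral_rejects, Auction.selfNormLaw_critValue_lt hN hξ hα₀ hα₁] at h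
  exact ⟨fun ξ ν k hν hd hk => hprice hν hd hk,
    fun ν k hν hd hk => hsize (hprice hν hd hk),
    ⟨Auction.isEquivariantTest_lrTest N ξ₀ ξ₁ α, fun P hP => (hsize hP).limsup_eq.le⟩,
    fun φ hφ hv ν k hν hd hk =>
      Auction.limsup_le_of_isAsymptoticallyValid hN hξ hα₀ hα₁ hφ hv (hprice hν hd hk),
    fun φ hφ ν₀ ν₁ k₀ k₁ hν₀ hl₀ hk₀ hν₁ hl₁ hk₁ hv =>
      Auction.limsup_le_of_inLocalDomain hN hξ hα₀ hα₁ hφ hν₀ hl₀ hk₀ hν₁ hl₁ hk₁ hv⟩
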